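/- **Setting.** Let $k\ge 1$ and let $\Lambda$ be a (nonempty) finite $k$-graph, i.e. a small category with a degree functor $d:\Lambda\to\mathbb N^k$ that has the factorisation property and for which every $\Lambda^n:=d^{-1}(n)$ is finite. Write $r(\lambda)$ and $s(\lambda)$ for the range and source of a path $\lambda$, $\Lambda^0$ for the set of vertices, and $v\Lambda^n:=\{\lambda\in\Lambda^n:r(\lambda)=v\}$. Assume that $\Lambda$ has no sources ($v\Lambda^n\neq\emptyset$ for all $v\in\Lambda^0$, $n\in\mathbb N^k$) and is coordinatewise irreducible: each vertex matrix $A_i=(|v\Lambda^{e_i}w|)_{v,w\in\Lambda^0}$, $1\le i\le k$, is irreducible (for all $v,w$ some $A_i^n(v,w)\ne0$). Let $\rho(A_i)$ be the spectral radius. The matrices $A_i$ have the same unimodular Perron–Frobenius eigenvector $\kappa$, that is, the unique $\kappa\in(0,\infty)^{\Lambda^0}$ with $\sum_v\kappa_v=1$ and $A_i\kappa=\rho(A_i)\kappa$. Let $J\sqcup K=\{1,\dots,k\}$ be a partition with $J,K\neq\emptyset$, and let $\mathbf r=(r_1,\dots,r_k)\in(0,\infty)^k$ satisfy $r_j>\ln\rho(A_j)$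 for $j\in J$ and $r_i=\ln\rho(A_i)$ for $i\in K$. Put $\mathbf r\cdot n=\sum_i r_in_i$ and $C_J:=\prod_{j\in J}(1-e^{-r_j}\rho(A_j))$. For $n\in(\mathbb N\cup\{\infty\})^k$ let $\Omega_{k,n}$ be the category with objects $\{p\in\mathbb N^k:p\le n\}$ and one morphism $(p,q)$, with range $p$, source $q$ and degree $q-p$, for each $p\le q\le n$. The path space $W_\Lambda$ consists of the degree-preserving functors $x:\Omega_{k,n}\to\Lambda$ for all $n$ (write $d(x)=n$, $r(x)=x(0)$); put $Z(\lambda)=\{x\in W_\Lambda:d(x)\ge d(\lambda),\ x(0,d(\lambda))=\lambda\}$. The topology of $W_\Lambda$ is generated by the sets $Z(\lambda)\setminus\bigcup_{\alpha\in G}Z(\lambda\alpha)$ with $\lambda\in\Lambda$ and $G\subset s(\lambda)\Lambda$ finite. For $m\in\mathbb N^J$ let $\Lambda^{m,\infty_K}=\{x\in W_\Lambda:d(x)_J=m,\ d(x)_i=\infty\text{ for }i\in K\}$, with the subspace topology, and let $\partial^K\Lambda=\bigcup_{m\in\mathbb N^J}\Lambda^{m,\infty_K}$. Write $\Lambda^{m,n}=d^{-1}(m,n)$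 for $m\in\mathbb N^J$, $n\in\mathbb N^K$. Let $\mathcal TC^*(\Lambda)$ be the $C^*$-algebra generated by a universal Toeplitz–Cuntz–Krieger $\Lambda$-family $\{t_\lambda\}$, that is, a universal family of partial isometries such that (T1) the $t_v$, $v\in\Lambda^0$, are mutually orthogonal projections; (T2) $t_\lambda t_\mu=t_{\lambda\mu}$ if $s(\lambda)=r(\mu)$; (T3) $t_\lambda^*t_\lambda=t_{s(\lambda)}$; (T4) $t_v\ge\sum_{\lambda\in v\Lambda^n}t_\lambda t_\lambda^*$ for all $v\in\Lambda^0$, $n\in\mathbb N^k$; (T5) $t_\mu^*t_\nu=\sum t_\eta t_\zeta^*$, the sum being over all pairs $(\eta,\zeta)$ with $\mu\eta=\nu\zeta$ and $d(\mu\eta)=d(\mu)\vee d(\nu)$. Let $\gamma$ be the gauge action of $\mathbb T^k$, $\gamma_z(t_\lambda)=z^{d(\lambda)}t_\lambda$; let $\Phi^\gamma(a)=\int_{\mathbb T^k}\gamma_z(a)\,dz$ (normalised Haar measure); let $\alpha^{\mathbf r}_t=\gamma_{(e^{itr_1},\dots,e^{itr_k})}$. Let $\{\xi_{m,x}:m\in\mathbb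 N^J,x\in\Lambda^{m,\infty_K}\}$ be the point masses in $\ell^2(\partial^K\Lambda)$, and let $\pi^K:\mathcal TC^*(\Lambda)\to B(\ell^2(\partial^K\Lambda))$ be the representation with $\pi^K(t_\lambda)\xi_{m,x}=\xi_{m+d(\lambda)_J,\lambda x}$ if $s(\lambda)=r(x)$ and $\pi^K(t_\lambda)\xi_{m,x}=0$ otherwise. A KMS$_1$ state of $(\mathcal TC^*(\Lambda),\alpha^{\mathbf r})$ is a state $\phi$ with $\phi(ab)=\phi(b\,\alpha^{\mathbf r}_{i}(a))$ for all analytic $a,b$, where $a$ is analytic if $t\mapsto\alpha^{\mathbf r}_t(a)$ extends to an entire function $z\mapsto\alpha^{\mathbf r}_z(a)$. **Theorem.** (a) For each $m\in\mathbb N^J$ there is a Borel measure $\nu^m$ on $\Lambda^{m,\infty_K}$ such that, for all $n\in\mathbb N^K$ and $\lambda\in\Lambda^{m,n}$, $$\nu^m(Z(\lambda)\cap\Lambda^{m,\infty_K})=e^{-\mathbf r\cdot d(\lambda)}\,C_J\,\kappa_{s(\lambda)}.$$ (b) These measures satisfy, for all $m\in\mathbb N^J$, $n\in\mathbb N^K$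 and $\lambda\in\Lambda^{m,n}$, $$\sum_{l\in\mathbb N^J}\nu^l(Z(\lambda)\cap\Lambda^{l,\infty_K})=\sum_{l\ge m}\nu^l(Z(\lambda)\cap\Lambda^{l,\infty_K})=e^{-\mathbf r\cdot d(\lambda)}\kappa_{s(\lambda)}.$$ (c) There is a bounded linear functional $\phi$ on $\mathcal TC^*(\Lambda)$ such that, for every $a$ (in particular for $a\ge0$), the integrands below are integrable, the series converges absolutely, and $$\phi(a)=\sum_{m\in\mathbb N^J}\int\big(\pi^K(\Phi^\gamma(a))\xi_{m,x}\mid\xi_{m,x}\big)\,d\nu^m(x).$$ This $\phi$ is a KMS$_1$ state of $(\mathcal TC^*(\Lambda),\alpha^{\mathbf r})$ and satisfies $\phi(t_\sigma t_\tau^*)=\delta_{\sigma,\tau}e^{-\mathbf r\cdot d(\sigma)}\kappa_{s(\sigma)}$ for all $\sigma,\tau\in\Lambda$. It factors through the quotient of $\mathcal TC^*(\Lambda)$ by the closed two-sided ideal generated by $\{t_v-\sum_{e\in v\Lambda^{e_i}}t_et_e^*:v\in\Lambda^0,\ i\in K\}$, that is, it vanishes on this ideal; and $\phi\big(t_v-\sum_{e\in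 v\Lambda^{e_j}}t_et_e^*\big)\ne0$ for all $j\in J$ and $v\in\Lambda^0$. (d) If $r_1,\dots,r_k$ are rationally independent, then $\phi$ is the only KMS$_1$ state of $(\mathcal TC^*(\Lambda),\alpha^{\mathbf r})$. -/

import Mathlib

open MeasureTheory
open scoped ENNReal

universe u

/-- A finite `k`-graph: a small category with objects `V` and morphisms ("paths") `P`, together
with a degree functor `d : P → ℕᵏ` having the factorisation property, such that there are only
finitely many paths of each degree. A path `l` goes from its source `s l` to its range `r l`; the
composite `comp l m` is meaningful only when `s l = r m` (no axiom mentions it otherwise), and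
`vtx v` is the identity morphism at `v`. -/
structure FiniteKGraph (k : ℕ) (V P : Type u) where
  r : P → V
  s : P → V
  vtx : V → P
  comp : P → P → P
  d : P → Fin k → ℕ
  r_vtx : ∀ v, r (vtx v) = v
  s_vtx : ∀ v, s (vtx v) = v
  r_comp : ∀ l m, s l = r m → r (comp l m) = r l
  s_comp : ∀ l m, s l = r m → s (comp l m) = s m
  vtx_comp : ∀ l, comp (vtx (r l)) l = l
  comp_vtx : ∀ l, comp l (vtx (s l)) = l
  assoc : ∀ l m n, s l = r m → s m = r n → comp (comp l m) n = comp l (comp m n)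
  d_vtx : ∀ v, d (vtx v) = 0
  d_comp : ∀ l m, s l = r m → d (comp l m) = d l + d m
  factor : ∀ l (m n : Fin k → ℕ), d l = m + n →
    ∃! p : P × P, s p.1 = r p.2 ∧ d p.1 = m ∧ d p.2 = n ∧ comp p.1 p.2 = l
  finite_deg : ∀ n, {l | d l = n}.Finite

namespace FiniteKGraph

variable {k : ℕ} {V P : Type u} (Λ : FiniteKGraph k V P)

/-- No sources: `vΛⁿ` is non-empty for every vertex `v` and every degree `n`. -/
def NoSources : Prop := ∀ v (n : Fin k → ℕ), ∃ l, Λ.r l = v ∧ Λ.d l = n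

/-- The vertex matrices `A_i(v,w) = |vΛ^{e_i}w|`. -/
noncomputable def vertexMatrix (i : Fin k) : Matrix V V ℕ := fun v w =>
  {l | Λ.d l = Pi.single i 1 ∧ Λ.r l = v ∧ Λ.s l = w}.ncard

/-- Each vertex matrix `A` is irreducible: for all `v, w` there is `n` with `Aⁿ(v,w) ≠ 0`. -/
def CoordinatewiseIrreducible [Fintype V] [DecidableEq V] : Prop :=
  ∀ i v w, ∃ n : ℕ, (Λ.vertexMatrix i ^ n) v w ≠ 0

open Classical in
/-- `vΛⁿ`, the finite set of paths of degree `n` with range `v`. -/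
noncomputable def pathsFrom (v : V) (n : Fin k → ℕ) : Finset P :=
  (Λ.finite_deg n).toFinset.filter fun l => Λ.r l = v

theorem mem_pathsFrom {v : V} {n : Fin k → ℕ} {l : P} :
    l ∈ Λ.pathsFrom v n ↔ Λ.d l = n ∧ Λ.r l = v := by
  simp [pathsFrom]

open Classical in
/-- `Λ^min(m,n)`: the pairs `(a,b)` with `ma = nb` of degree `d(m) ∨ d(n)`. -/
noncomputable def minExt (m n : P) : Finset (P × P) :=
  ((Λ.finite_deg (Λ.d m ⊔ Λ.d n - Λ.d m)).toFinset ×ˢ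
    (Λ.finite_deg (Λ.d m ⊔ Λ.d n - Λ.d n)).toFinset).filter fun p =>
      Λ.s m = Λ.r p.1 ∧ Λ.s n = Λ.r p.2 ∧ Λ.comp m p.1 = Λ.comp n p.2

theorem mem_minExt {m n : P} {p : P × P} :
    p ∈ Λ.minExt m n ↔ Λ.s m = Λ.r p.1 ∧ Λ.s n = Λ.r p.2 ∧ Λ.comp m p.1 = Λ.comp n p.2 ∧
      Λ.d (Λ.comp m p.1) = Λ.d m ⊔ Λ.d n := by
  simp only [minExt, Finset.mem_filter, Finset.mem_product, Set.Finite.mem_toFinset,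
    Set.mem_ofPred_eq]
  constructor
  · rintro ⟨⟨h1, h2⟩, h3, h4, h5⟩
    refine ⟨h3, h4, h5, ?_⟩
    rw [Λ.d_comp _ _ h3, h1, add_tsub_cancel_of_le le_sup_left]
  · rintro ⟨h3, h4, h5, h6⟩
    refine ⟨⟨?_, ?_⟩, h3, h4, h5⟩
    · rw [← h6, Λ.d_comp _ _ h3, add_tsub_cancel_left]
    · rw [← h6, h5, Λ.d_comp _ _ h4, add_tsub_cancel_left]

/-! ### Cancellation and initial segments -/

theorem comp_inj {a b a' b' : P} (h : Λ.s a = Λ.r b) (h' : Λ.s a' = Λ.r b')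
    (hd : Λ.d a = Λ.d a') (he : Λ.comp a b = Λ.comp a' b') : a = a' ∧ b = b' := by
  have hdd : Λ.d b = Λ.d b' := by
    have := Λ.d_comp a b h
    rw [he, Λ.d_comp _ _ h', hd] at this
    exact (add_left_cancel this).symm
  have := (Λ.factor (Λ.comp a b) (Λ.d a) (Λ.d b) (Λ.d_comp _ _ h)).unique
    (y₁ := (a, b)) (y₂ := (a', b')) ⟨h, rfl, rfl, rfl⟩ ⟨h', hd.symm, hdd.symm, he.symm⟩
  exact ⟨congrArg Prod.fst this, congrArg Prod.snd this⟩

theorem eq_vtx {l : P} (h : Λ.d l = 0) : l = Λ.vtx (Λ.r l) := by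
  have := Λ.comp_inj (a := Λ.vtx (Λ.r l)) (b := l) (a' := l) (b' := Λ.vtx (Λ.s l))
    (Λ.s_vtx _) (Λ.r_vtx _).symm (by rw [Λ.d_vtx, h]) (by rw [Λ.vtx_comp, Λ.comp_vtx])
  exact this.1.symm

/-- `a` is an initial segment of `l`. -/
def IsPre (a l : P) : Prop := ∃ b, Λ.s a = Λ.r b ∧ Λ.comp a b = l

variable {Λ}

theorem IsPre.refl (l : P) : Λ.IsPre l l := ⟨Λ.vtx (Λ.s l), (Λ.r_vtx _).symm, Λ.comp_vtx l⟩

theorem IsPre.trans {a b c : P} (h : Λ.IsPre a b) (h' : Λ.IsPre b c) : Λ.IsPre a c := by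
  obtain ⟨x, hx, rfl⟩ := h
  obtain ⟨y, hy, rfl⟩ := h'
  rw [Λ.s_comp _ _ hx] at hy
  exact ⟨Λ.comp x y, by rw [Λ.r_comp _ _ hy, hx], (Λ.assoc _ _ _ hx hy).symm⟩

theorem IsPre.d_le {a l : P} (h : Λ.IsPre a l) : Λ.d a ≤ Λ.d l := by
  obtain ⟨x, hx, rfl⟩ := h
  rw [Λ.d_comp _ _ hx]; exact le_self_add

theorem IsPre.eq {a b l : P} (h : Λ.IsPre a l) (h' : Λ.IsPre b l) (hd : Λ.d a = Λ.d b) :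
    a = b := by
  obtain ⟨x, hx, hl⟩ := h
  obtain ⟨y, hy, hl'⟩ := h'
  exact (Λ.comp_inj hx hy hd (hl.trans hl'.symm)).1

variable (Λ)

theorem exists_pre (l : P) (q : Fin k → ℕ) (h : q ≤ Λ.d l) : ∃ a, Λ.IsPre a l ∧ Λ.d a = q := by
  obtain ⟨p, ⟨h1, h2, -, h3⟩, -⟩ := Λ.factor l q (Λ.d l - q) (add_tsub_cancel_of_le h).symm
  exact ⟨p.1, ⟨p.2, h1, h3⟩, h2⟩

variable {Λ} in
theorem IsPre.of_le {a b l : P} (h : Λ.IsPre a l) (h' : Λ.IsPre b l) (hd : Λ.d a ≤ Λ.d b) :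
    Λ.IsPre a b := by
  obtain ⟨c, hc, hcd⟩ := Λ.exists_pre b (Λ.d a) hd
  rwa [h.eq (hc.trans h') hcd.symm]

theorem comp_isPre (l : P) {a b : P} (h : Λ.IsPre a b) (hl : Λ.s l = Λ.r a) :
    Λ.IsPre (Λ.comp l a) (Λ.comp l b) := by
  obtain ⟨x, hx, rfl⟩ := h
  exact ⟨x, by rw [Λ.s_comp _ _ hl, hx], Λ.assoc _ _ _ hl hx⟩

/-- The initial segment `l(0,q)` of degree `q` of a finite path `l`. -/
noncomputable def pre (l : P) (q : Fin k → ℕ) (h : q ≤ Λ.d l) : P := (Λ.exists_pre l q h).choose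

theorem pre_isPre (l : P) (q : Fin k → ℕ) (h : q ≤ Λ.d l) : Λ.IsPre (Λ.pre l q h) l :=
  (Λ.exists_pre l q h).choose_spec.1

theorem d_pre (l : P) (q : Fin k → ℕ) (h : q ≤ Λ.d l) : Λ.d (Λ.pre l q h) = q :=
  (Λ.exists_pre l q h).choose_spec.2

theorem IsPre.r_eq {a l : P} (h : Λ.IsPre a l) : Λ.r a = Λ.r l := by
  obtain ⟨x, hx, rfl⟩ := h
  rw [Λ.r_comp _ _ hx]

section rest

variable {Λ} {a l : P} (h : Λ.IsPre a l)

/-- The path `b` with `ab = l`. -/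
noncomputable def IsPre.rest : P := h.choose

theorem IsPre.r_rest : Λ.r h.rest = Λ.s a := h.choose_spec.1.symm

theorem IsPre.comp_rest : Λ.comp a h.rest = l := h.choose_spec.2

theorem IsPre.s_rest : Λ.s h.rest = Λ.s l := by
  rw [← Λ.s_comp _ _ h.r_rest.symm, h.comp_rest]

theorem IsPre.d_rest : Λ.d h.rest = Λ.d l - Λ.d a := by
  have := Λ.d_comp _ _ h.r_rest.symm
  rw [h.comp_rest] at this
  rw [this, add_tsub_cancel_left]

theorem IsPre.rest_of_d_zero (hd : Λ.d a = 0) : h.rest = l := by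
  have h1 : ∀ b, Λ.s a = Λ.r b → Λ.comp a b = b := by
    intro b hb
    have h0 := Λ.eq_vtx hd
    rw [h0, Λ.s_vtx] at hb
    rw [h0, hb, Λ.vtx_comp]
  rw [← h1 _ h.r_rest.symm, h.comp_rest]

end rest

/-! ### The path space -/

/-- `p ≤ n` for `p ∈ ℕᵏ` and `n ∈ (ℕ ∪ {∞})ᵏ`. -/
def Below (p : Fin k → ℕ) (n : Fin k → ℕ∞) : Prop := ∀ i, (p i : ℕ∞) ≤ n i

theorem Below.mono {p q : Fin k → ℕ} {n : Fin k → ℕ∞} (h : Below q n) (hp : p ≤ q) : Below p n :=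
  fun i => le_trans (by exact_mod_cast hp i) (h i)

theorem Below.zero (n : Fin k → ℕ∞) : Below 0 n := fun i => by simp

/-- The path space `W_Λ`: all degree-preserving functors `Ω_{k,n} → Λ`, for all degrees
`deg = n ∈ (ℕ ∪ {∞})ᵏ`. The objects of `Ω_{k,n}` are the `p ∈ ℕᵏ` with `p ≤ n`, and it has a unique
morphism `(p,q)`, with range `p`, source `q` and degree `q - p`, whenever `p ≤ q ≤ n`. -/
structure PathSpace where
  deg : Fin k → ℕ∞
  obj : ∀ p : Fin k → ℕ, Below p deg → V
  mor : ∀ p q : Fin k → ℕ, p ≤ q → Below q deg → P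
  r_mor : ∀ p q (hpq : p ≤ q) (hq : Below q deg), Λ.r (mor p q hpq hq) = obj p (hq.mono hpq)
  s_mor : ∀ p q (hpq : p ≤ q) (hq : Below q deg), Λ.s (mor p q hpq hq) = obj q hq
  mor_id : ∀ p (hp : Below p deg), mor p p le_rfl hp = Λ.vtx (obj p hp)
  mor_comp : ∀ p q t (hpq : p ≤ q) (hqt : q ≤ t) (ht : Below t deg),
    Λ.comp (mor p q hpq (ht.mono hqt)) (mor q t hqt ht) = mor p t (hpq.trans hqt) ht
  d_mor : ∀ p q (hpq : p ≤ q) (hq : Below q deg), Λ.d (mor p q hpq hq) = q - p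

namespace PathSpace

variable {Λ}

/-- The initial segment `x(0,q)`. -/
def init (x : Λ.PathSpace) (q : Fin k → ℕ) (hq : Below q x.deg) : P := x.mor 0 q zero_le hq

/-- The range `r(x) = x(0)`. -/
def range (x : Λ.PathSpace) : V := x.obj 0 (Below.zero _)

theorem d_init (x : Λ.PathSpace) (q : Fin k → ℕ) (hq : Below q x.deg) : Λ.d (x.init q hq) = q := by
  rw [init, x.d_mor, tsub_zero]

theorem r_init (x : Λ.PathSpace) (q : Fin k → ℕ) (hq : Below q x.deg) :
    Λ.r (x.init q hq) = x.range := x.r_mor _ _ _ _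

theorem s_init (x : Λ.PathSpace) (p q : Fin k → ℕ) (hpq : p ≤ q) (hq : Below q x.deg) :
    Λ.s (x.init p (hq.mono hpq)) = Λ.r (x.mor p q hpq hq) := by
  rw [init, x.s_mor, x.r_mor]

theorem init_comp (x : Λ.PathSpace) (p q : Fin k → ℕ) (hpq : p ≤ q) (hq : Below q x.deg) :
    Λ.comp (x.init p (hq.mono hpq)) (x.mor p q hpq hq) = x.init q hq := x.mor_comp _ _ _ _ _ _

theorem init_isPre (x : Λ.PathSpace) (p q : Fin k → ℕ) (hpq : p ≤ q) (hq : Below q x.deg) :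
    Λ.IsPre (x.init p (hq.mono hpq)) (x.init q hq) :=
  ⟨_, x.s_init p q hpq hq, x.init_comp p q hpq hq⟩

/-- A path is determined by its degree and its initial segments. -/
theorem ext_init {x y : Λ.PathSpace} (hd : x.deg = y.deg)
    (h : ∀ q (hx : Below q x.deg) (hy : Below q y.deg), x.init q hx = y.init q hy) : x = y := by
  have hm : ∀ p q hpq (hx : Below q x.deg) (hy : Below q y.deg),
      x.mor p q hpq hx = y.mor p q hpq hy := by
    intro p q hpq hx hy
    refine (Λ.comp_inj (x.s_init p q hpq hx) (y.s_init p q hpq hy) ?_ ?_).2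
    · rw [x.d_init, y.d_init]
    · rw [x.init_comp, y.init_comp, h]
  have ho : ∀ p (hx : Below p x.deg) (hy : Below p y.deg), x.obj p hx = y.obj p hy := by
    intro p hx hy
    rw [← x.r_mor p p le_rfl hx, ← y.r_mor p p le_rfl hy, hm]
  obtain ⟨n, ox, mx, _, _, _, _, _⟩ := x
  obtain ⟨n', oy, my, _, _, _, _, _⟩ := y
  obtain rfl : n = n' := hd
  obtain rfl : ox = oy := by funext p hp; exact ho p hp hp
  obtain rfl : mx = my := by funext p q hpq hq; exact hm p q hpq hq hq
  rfl

/-- A coherent family of initial segments gives a path. -/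
noncomputable def ofInit (n : Fin k → ℕ∞) (f : ∀ q, Below q n → P)
    (hd : ∀ q hq, Λ.d (f q hq) = q)
    (hf : ∀ p q (hpq : p ≤ q) (hq : Below q n), Λ.IsPre (f p (hq.mono hpq)) (f q hq)) :
    Λ.PathSpace where
  deg := n
  obj p hp := Λ.s (f p hp)
  mor p q hpq hq := (hf p q hpq hq).rest
  r_mor p q hpq hq := (hf p q hpq hq).r_rest
  s_mor p q hpq hq := (hf p q hpq hq).s_rest
  mor_id p hp := by
    refine (Λ.comp_inj (hf p p le_rfl hp).r_rest.symm (Λ.r_vtx _).symm rfl ?_).2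
    rw [(hf p p le_rfl hp).comp_rest, Λ.comp_vtx]
  mor_comp p q t hpq hqt ht := by
    have h1 := hf p q hpq (ht.mono hqt)
    have h2 := hf q t hqt ht
    have h3 := hf p t (hpq.trans hqt) ht
    have h4 : Λ.s h1.rest = Λ.r h2.rest := by rw [h2.r_rest, h1.s_rest]
    refine (Λ.comp_inj ?_ h3.r_rest.symm rfl ?_).2
    · rw [Λ.r_comp _ _ h4, h1.r_rest]
    · rw [← Λ.assoc _ _ _ h1.r_rest.symm h4, h1.comp_rest, h2.comp_rest, h3.comp_rest]
  d_mor p q hpq hq := by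
    rw [(hf p q hpq hq).d_rest, hd, hd]

theorem ofInit_init (n : Fin k → ℕ∞) (f : ∀ q, Below q n → P) (hd) (hf)
    (q : Fin k → ℕ) (hq : Below q n) :
    (ofInit (Λ := Λ) n f hd hf).init q hq = f q hq := by
  exact (hf 0 q zero_le hq).rest_of_d_zero (hd _ _)

/-- The shifted path `x(p,∞)`, given by `(q,t) ↦ x(p+q,p+t)`. -/
def shift (x : Λ.PathSpace) (p : Fin k → ℕ) (hp : Below p x.deg) : Λ.PathSpace :=
  have key : ∀ {q : Fin k → ℕ}, Below q (fun i => x.deg i - p i) → Below (p + q) x.deg := by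
    intro q hq i
    have h1 := hq i
    have h2 := hp i
    rw [Pi.add_apply, Nat.cast_add]
    calc (p i : ℕ∞) + q i ≤ p i + (x.deg i - p i) := by gcongr
      _ = x.deg i := add_tsub_cancel_of_le h2
  { deg := fun i => x.deg i - p i
    obj := fun q hq => x.obj (p + q) (key hq)
    mor := fun q t hqt ht => x.mor (p + q) (p + t) (by gcongr) (key ht)
    r_mor := fun _ _ _ _ => x.r_mor _ _ _ _
    s_mor := fun _ _ _ _ => x.s_mor _ _ _ _
    mor_id := fun _ _ => x.mor_id _ _
    mor_comp := fun _ _ _ _ _ _ => x.mor_comp _ _ _ _ _ _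
    d_mor := fun q t _ _ => by rw [x.d_mor, add_tsub_add_eq_tsub_left] }

/-- The cylinder set `Z(l) = {x : x(0,d(l)) = l}`. -/
def cyl (l : P) : Set Λ.PathSpace := {x | ∃ h : Below (Λ.d l) x.deg, x.init (Λ.d l) h = l}

theorem below_prepend {l : P} {x : Λ.PathSpace} {q : Fin k → ℕ}
    (hq : Below q (fun i => Λ.d l i + x.deg i)) : Below (q ⊔ Λ.d l - Λ.d l) x.deg := by
  intro i
  have h := hq i
  have h2 : ((Λ.d l i : ℕ∞)) ≤ Λ.d l i + x.deg i := le_self_add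
  have h3 : (((q ⊔ Λ.d l) i : ℕ) : ℕ∞) ≤ Λ.d l i + x.deg i := by
    exact max_le h h2
  rw [Pi.sub_apply, ENat.natCast_sub]
  exact tsub_le_iff_left.2 h3

theorem le_d_prepend (l : P) (x : Λ.PathSpace) (h : Λ.s l = x.range) {q : Fin k → ℕ}
    (hq : Below (q ⊔ Λ.d l - Λ.d l) x.deg) : q ≤ Λ.d (Λ.comp l (x.init _ hq)) := by
  rw [Λ.d_comp _ _ (by rw [x.r_init, h]), x.d_init, add_tsub_cancel_of_le le_sup_right]
  exact le_sup_left

/-- The path `lx`, of degree `d(l) + d(x)`, for `s(l) = r(x)`: its initial segment of degree `q` is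
that of the finite path `l x(0, (q ∨ d(l)) - d(l))`. -/
noncomputable def prepend (l : P) (x : Λ.PathSpace) (h : Λ.s l = x.range) : Λ.PathSpace :=
  ofInit (fun i => Λ.d l i + x.deg i)
    (fun q hq => Λ.pre (Λ.comp l (x.init _ (below_prepend hq))) q (le_d_prepend l x h _))
    (fun q hq => Λ.d_pre _ _ _)
    (fun p q hpq hq => by
      refine IsPre.of_le (l := Λ.comp l (x.init _ (below_prepend hq))) ?_ (Λ.pre_isPre _ _ _) ?_
      · refine (Λ.pre_isPre _ _ _).trans (Λ.comp_isPre l ?_ ?_)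
        · exact x.init_isPre _ _ (by gcongr) _
        · rw [x.r_init, h]
      · rw [Λ.d_pre, Λ.d_pre]; exact hpq)

end PathSpace
end FiniteKGraph

namespace FiniteKGraph
variable {k : ℕ} {V P : Type u} (Λ : FiniteKGraph k V P)
namespace PathSpace
variable {Λ}

theorem ext_init_add {x y : Λ.PathSpace} (hd : x.deg = y.deg) (p : Fin k → ℕ)
    (hp : Below p x.deg)
    (h : ∀ q (hx : Below (p + q) x.deg) (hy : Below (p + q) y.deg),
      x.init (p + q) hx = y.init (p + q) hy) : x = y := by
  refine ext_init hd fun q hx hy => ?_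
  have e : p + (q ⊔ p - p) = q ⊔ p := add_tsub_cancel_of_le le_sup_right
  have hB : Below (p + (q ⊔ p - p)) x.deg := by
    rw [e]; intro i; exact max_le (hx i) (hp i)
  have hB' : Below (p + (q ⊔ p - p)) y.deg := hd ▸ hB
  have hq : q ≤ p + (q ⊔ p - p) := by rw [e]; exact le_sup_left
  refine IsPre.eq (x.init_isPre q _ hq hB) ?_ (by rw [x.d_init, y.d_init])
  rw [h _ hB hB']
  exact y.init_isPre q _ hq hB'

theorem init_congr (x : Λ.PathSpace) {p q : Fin k → ℕ} (h : p = q) (hp : Below p x.deg) :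
    x.init p hp = x.init q (h ▸ hp) := by
  subst h; rfl

theorem prepend_init (l : P) (x : Λ.PathSpace) (h : Λ.s l = x.range) (q : Fin k → ℕ)
    (hq : Below q x.deg) (hq' : Below (Λ.d l + q) (prepend l x h).deg) :
    (prepend l x h).init (Λ.d l + q) hq' = Λ.comp l (x.init q hq) := by
  have e : (Λ.d l + q) ⊔ Λ.d l - Λ.d l = q := by
    rw [sup_eq_left.2 le_self_add, add_tsub_cancel_left]
  refine (ofInit_init _ _ _ _ _ _).trans ?_
  refine IsPre.eq (Λ := Λ) (l := Λ.comp l (x.init q hq)) ?_ (IsPre.refl _) ?_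
  · rw [← x.init_congr e (below_prepend hq')]
    exact Λ.pre_isPre _ _ _
  · rw [Λ.d_pre, Λ.d_comp _ _ (by rw [x.r_init, h]), x.d_init]

theorem prepend_deg (l : P) (x : Λ.PathSpace) (h : Λ.s l = x.range) :
    (prepend l x h).deg = fun i => Λ.d l i + x.deg i := rfl

theorem below_add {l : P} {x : Λ.PathSpace} (h : Λ.s l = x.range) {q : Fin k → ℕ}
    (hq : Below q x.deg) : Below (Λ.d l + q) (prepend l x h).deg := fun i => by
  simp only [prepend_deg, Pi.add_apply, Nat.cast_add]
  gcongr
  exact hq i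

theorem init_zero (x : Λ.PathSpace) : x.init 0 (Below.zero _) = Λ.vtx x.range :=
  x.mor_id 0 (Below.zero _)

theorem prepend_mem_cyl (l : P) (x : Λ.PathSpace) (h : Λ.s l = x.range) :
    prepend l x h ∈ (cyl l : Set Λ.PathSpace) := by
  have h0 := prepend_init l x h 0 (Below.zero _) (below_add h (Below.zero _))
  rw [x.init_zero, ← h, Λ.comp_vtx, init_congr _ (add_zero _)] at h0
  exact ⟨_, h0⟩

theorem range_prepend (l : P) (x : Λ.PathSpace) (h : Λ.s l = x.range) :
    (prepend l x h).range = Λ.r l := by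
  obtain ⟨hb, h⟩ := prepend_mem_cyl l x h
  rw [← r_init _ _ hb, h]

theorem range_of_mem_cyl {l : P} {x : Λ.PathSpace} (h : x ∈ cyl l) : x.range = Λ.r l := by
  obtain ⟨hb, h⟩ := h
  rw [← r_init _ _ hb, h]

theorem shift_init (x : Λ.PathSpace) (p : Fin k → ℕ) (hp : Below p x.deg) (q : Fin k → ℕ)
    (hq : Below q (x.shift p hp).deg) (hq' : Below (p + q) x.deg) :
    Λ.comp (x.init p hp) ((x.shift p hp).init q hq) = x.init (p + q) hq' := by
  have h := x.mor_comp 0 (p + 0) (p + q) zero_le (by gcongr; exact zero_le) hq'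
  simp only [shift, init] at h ⊢
  rw [← h]
  congr 1

theorem range_shift (x : Λ.PathSpace) (p : Fin k → ℕ) (hp : Below p x.deg) :
    (x.shift p hp).range = Λ.s (x.init p hp) := by
  simp only [init, x.s_mor, range, shift, add_zero]

theorem below_of_shift (x : Λ.PathSpace) (p : Fin k → ℕ) (hp : Below p x.deg) (q : Fin k → ℕ)
    (hq : Below q (x.shift p hp).deg) : Below (p + q) x.deg := by
  intro i
  have h1 : (q i : ℕ∞) ≤ x.deg i - p i := hq i
  rw [Pi.add_apply, Nat.cast_add]
  calc (p i : ℕ∞) + q i ≤ p i + (x.deg i - p i) := by gcongr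
    _ = x.deg i := add_tsub_cancel_of_le (hp i)

theorem s_of_mem_cyl {l : P} {x : Λ.PathSpace} (h : x ∈ cyl l) :
    Λ.s l = (x.shift (Λ.d l) h.1).range := by
  rw [range_shift, h.2]

theorem prepend_shift {l : P} {x : Λ.PathSpace} (h : x ∈ cyl l) :
    prepend l (x.shift (Λ.d l) h.1) (s_of_mem_cyl h) = x := by
  refine ext_init_add ?_ (Λ.d l) ?_ ?_
  · funext i; exact add_tsub_cancel_of_le (h.1 i)
  · exact (prepend_mem_cyl l _ (s_of_mem_cyl h)).1
  · intro q hx hy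
    have hq : Below q (x.shift (Λ.d l) h.1).deg := by
      intro i
      have h1 := hy i
      rw [Pi.add_apply, Nat.cast_add] at h1
      exact (ENat.addLECancellable_natCast _).le_tsub_of_add_le_left h1
    rw [prepend_init _ _ _ _ hq, ← x.shift_init _ h.1 q hq hy, h.2]

theorem shift_prepend {l : P} {x : Λ.PathSpace} (h : Λ.s l = x.range)
    (hp : Below (Λ.d l) (prepend l x h).deg) : (prepend l x h).shift (Λ.d l) hp = x := by
  refine ext_init ?_ ?_
  · funext i
    exact (ENat.addLECancellable_natCast _).add_tsub_cancel_left
  · intro q hx hy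
    have h1 := shift_init _ _ hp q hx (below_of_shift _ _ hp _ hx)
    rw [prepend_init l x h q hy] at h1
    refine (Λ.comp_inj ?_ ?_ ?_ h1).2
    · rw [r_init, range_shift]
    · rw [r_init, h]
    · rw [d_init]

theorem prepend_comp {l m : P} {x : Λ.PathSpace} (hlm : Λ.s l = Λ.r m) (h : Λ.s m = x.range)
    (h1 : Λ.s l = (prepend m x h).range) (h2 : Λ.s (Λ.comp l m) = x.range) :
    prepend l (prepend m x h) h1 = prepend (Λ.comp l m) x h2 := by
  have hd := Λ.d_comp l m hlm
  refine ext_init_add ?_ (Λ.d (Λ.comp l m)) ?_ ?_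
  · funext i
    simp only [prepend_deg, hd, Pi.add_apply, Nat.cast_add, add_assoc]
  · rw [hd]; exact below_add h1 (prepend_mem_cyl m x h).1
  · intro q hx hy
    have hq : Below q x.deg := fun i => by
      have h1 := hy i
      simp only [prepend_deg, Pi.add_apply, Nat.cast_add] at h1
      exact (ENat.addLECancellable_natCast _).add_le_add_iff_left.1 h1
    rw [prepend_init _ _ _ q hq]
    have e : Λ.d (Λ.comp l m) + q = Λ.d l + (Λ.d m + q) := by rw [hd, add_assoc]
    rw [init_congr _ e, prepend_init _ _ _ _ (below_add h hq), prepend_init _ _ _ q hq,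
      Λ.assoc _ _ _ hlm (by rw [r_init, h])]

theorem prepend_vtx {v : V} {x : Λ.PathSpace} (h : Λ.s (Λ.vtx v) = x.range) :
    prepend (Λ.vtx v) x h = x := by
  have e : Λ.d (Λ.vtx v) = 0 := Λ.d_vtx v
  refine ext_init_add ?_ (Λ.d (Λ.vtx v)) (prepend_mem_cyl _ _ _).1 fun q hx hy => ?_
  · funext i; simp [prepend_deg, e]
  · have hq : Λ.d (Λ.vtx v) + q = q := by rw [e, zero_add]
    have hy' : Below q x.deg := by rwa [hq] at hy
    rw [prepend_init _ _ _ q hy', x.init_congr hq]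
    rw [Λ.s_vtx] at h
    have h2 := Λ.vtx_comp (x.init q hy')
    rw [x.r_init, ← h] at h2
    exact h2

end PathSpace
end FiniteKGraph

namespace FiniteKGraph
variable {k : ℕ} {V P : Type u} (Λ : FiniteKGraph k V P)

/-! ### Topology and semi-infinite paths -/

namespace PathSpace

/-- The topology of `W_Λ`: it is generated by the sets `Z(l ∖ G) = Z(l) ∖ ⋃_{a ∈ G} Z(la)`, for `l`
in `Λ` and `G` a finite set of paths with range `s(l)`. -/
instance : TopologicalSpace Λ.PathSpace :=
  TopologicalSpace.generateFrom {U | ∃ (l : P) (G : Finset P), (∀ a ∈ G, Λ.r a = Λ.s l) ∧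
    U = cyl l \ ⋃ a ∈ G, cyl (Λ.comp l a)}

instance : MeasurableSpace Λ.PathSpace := borel _

instance : BorelSpace Λ.PathSpace := ⟨rfl⟩

end PathSpace

/-- `Λ^{m,∞_K}` for `m ∈ ℕᴶ`, where `J` is the complement of `K`: the paths `x` with `d(x)_J = m`
and `d(x)_K = ∞`. -/
def semiPaths (K : Finset (Fin k)) (m : {j // j ∉ K} → ℕ) : Set Λ.PathSpace :=
  {x | (∀ j : {j // j ∉ K}, x.deg j = m j) ∧ ∀ i ∈ K, x.deg i = ⊤}

/-- The set `∂^K Λ` of semi-infinite paths, the union of the `Λ^{m,∞_K}` over `m ∈ ℕᴶ`. -/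
def semiInf (K : Finset (Fin k)) : Set Λ.PathSpace := ⋃ m, Λ.semiPaths K m

variable {Λ} in
theorem mem_semiInf {K : Finset (Fin k)} {x : Λ.PathSpace} :
    x ∈ Λ.semiInf K ↔ (∀ j ∉ K, x.deg j ≠ ⊤) ∧ ∀ i ∈ K, x.deg i = ⊤ := by
  simp only [semiInf, semiPaths, Set.mem_iUnion, Set.mem_ofPred_eq]
  constructor
  · rintro ⟨m, h1, h2⟩
    exact ⟨fun j hj => by rw [h1 ⟨j, hj⟩]; exact ENat.natCast_ne_top _, h2⟩
  · rintro ⟨h1, h2⟩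
    exact ⟨fun j => (x.deg j).toNat, fun j => (ENat.natCast_toNat (h1 j j.2)).symm, h2⟩

/-- The inclusion of `Λ^{m,∞_K}` into `∂^K Λ`. -/
def toSemiInf (K : Finset (Fin k)) (m : {j // j ∉ K} → ℕ) (x : Λ.semiPaths K m) :
    Λ.semiInf K := ⟨x, Set.mem_iUnion.2 ⟨m, x.2⟩⟩

open PathSpace

variable {Λ} in
theorem prepend_mem {K : Finset (Fin k)} {l : P} {x : Λ.PathSpace} (h : Λ.s l = x.range)
    (hx : x ∈ Λ.semiInf K) : prepend l x h ∈ Λ.semiInf K := by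
  rw [mem_semiInf] at hx ⊢
  refine ⟨fun j hj => ?_, fun i hi => ?_⟩
  · simp [prepend_deg, hx.1 j hj]
  · simp [prepend_deg, hx.2 i hi]

variable {Λ} in
theorem shift_mem {K : Finset (Fin k)} {p : Fin k → ℕ} {x : Λ.PathSpace} (h : Below p x.deg)
    (hx : x ∈ Λ.semiInf K) : x.shift p h ∈ Λ.semiInf K := by
  rw [mem_semiInf] at hx ⊢
  refine ⟨fun j hj => ?_, fun i hi => ?_⟩
  · exact ne_top_of_le_ne_top (hx.1 j hj) tsub_le_self
  · simp [shift, hx.2 i hi]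

open Classical in
/-- The partial bijection `x ↦ lx` of `∂^K Λ`, from `{x : r(x) = s(l)}` onto `Z(l) ∩ ∂^K Λ`. -/
noncomputable def cons (K : Finset (Fin k)) (l : P) : Λ.semiInf K ≃. Λ.semiInf K where
  toFun x := if h : Λ.s l = x.1.range then some ⟨prepend l x.1 h, prepend_mem h x.2⟩ else none
  invFun y := if h : y.1 ∈ cyl l then some ⟨y.1.shift (Λ.d l) h.1, shift_mem h.1 y.2⟩ else none
  inv x y := by
    constructor
    · intro h
      by_cases hy : y.1 ∈ cyl l
      · simp only [hy, dif_pos, Option.some.injEq] at h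
        subst h
        simp only [s_of_mem_cyl hy, dif_pos, prepend_shift hy, Subtype.coe_eta]
      · simp [hy] at h
    · intro h
      by_cases hx : Λ.s l = x.1.range
      · simp only [hx, dif_pos, Option.some.injEq] at h
        subst h
        simp only [prepend_mem_cyl l x.1 hx, dif_pos, shift_prepend hx,
          Subtype.coe_eta]
      · simp [hx] at h

/-- The Hilbert space `ℓ²(∂^K Λ)`. -/
abbrev semiHilbert (K : Finset (Fin k)) : Type u := lp (fun _ : Λ.semiInf K => ℂ) 2

end FiniteKGraph

section pequivOp
variable {X : Type u}

theorem hasSum_pequiv {E : Type*} [AddCommMonoid E] [TopologicalSpace E] (e : X ≃. X) (G : X → E)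
    (a : E) : HasSum (fun y => (e.symm y).elim 0 G) a ↔
      HasSum (fun x => if (e x).isSome then G x else 0) a := by
  have hs : ∀ x : Function.support (fun x => if (e x).isSome then G x else 0),
      (e x).isSome := fun x => by
    by_contra h
    exact x.2 (by simp [h])
  have hg : ∀ x : Function.support (fun x => if (e x).isSome then G x else 0),
      e.symm ((e x).get (hs x)) = some x.1 := fun x => by
    rw [PEquiv.eq_some_iff, Option.some_get]
  refine hasSum_iff_hasSum_of_ne_zero_bij (fun x => (e x).get (hs x)) ?_ ?_ ?_
  · intro x x' h
    have h1 := hg x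
    simp only at h
    rw [h, hg x'] at h1
    exact Subtype.ext (Option.some.inj h1).symm
  · intro y hy
    cases hx : e.symm y with
    | none => simp [hx] at hy
    | some x =>
      have h1 := (PEquiv.eq_some_iff e).1 hx
      refine ⟨⟨x, ?_⟩, ?_⟩
      · simpa [h1, hx] using hy
      · simp [h1]
  · intro x
    simp [hg, hs]

theorem pequiv_aux (e : X ≃. X) (f : lp (fun _ : X => ℂ) 2) :
    ∃ b ≤ ‖f‖ ^ (2 : ℝ), HasSum (fun y => ‖(e.symm y).elim 0 f‖ ^ (2 : ℝ)) b := by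
  have hf := lp.hasSum_norm (p := 2) (by norm_num) f
  simp only [ENNReal.toReal_ofNat] at hf
  have hle : ∀ x, (if (e x).isSome then ‖f x‖ ^ (2 : ℝ) else 0) ≤ ‖f x‖ ^ (2 : ℝ) := fun x => by
    split_ifs
    · exact le_rfl
    · positivity
  have hnn : ∀ x, 0 ≤ (if (e x).isSome then ‖f x‖ ^ (2 : ℝ) else 0) := fun x => by
    split_ifs
    · positivity
    · exact le_rfl
  have hs : Summable fun x => (if (e x).isSome then ‖f x‖ ^ (2 : ℝ) else 0) :=
    Summable.of_nonneg_of_le hnn hle hf.summable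
  refine ⟨_, hasSum_le hle hs.hasSum hf, ?_⟩
  have h := (hasSum_pequiv e (fun x => ‖f x‖ ^ (2 : ℝ)) _).2 hs.hasSum
  convert! h using 2 with y
  cases e.symm y <;> simp

/-- The partial isometry of `ℓ²(X)` that moves the point masses along the partial bijection `e` of
`X`, and kills the point masses at which `e` is not defined (see `pequivOp_single`). -/
noncomputable def pequivOp (e : X ≃. X) :
    lp (fun _ : X => ℂ) 2 →L[ℂ] lp (fun _ : X => ℂ) 2 :=
  LinearMap.mkContinuous
    { toFun := fun f => ⟨fun y => (e.symm y).elim 0 f, by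
        obtain ⟨b, -, hb⟩ := pequiv_aux e f
        exact memℓp_gen (by simpa using hb.summable)⟩
      map_add' := fun f g => by
        ext y
        simp only [lp.coeFn_add, Pi.add_apply]
        cases e.symm y <;> simp
      map_smul' := fun c f => by
        ext y
        simp only [lp.coeFn_smul, Pi.smul_apply]
        cases e.symm y <;> simp } 1 (fun f => by
    obtain ⟨b, hb1, hb⟩ := pequiv_aux e f
    rw [one_mul]
    refine (Real.rpow_le_rpow_iff (norm_nonneg _) (norm_nonneg _)
      (z := 2) (by norm_num)).1 (le_trans (le_of_eq ?_) hb1)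
    have h := lp.hasSum_norm (p := 2) (by norm_num) (⟨fun y => (e.symm y).elim 0 f, by
        exact memℓp_gen (by simpa using hb.summable)⟩ : lp (fun _ : X => ℂ) 2)
    simp only [ENNReal.toReal_ofNat] at h
    exact h.unique hb)

theorem pequivOp_apply (e : X ≃. X) (f : lp (fun _ : X => ℂ) 2) (y : X) :
    pequivOp e f y = (e.symm y).elim 0 f := rfl

theorem pequivOp_trans (e e' : X ≃. X) : pequivOp (e.trans e') = pequivOp e' * pequivOp e := by
  ext f y
  rw [mul_apply_eq_comp, pequivOp_apply, pequivOp_apply]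
  change ((e'.symm y).bind e.symm).elim 0 f = _
  cases e'.symm y with
  | none => rfl
  | some z => simp [pequivOp_apply]

theorem pequivOp_single [DecidableEq X] (e : X ≃. X) (x : X) (c : ℂ) :
    pequivOp e (lp.single 2 x c) = (e x).elim 0 fun y => lp.single 2 y c := by
  ext y
  rw [pequivOp_apply]
  cases hx : e x with
  | none =>
    cases hy : e.symm y with
    | none => rfl
    | some z =>
      have : z ≠ x := by
        rintro rfl
        rw [PEquiv.eq_some_iff, hx] at hy
        cases hy
      simp [this]
  | some w =>
    by_cases hw : w = y
    · subst hw
      rw [(PEquiv.eq_some_iff e).2 hx]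
      simp
    · cases hy : e.symm y with
      | none => simp [Ne.symm hw]
      | some z =>
        have : z ≠ x := by
          rintro rfl
          rw [PEquiv.eq_some_iff, hx] at hy
          exact hw (Option.some.inj hy)
        simp [this, Ne.symm hw]

theorem star_pequivOp (e : X ≃. X) : star (pequivOp e) = pequivOp e.symm := by
  rw [ContinuousLinearMap.star_eq_adjoint]
  refine ((ContinuousLinearMap.eq_adjoint_iff _ _).2 fun f g => ?_).symm
  have h1 := lp.hasSum_inner (𝕜 := ℂ) (pequivOp e.symm f) g
  have h2 := lp.hasSum_inner (𝕜 := ℂ) f (pequivOp e g)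
  have h3 := (hasSum_pequiv e.symm
    (fun x => inner ℂ (f x) (pequivOp e g x)) (inner ℂ (pequivOp e.symm f) g)).1 (by
      convert! h1 using 2 with y
      rw [pequivOp_apply]
      cases hy : e y with
      | none => simp [hy]
      | some x =>
        have hx := (PEquiv.eq_some_iff e).2 hy
        simp [hy, hx, pequivOp_apply])
  refine h3.unique ?_
  convert! h2 using 2 with x
  rw [pequivOp_apply]
  cases e.symm x <;> simp
end pequivOp

namespace FiniteKGraph
variable {k : ℕ} {V P : Type u} (Λ : FiniteKGraph k V P)

/-! ### Toeplitz-Cuntz-Krieger families and the Toeplitz algebra -/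

/-- `T` is a Toeplitz-Cuntz-Krieger `Λ`-family of partial isometries in the C⋆-algebra `B`. In
`T4`, the inequality `T_v ≥ ∑ T_l T_l⋆` says that the difference is a positive element, that is, one
of the form `b⋆b`. -/
structure IsTCK {B : Type*} [NonUnitalCStarAlgebra B] (T : P → B) : Prop where
  partialIsometry : ∀ l, T l * star (T l) * T l = T l
  T1_proj : ∀ v, IsStarProjection (T (Λ.vtx v))
  T1_orth : ∀ v w, v ≠ w → T (Λ.vtx v) * T (Λ.vtx w) = 0
  T2 : ∀ l m, Λ.s l = Λ.r m → T l * T m = T (Λ.comp l m)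
  T3 : ∀ l, star (T l) * T l = T (Λ.vtx (Λ.s l))
  T4 : ∀ v n, ∃ b, T (Λ.vtx v) - ∑ l ∈ Λ.pathsFrom v n, T l * star (T l) = star b * b
  T5 : ∀ m n, star (T m) * T n = ∑ p ∈ Λ.minExt m n, T p.1 * star (T p.2)

theorem IsTCK.norm_le {Λ : FiniteKGraph k V P} {B : Type*} [NonUnitalCStarAlgebra B] {T : P → B}
    (h : Λ.IsTCK T) (l : P) : ‖T l‖ ≤ 1 := by
  have hp := h.T1_proj (Λ.s l)
  have h1 : ‖T (Λ.vtx (Λ.s l))‖ * ‖T (Λ.vtx (Λ.s l))‖ = ‖T (Λ.vtx (Λ.s l))‖ := by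
    rw [← CStarRing.norm_star_mul_self, hp.isSelfAdjoint.star_eq, hp.isIdempotentElem.eq]
  have h2 : ‖T l‖ * ‖T l‖ = ‖T (Λ.vtx (Λ.s l))‖ := by
    rw [← CStarRing.norm_star_mul_self, h.T3]
  by_contra hc
  push Not at hc
  have h3 : 1 < ‖T l‖ * ‖T l‖ := by nlinarith
  rw [h2] at h3
  nlinarith

/-- The inequalities `T4` are automatic. -/
theorem IsTCK.of_T5 {Λ : FiniteKGraph k V P} {B : Type*} [NonUnitalCStarAlgebra B] {T : P → B}
    (h0 : ∀ l, T l * star (T l) * T l = T l)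
    (h1 : ∀ v, IsStarProjection (T (Λ.vtx v)))
    (h1' : ∀ v w, v ≠ w → T (Λ.vtx v) * T (Λ.vtx w) = 0)
    (h2 : ∀ l m, Λ.s l = Λ.r m → T l * T m = T (Λ.comp l m))
    (h3 : ∀ l, star (T l) * T l = T (Λ.vtx (Λ.s l)))
    (h5 : ∀ m n, star (T m) * T n = ∑ p ∈ Λ.minExt m n, T p.1 * star (T p.2)) :
    Λ.IsTCK T where
  partialIsometry := h0
  T1_proj := h1
  T1_orth := h1'
  T2 := h2
  T3 := h3
  T5 := h5
  T4 v n := by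
    set q := ∑ l ∈ Λ.pathsFrom v n, T l * star (T l) with hq
    have hqs : star q = q := by simp [hq, star_sum]
    have hpq : T (Λ.vtx v) * q = q := by
      rw [hq, Finset.mul_sum]
      refine Finset.sum_congr rfl fun l hl => ?_
      have hr := (Λ.mem_pathsFrom.1 hl).2
      rw [← mul_assoc, h2 _ _ (by rw [Λ.s_vtx, hr]), ← hr, Λ.vtx_comp]
    have hps := (h1 v).isSelfAdjoint.star_eq
    have hpp := (h1 v).isIdempotentElem.eq
    have hqp : q * T (Λ.vtx v) = q := by
      have := congrArg star hpq
      rwa [star_mul, hqs, hps] at this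
    have hqq : q * q = q := by
      rw [hq, Finset.sum_mul]
      refine Finset.sum_congr rfl fun l hl => ?_
      rw [Finset.mul_sum, Finset.sum_eq_single l]
      · rw [← mul_assoc, h0]
      · intro m hm hml
        have hE : Λ.minExt l m = ∅ := by
          refine Finset.eq_empty_of_forall_notMem fun p hp => hml ?_
          obtain ⟨a1, a2, a3, -⟩ := Λ.mem_minExt.1 hp
          exact (Λ.comp_inj a2 a1
            ((Λ.mem_pathsFrom.1 hm).1.trans (Λ.mem_pathsFrom.1 hl).1.symm) a3.symm).1
        rw [mul_assoc, ← mul_assoc (star (T l)), h5, hE]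
        simp
      · exact fun h => absurd hl h
    refine ⟨T (Λ.vtx v) - q, ?_⟩
    rw [star_sub, hqs, hps, sub_mul, mul_sub, mul_sub, hpp, hqp, hpq, hqq]
    abel

/-- A Toeplitz-Cuntz-Krieger `Λ`-family in some C⋆-algebra. (Each such family generates a separable
C⋆-algebra, since `Λ` is countable; so all of them occur, up to isomorphism, in any universe.) -/
structure TCKFamily where
  B : Type u
  [inst : NonUnitalCStarAlgebra B]
  T : P → B
  isTCK : Λ.IsTCK T

attribute [instance] TCKFamily.inst

/-- The product (the `ℓ^∞`-direct sum) of the C⋆-algebras over all Toeplitz-Cuntz-Krieger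
families. -/
abbrev bigProduct : Type (u + 1) := lp (fun F : Λ.TCKFamily => F.B) ∞

/-- The family in the product whose coordinates are all the Toeplitz-Cuntz-Krieger families. -/
noncomputable def bigT (l : P) : Λ.bigProduct :=
  ⟨fun F => F.T l, memℓp_infty ⟨1, by rintro _ ⟨F, rfl⟩; exact F.isTCK.norm_le l⟩⟩

/-- The C⋆-subalgebra of the product generated by the family of all Toeplitz-Cuntz-Krieger
families. -/
noncomputable def toeplitzSubalgebra : NonUnitalStarSubalgebra ℂ Λ.bigProduct :=
  (NonUnitalStarAlgebra.adjoin ℂ (Set.range Λ.bigT)).topologicalClosure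

instance : IsClosed (Λ.toeplitzSubalgebra : Set Λ.bigProduct) :=
  NonUnitalStarSubalgebra.isClosed_topologicalClosure _

/-- The Toeplitz algebra `TC⋆(Λ)`: the C⋆-algebra generated by a universal
Toeplitz-Cuntz-Krieger `Λ`-family. -/
abbrev ToeplitzAlgebra : Type (u + 1) := Λ.toeplitzSubalgebra

noncomputable instance : NonUnitalCStarAlgebra Λ.ToeplitzAlgebra :=
  NonUnitalStarSubalgebra.nonUnitalCStarAlgebra _

/-- The universal Toeplitz-Cuntz-Krieger family `t`. -/
noncomputable def t (l : P) : Λ.ToeplitzAlgebra :=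
  ⟨Λ.bigT l, NonUnitalStarSubalgebra.le_topologicalClosure _
    (NonUnitalStarAlgebra.subset_adjoin ℂ _ ⟨l, rfl⟩)⟩

/-- The homomorphism `TC⋆(Λ) → B` given by a Toeplitz-Cuntz-Krieger family in `B`. -/
noncomputable def lift (F : Λ.TCKFamily) : Λ.ToeplitzAlgebra →⋆ₙₐ[ℂ] F.B where
  toFun a := a.1 F
  map_smul' _ _ := rfl
  map_zero' := rfl
  map_add' _ _ := rfl
  map_mul' _ _ := rfl
  map_star' _ := rfl

theorem lift_t (F : Λ.TCKFamily) (l : P) : Λ.lift F (Λ.t l) = F.T l := rfl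

theorem isTCK_t : Λ.IsTCK Λ.t := by
  have key : ∀ a b : Λ.ToeplitzAlgebra, (∀ F, Λ.lift F a = Λ.lift F b) → a = b := fun a b h =>
    Subtype.ext (lp.ext (funext h))
  refine IsTCK.of_T5 (fun l => key _ _ fun F => ?_) (fun v => ⟨key _ _ fun F => ?_,
    key _ _ fun F => ?_⟩) (fun v w h => key _ _ fun F => ?_) (fun l m h => key _ _ fun F => ?_)
    (fun l => key _ _ fun F => ?_) (fun m n => key _ _ fun F => ?_)
  · simpa only [map_mul, map_star, lift_t] using F.isTCK.partialIsometry l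
  · simpa only [map_mul, lift_t] using (F.isTCK.T1_proj v).isIdempotentElem.eq
  · simpa only [map_star, lift_t] using (F.isTCK.T1_proj v).isSelfAdjoint.star_eq
  · simpa only [map_mul, map_zero, lift_t] using F.isTCK.T1_orth v w h
  · simpa only [map_mul, lift_t] using F.isTCK.T2 l m h
  · simpa only [map_mul, map_star, lift_t] using F.isTCK.T3 l
  · simpa only [map_mul, map_star, map_sum, lift_t] using F.isTCK.T5 m n

/-! ### The gauge action -/

/-- `z^n = ∏ zᵢ^{nᵢ}`. -/
noncomputable def mpow (z : Fin k → Circle) (n : Fin k → ℕ) : Circle := ∏ i, z i ^ n i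

theorem IsTCK.twist {Λ : FiniteKGraph k V P} {B : Type*} [NonUnitalCStarAlgebra B] {T : P → B}
    (h : Λ.IsTCK T) (z : Fin k → Circle) :
    Λ.IsTCK fun l => ((mpow z (Λ.d l) : Circle) : ℂ) • T l := by
  have hc : ∀ l : P, star ((mpow z (Λ.d l) : Circle) : ℂ) * ((mpow z (Λ.d l) : Circle) : ℂ) = 1 :=
    fun l => by
      rw [Complex.star_def, ← Complex.normSq_eq_conj_mul_self, Circle.normSq_coe, Complex.ofReal_one]
  have h0 : ∀ v, ((mpow z (Λ.d (Λ.vtx v)) : Circle) : ℂ) = 1 := fun v => by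
    simp [Λ.d_vtx, mpow]
  have hm : ∀ l m, Λ.s l = Λ.r m → ((mpow z (Λ.d (Λ.comp l m)) : Circle) : ℂ) =
    (mpow z (Λ.d l) : Circle) * (mpow z (Λ.d m) : Circle) := fun l m hlm => by
    rw [Λ.d_comp _ _ hlm]; simp [mpow, pow_add, Finset.prod_mul_distrib]
  have hv : ∀ v, ((mpow z (Λ.d (Λ.vtx v)) : Circle) : ℂ) • T (Λ.vtx v) = T (Λ.vtx v) := fun v => by
    rw [h0, one_smul]
  refine IsTCK.of_T5 (fun l => ?_) (fun v => ?_) (fun v w hvw => ?_) (fun l m hlm => ?_)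
    (fun l => ?_) (fun m n => ?_)
  · rw [star_smul, smul_mul_smul_comm, smul_mul_smul_comm, h.partialIsometry, mul_assoc, hc,
      mul_one]
  · rw [hv]; exact h.T1_proj v
  · rw [hv, hv]; exact h.T1_orth v w hvw
  · rw [smul_mul_smul_comm, h.T2 _ _ hlm, hm _ _ hlm]
  · rw [hv, star_smul, smul_mul_smul_comm, hc, one_smul, h.T3]
  · rw [star_smul, smul_mul_smul_comm, h.T5, Finset.smul_sum]
    refine Finset.sum_congr rfl fun p hp => ?_
    obtain ⟨a1, a2, a3, -⟩ := Λ.mem_minExt.1 hp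
    rw [star_smul, smul_mul_smul_comm]
    congr 1
    have e := hm _ _ a1
    rw [a3, hm _ _ a2] at e
    have e1 := hc m
    have e2 := hc p.2
    linear_combination (exp := 1) (star ((mpow z (Λ.d m) : Circle) : ℂ)) *
      (star ((mpow z (Λ.d p.2) : Circle) : ℂ)) * e +
      (-star ((mpow z (Λ.d m) : Circle) : ℂ) * ((mpow z (Λ.d n) : Circle) : ℂ)) * e2 +
      (star ((mpow z (Λ.d p.2) : Circle) : ℂ) * ((mpow z (Λ.d p.1) : Circle) : ℂ)) * e1

/-- The action of `z ∈ 𝕋ᵏ` on the product, by permutation of the coordinates. -/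
noncomputable def bigGauge (z : Fin k → Circle) : Λ.bigProduct →⋆ₙₐ[ℂ] Λ.bigProduct where
  toFun f := ⟨fun F => (f ⟨F.B, _, F.isTCK.twist z⟩ : F.B), memℓp_infty (by
    obtain ⟨C, hC⟩ := memℓp_infty_iff.1 f.2
    exact ⟨C, by rintro _ ⟨F, rfl⟩; exact hC ⟨⟨F.B, _, F.isTCK.twist z⟩, rfl⟩⟩)⟩
  map_smul' _ _ := rfl
  map_zero' := rfl
  map_add' _ _ := rfl
  map_mul' _ _ := rfl
  map_star' _ := rfl

theorem bigGauge_bigT (z : Fin k → Circle) (l : P) :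
    Λ.bigGauge z (Λ.bigT l) = ((mpow z (Λ.d l) : Circle) : ℂ) • Λ.bigT l := rfl

theorem bigGauge_mem (z : Fin k → Circle) (a : Λ.bigProduct) (ha : a ∈ Λ.toeplitzSubalgebra) :
    Λ.bigGauge z a ∈ Λ.toeplitzSubalgebra := by
  have hc : Continuous (Λ.bigGauge z) :=
    AddMonoidHomClass.continuous_of_bound _ 1 fun a => by
      rw [one_mul]; exact NonUnitalStarAlgHom.norm_apply_le _ a
  have h1 := NonUnitalStarSubalgebra.map_topologicalClosure_le
    (NonUnitalStarAlgebra.adjoin ℂ (Set.range Λ.bigT)) hc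
  refine NonUnitalStarSubalgebra.topologicalClosure_mono ?_
    (h1 (NonUnitalStarSubalgebra.mem_map.2 ⟨a, ha, rfl⟩))
  rw [NonUnitalStarSubalgebra.map_le, NonUnitalStarAlgebra.adjoin_le_iff]
  rintro _ ⟨l, rfl⟩
  change Λ.bigGauge z (Λ.bigT l) ∈ NonUnitalStarAlgebra.adjoin ℂ (Set.range Λ.bigT)
  rw [bigGauge_bigT]
  exact SMulMemClass.smul_mem _ (NonUnitalStarAlgebra.subset_adjoin ℂ _ ⟨l, rfl⟩)

/-- The gauge action `γ` of `𝕋ᵏ` on `TC⋆(Λ)`; it satisfies `γ_z(t_l) = z^{d(l)} t_l`. -/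
noncomputable def gauge (z : Fin k → Circle) : Λ.ToeplitzAlgebra →⋆ₙₐ[ℂ] Λ.ToeplitzAlgebra where
  toFun a := ⟨Λ.bigGauge z a, Λ.bigGauge_mem z a a.2⟩
  map_smul' _ _ := rfl
  map_zero' := rfl
  map_add' _ _ := rfl
  map_mul' _ _ := rfl
  map_star' _ := rfl

theorem gauge_t (z : Fin k → Circle) (l : P) :
    Λ.gauge z (Λ.t l) = ((mpow z (Λ.d l) : Circle) : ℂ) • Λ.t l := rfl

/-- The expectation `Φ^γ` of `TC⋆(Λ)` onto the fixed-point algebra of `γ`: it averages over the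
gauge action, with respect to the normalised Haar measure of `𝕋ᵏ ≅ (ℝ/ℤ)ᵏ`. -/
noncomputable def expectation (a : Λ.ToeplitzAlgebra) : Λ.ToeplitzAlgebra :=
  ∫ θ : Fin k → UnitAddCircle, Λ.gauge (fun i => AddCircle.toCircle (θ i)) a
    ∂(Measure.pi fun _ => AddCircle.haarAddCircle)

/-- The dynamics `α^r_t = γ_{e^{itr}}`. -/
noncomputable def dynamics (r : Fin k → ℝ) (t : ℝ) : Λ.ToeplitzAlgebra →⋆ₙₐ[ℂ] Λ.ToeplitzAlgebra :=
  Λ.gauge fun i => Circle.exp (t * r i)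

/-! ### The semi-infinite path representation -/

open PathSpace

theorem cons_apply (K : Finset (Fin k)) (l : P) (x : Λ.semiInf K) (h : Λ.s l = x.1.range) :
    Λ.cons K l x = some ⟨prepend l x.1 h, prepend_mem h x.2⟩ := dif_pos h

theorem cons_eq_some {K : Finset (Fin k)} {l : P} {x y : Λ.semiInf K} (h : Λ.cons K l x = some y) :
    ∃ h : Λ.s l = x.1.range, prepend l x.1 h = y.1 := by
  by_cases h' : Λ.s l = x.1.range
  · rw [cons_apply Λ K l x h'] at h
    exact ⟨h', congrArg Subtype.val (Option.some.inj h)⟩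
  · have h2 : Λ.cons K l x = none := dif_neg h'
    rw [h2] at h
    cases h

open Classical in
theorem cons_vtx (K : Finset (Fin k)) (v : V) (x : Λ.semiInf K) :
    Λ.cons K (Λ.vtx v) x = if v = x.1.range then some x else none := by
  split_ifs with h
  · rw [cons_apply Λ K _ x (by rw [Λ.s_vtx, h])]
    exact congrArg some (Subtype.ext (prepend_vtx (by rw [Λ.s_vtx, h])))
  · exact dif_neg (by rw [Λ.s_vtx]; exact h)

theorem cons_vtx_symm (K : Finset (Fin k)) (v : V) :
    (Λ.cons K (Λ.vtx v)).symm = Λ.cons K (Λ.vtx v) := by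
  ext x y
  rw [PEquiv.eq_some_iff, cons_vtx, cons_vtx]
  split_ifs with h1 h2 h2
  · simp [eq_comm]
  · simp only [Option.some.injEq, iff_false]; rintro rfl; exact h2 h1
  · simp only [Option.some.injEq, false_iff]; rintro rfl; exact h1 h2
  · simp

theorem cons_comp (K : Finset (Fin k)) (l m : P) (h : Λ.s l = Λ.r m) :
    (Λ.cons K m).trans (Λ.cons K l) = Λ.cons K (Λ.comp l m) := by
  refine PEquiv.ext fun x => ?_
  change (Λ.cons K m x).bind (Λ.cons K l) = _
  by_cases hx : Λ.s m = x.1.range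
  · have h1 : Λ.s l = (prepend m x.1 hx).range := by rw [range_prepend, h]
    have h2 : Λ.s (Λ.comp l m) = x.1.range := by rw [Λ.s_comp _ _ h, hx]
    rw [cons_apply Λ K m x hx, Option.bind_some, cons_apply Λ K l _ h1, cons_apply Λ K _ x h2]
    exact congrArg some (Subtype.ext (prepend_comp h hx h1 h2))
  · have h1 : Λ.cons K m x = none := dif_neg hx
    have h2 : Λ.cons K (Λ.comp l m) x = none := dif_neg (by rwa [Λ.s_comp _ _ h])
    rw [h1, h2, Option.bind_none]

theorem minExt_cons (K : Finset (Fin k)) {m n : P} {p : P × P} (hp : p ∈ Λ.minExt m n)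
    {x u : Λ.semiInf K} (h : ((Λ.cons K p.1).symm x).bind (Λ.cons K p.2) = some u) :
    (Λ.cons K m x).bind (Λ.cons K n).symm = some u := by
  obtain ⟨a1, a2, a3, -⟩ := Λ.mem_minExt.1 hp
  obtain ⟨w, hw, hu⟩ := Option.bind_eq_some_iff.1 h
  rw [PEquiv.eq_some_iff] at hw
  have e1 := DFunLike.congr_fun (Λ.cons_comp K m p.1 a1) w
  have e2 := DFunLike.congr_fun (Λ.cons_comp K n p.2 a2) w
  change (Λ.cons K p.1 w).bind (Λ.cons K m) = _ at e1
  change (Λ.cons K p.2 w).bind (Λ.cons K n) = _ at e2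
  rw [hw, Option.bind_some, a3, ← e2, hu, Option.bind_some] at e1
  have hs : Λ.s n = u.1.range := by
    obtain ⟨h1, h2⟩ := Λ.cons_eq_some hu
    rw [← h2, range_prepend, a2]
  rw [cons_apply Λ K n u hs] at e1
  rw [e1, Option.bind_some, PEquiv.eq_some_iff, cons_apply Λ K n u hs]

theorem exists_minExt_cons (K : Finset (Fin k)) {m n : P} {x u : Λ.semiInf K}
    (h : (Λ.cons K m x).bind (Λ.cons K n).symm = some u) :
    ∃ p ∈ Λ.minExt m n, ((Λ.cons K p.1).symm x).bind (Λ.cons K p.2) = some u := by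
  obtain ⟨y, hx, hu⟩ := Option.bind_eq_some_iff.1 h
  rw [PEquiv.eq_some_iff] at hu
  have hm : y.1 ∈ cyl m := by
    obtain ⟨h1, h2⟩ := Λ.cons_eq_some hx
    rw [← h2]; exact prepend_mem_cyl _ _ _
  have hn : y.1 ∈ cyl n := by
    obtain ⟨h1, h2⟩ := Λ.cons_eq_some hu
    rw [← h2]; exact prepend_mem_cyl _ _ _
  have hB : Below (Λ.d m ⊔ Λ.d n) y.1.deg := fun i => max_le (hm.1 i) (hn.1 i)
  have pm : Λ.IsPre m (y.1.init _ hB) := by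
    conv => arg 2; rw [← hm.2]
    exact y.1.init_isPre _ _ le_sup_left hB
  have pn : Λ.IsPre n (y.1.init _ hB) := by
    conv => arg 2; rw [← hn.2]
    exact y.1.init_isPre _ _ le_sup_right hB
  have hg : y.1 ∈ cyl (y.1.init _ hB) := by
    have e := y.1.d_init _ hB
    exact ⟨by rwa [e], y.1.init_congr e _⟩
  obtain ⟨w, hw⟩ : ∃ w, Λ.cons K (y.1.init _ hB) w = some y :=
    ⟨⟨_, shift_mem hg.1 y.2⟩, by
      rw [cons_apply Λ K _ _ (s_of_mem_cyl hg)]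
      exact congrArg some (Subtype.ext (prepend_shift hg))⟩
  have e1 := DFunLike.congr_fun (Λ.cons_comp K m pm.rest pm.r_rest.symm) w
  have e2 := DFunLike.congr_fun (Λ.cons_comp K n pn.rest pn.r_rest.symm) w
  rw [pm.comp_rest, hw, PEquiv.trans_eq_some] at e1
  rw [pn.comp_rest, hw, PEquiv.trans_eq_some] at e2
  obtain ⟨x', hx1, hx2⟩ := e1
  obtain ⟨u', hu1, hu2⟩ := e2
  obtain rfl : x' = x := (Λ.cons K m).inj hx2 hx
  obtain rfl : u' = u := (Λ.cons K n).inj hu2 hu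
  refine ⟨(pm.rest, pn.rest), Λ.mem_minExt.2 ⟨pm.r_rest.symm, pn.r_rest.symm, ?_, ?_⟩, ?_⟩
  · rw [pm.comp_rest, pn.comp_rest]
  · rw [pm.comp_rest, y.1.d_init]
  · rw [(PEquiv.eq_some_iff _).2 hx1, Option.bind_some, hu1]

theorem minExt_unique (K : Finset (Fin k)) {m n : P} {p q : P × P} (hp : p ∈ Λ.minExt m n)
    (hq : q ∈ Λ.minExt m n) {x w w' : Λ.semiInf K} (h : (Λ.cons K p.1).symm x = some w)
    (h' : (Λ.cons K q.1).symm x = some w') : p = q := by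
  obtain ⟨a1, a2, a3, a4⟩ := Λ.mem_minExt.1 hp
  obtain ⟨b1, b2, b3, b4⟩ := Λ.mem_minExt.1 hq
  rw [PEquiv.eq_some_iff] at h h'
  obtain ⟨h1, h2⟩ := Λ.cons_eq_some h
  obtain ⟨h1', h2'⟩ := Λ.cons_eq_some h'
  have hd : Λ.d p.1 = Λ.d q.1 := by
    have := b4.trans a4.symm
    rw [Λ.d_comp _ _ a1, Λ.d_comp _ _ b1] at this
    exact (add_left_cancel this).symm
  have hx : x.1 ∈ cyl p.1 := h2 ▸ prepend_mem_cyl p.1 w.1 h1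
  have hx' : x.1 ∈ cyl q.1 := h2' ▸ prepend_mem_cyl q.1 w'.1 h1'
  have e1 : p.1 = q.1 := by rw [← hx.2, ← hx'.2, init_congr _ hd]
  have e2 : p.2 = q.2 := by
    refine (Λ.comp_inj a2 b2 rfl ?_).2
    rw [← a3, ← b3, e1]
  exact Prod.ext e1 e2

theorem isTCK_semi (K : Finset (Fin k)) : Λ.IsTCK fun l => pequivOp (Λ.cons K l) := by
  have h2 : ∀ l m, Λ.s l = Λ.r m →
      pequivOp (Λ.cons K l) * pequivOp (Λ.cons K m) = pequivOp (Λ.cons K (Λ.comp l m)) :=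
    fun l m h => by rw [← pequivOp_trans, cons_comp _ _ _ _ h]
  have h3 : ∀ l, star (pequivOp (Λ.cons K l)) * pequivOp (Λ.cons K l) =
      pequivOp (Λ.cons K (Λ.vtx (Λ.s l))) := fun l => by
    rw [star_pequivOp, ← pequivOp_trans]
    congr 1
    refine PEquiv.ext fun x => ?_
    change (Λ.cons K l x).bind (Λ.cons K l).symm = _
    rw [cons_vtx]
    split_ifs with h
    · have h1 := Λ.cons_apply K l x h
      rw [h1, Option.bind_some, PEquiv.eq_some_iff, h1]
    · have h1 : Λ.cons K l x = none := dif_neg h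
      rw [h1, Option.bind_none]
  refine IsTCK.of_T5 (fun l => ?_) (fun v => ⟨?_, ?_⟩) (fun v w hvw => ?_) h2 h3 (fun m n => ?_)
  · rw [mul_assoc, h3, h2 _ _ (Λ.r_vtx _).symm, Λ.comp_vtx]
  · have h := h2 (Λ.vtx v) (Λ.vtx v) (by rw [Λ.s_vtx, Λ.r_vtx])
    have h1 := Λ.vtx_comp (Λ.vtx v)
    rw [Λ.r_vtx] at h1
    rwa [h1] at h
  · change star _ = _
    rw [star_pequivOp, cons_vtx_symm]
  · ext f x
    rw [← pequivOp_trans, pequivOp_apply]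
    change (((Λ.cons K (Λ.vtx v)).symm x).bind (Λ.cons K (Λ.vtx w)).symm).elim 0 f = 0
    rw [cons_vtx_symm, cons_vtx_symm, cons_vtx]
    split_ifs with h
    · rw [Option.bind_some, cons_vtx, if_neg (by rintro rfl; exact hvw h)]; rfl
    · rfl
  · have e1 : star (pequivOp (Λ.cons K m)) * pequivOp (Λ.cons K n) =
        pequivOp ((Λ.cons K n).trans (Λ.cons K m).symm) := by
      rw [star_pequivOp, ← pequivOp_trans]
    have e2 : ∀ p : P × P, pequivOp (Λ.cons K p.1) * star (pequivOp (Λ.cons K p.2)) =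
        pequivOp ((Λ.cons K p.2).symm.trans (Λ.cons K p.1)) := fun p => by
      rw [star_pequivOp, ← pequivOp_trans]
    simp only [e1, e2]
    ext f x
    have e3 : ∀ S : Finset (P × P), (∑ p ∈ S, pequivOp ((Λ.cons K p.2).symm.trans
        (Λ.cons K p.1))) f x = ∑ p ∈ S, (((Λ.cons K p.1).symm x).bind (Λ.cons K p.2)).elim 0 f := by
      intro S
      rw [sum_apply, lp.coeFn_sum, Finset.sum_apply]
      rfl
    rw [e3, pequivOp_apply]
    change ((Λ.cons K m x).bind (Λ.cons K n).symm).elim 0 f = _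
    cases h : (Λ.cons K m x).bind (Λ.cons K n).symm with
    | none =>
      symm
      refine Finset.sum_eq_zero fun p hp => ?_
      cases h' : ((Λ.cons K p.1).symm x).bind (Λ.cons K p.2) with
      | none => rfl
      | some u => rw [Λ.minExt_cons K hp h'] at h; cases h
    | some u =>
      obtain ⟨p, hp, hpu⟩ := Λ.exists_minExt_cons K h
      rw [Finset.sum_eq_single p, hpu]
      · intro q hq hqp
        cases h' : ((Λ.cons K q.1).symm x).bind (Λ.cons K q.2) with
        | none => rfl
        | some u' =>
          obtain ⟨w, hw, -⟩ := Option.bind_eq_some_iff.1 hpu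
          obtain ⟨w', hw', -⟩ := Option.bind_eq_some_iff.1 h'
          exact absurd (Λ.minExt_unique K hq hp hw' hw) hqp
      · exact fun h => absurd hp h

/-- The representation `π^K` of `TC⋆(Λ)` on `ℓ²(∂^K Λ)` with `π^K(t_l) = T_l`, where `T_l` maps the
point mass at `x` to the point mass at `lx` if `s(l) = r(x)`, and to `0` otherwise. -/
noncomputable def semiRep (K : Finset (Fin k)) :
    Λ.ToeplitzAlgebra →⋆ₙₐ[ℂ] (Λ.semiHilbert K →L[ℂ] Λ.semiHilbert K) :=
  Λ.lift ⟨_, _, Λ.isTCK_semi K⟩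

/-- The point mass `ξ_{m,x}`, for `x ∈ Λ^{m,∞_K}`. -/
noncomputable def pointMass (K : Finset (Fin k)) (m : {j // j ∉ K} → ℕ) (x : Λ.semiPaths K m) :
    Λ.semiHilbert K := by
  classical exact lp.single 2 (Λ.toSemiInf K m x) 1

theorem add_d_mem_semiPaths {K : Finset (Fin k)} {m : {j // j ∉ K} → ℕ} {l : P}
    (x : Λ.semiPaths K m) (h : Λ.s l = x.1.range) :
    prepend l x.1 h ∈ Λ.semiPaths K fun j => m j + Λ.d l j := by
  refine ⟨fun j => ?_, fun i hi => ?_⟩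
  · simp [prepend_deg, x.2.1 j, add_comm]
  · simp [prepend_deg, x.2.2 i hi]

open Classical in
/-- The defining formula of the semi-infinite path representation. -/
theorem semiRep_t_pointMass (K : Finset (Fin k)) (m : {j // j ∉ K} → ℕ) (x : Λ.semiPaths K m)
    (l : P) : Λ.semiRep K (Λ.t l) (Λ.pointMass K m x) =
      if h : Λ.s l = x.1.range then
        Λ.pointMass K (fun j => m j + Λ.d l j) ⟨prepend l x.1 h, Λ.add_d_mem_semiPaths x h⟩
      else 0 := by
  have h1 : Λ.pointMass K m x = lp.single 2 (Λ.toSemiInf K m x) 1 := rfl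
  have h2 : Λ.semiRep K (Λ.t l) = pequivOp (Λ.cons K l) := rfl
  rw [h1, h2, pequivOp_single]
  split_ifs with h
  · rw [cons_apply Λ K l _ h]; rfl
  · have h3 : Λ.cons K l (Λ.toSemiInf K m x) = none := dif_neg h
    rw [h3]; rfl

/-- `t_v - ∑_{e ∈ vΛ^{e_i}} t_e t_e⋆`. -/
noncomputable def gap (v : V) (i : Fin k) : Λ.ToeplitzAlgebra :=
  Λ.t (Λ.vtx v) - ∑ e ∈ Λ.pathsFrom v (Pi.single i 1), Λ.t e * star (Λ.t e)

/-- The element `(m,n)` of `ℕᵏ = ℕᴶ × ℕᴷ`, where `J` is the complement of `K`. -/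
def joinDeg (K : Finset (Fin k)) (m : {j // j ∉ K} → ℕ) (n : {i // i ∈ K} → ℕ) : Fin k → ℕ :=
  fun i => if h : i ∈ K then n ⟨i, h⟩ else m ⟨i, h⟩

end FiniteKGraph

/-- `r · n = ∑ rᵢ nᵢ`. -/
def degDot {k : ℕ} (r : Fin k → ℝ) (n : Fin k → ℕ) : ℝ := ∑ i, r i * n i

/-! ### Perron-Frobenius eigenvectors -/

/-- The spectral radius `ρ(A)` of a matrix of natural numbers. -/
noncomputable def specRad {V : Type*} [Fintype V] [DecidableEq V] (A : Matrix V V ℕ) : ℝ :=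
  (spectralRadius ℂ (A.map (Nat.cast : ℕ → ℂ))).toReal

/-- `κ` is a unimodular Perron-Frobenius eigenvector of `A`: it has positive entries and unit
`1`-norm, and `Aκ = ρ(A)κ`. -/
def IsPerronVector {V : Type*} [Fintype V] [DecidableEq V] (A : Matrix V V ℕ) (κ : V → ℝ) : Prop :=
  (∀ v, 0 < κ v) ∧ ∑ v, κ v = 1 ∧
    Matrix.mulVec (A.map (Nat.cast : ℕ → ℝ)) κ = specRad A • κ

/-! ### States, KMS states and ideals -/

section KMS
variable {A : Type*} [NonUnitalCStarAlgebra A]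

/-- A state: a positive linear functional of norm `1`. -/
def IsState (φ : A →L[ℂ] ℂ) : Prop :=
  (∀ a, 0 ≤ (φ (star a * a)).re ∧ (φ (star a * a)).im = 0) ∧ ‖φ‖ = 1

/-- The entire function `F` extends `t ↦ α_t(a)`. So `a` is analytic for `α` if there is such an
`F`, and then `F(z) = α_z(a)`. -/
def IsAnalyticExtension (α : ℝ → A → A) (a : A) (F : ℂ → A) : Prop :=
  Differentiable ℂ F ∧ ∀ t : ℝ, F t = α t a

/-- `φ` is a KMS state of `(A, α)` with inverse temperature `β`: a state with
`φ(ab) = φ(b α_{iβ}(a))` for all analytic elements `a` and `b`. -/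
def IsKMSState (α : ℝ → A → A) (β : ℝ) (φ : A →L[ℂ] ℂ) : Prop :=
  IsState φ ∧ ∀ (a b : A) (F G : ℂ → A), IsAnalyticExtension α a F → IsAnalyticExtension α b G →
    φ (a * b) = φ (b * F (Complex.I * β))

/-- The closed two-sided ideal generated by `S`. -/
def closedIdeal (S : Set A) : Set A := closure (TwoSidedIdeal.span S : Set A)

end KMS

/-! ### Perron-Frobenius theory of non-negative matrices -/

section PerronFrobenius
variable {V : Type*} [Fintype V]

/-! Put `x_i = e^{-r_i} ρ(A_i)`. This is 1 for `i ∈ K` and less than 1 for `j ∈ J`. The vertex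
matrices commute, because both products of two of them count paths of degree `e_i + e_j`; by
irreducibility they therefore share one Perron-Frobenius vector `κ`. Consequently the weight
`e^{-r·d(λ)} κ_{s(λ)}`, summed over the paths of degree `n` from `v`, is `κ_v ∏ x_i^{n_i}`
(`sum_weight`). Everything about the measures comes from this identity.

In the directions of `K` the weight is conserved, so normalised weights are transition probabilities
of a random walk on the graph. A path `a` of degree `(m,0)` is taken with mass `C_J` times its
weight and is continued by walk steps of degree 1 in every direction of `K`. The law of the
resulting infinite path is the measure of (a): the probabilities telescope to the quotient of the
weights (`stepsLaw_walk`, `pathMeasure_cyl`). The steps are independent coordinates of a product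
measure, one for each pair of a time and a vertex, and the walk reads the coordinate at its current
source. In the directions of `J` each extension by `p` costs `∏ x_j^{p_j}`, so the sum in (b) is a
product of geometric series, which `C_J` normalises. In particular the total mass is 1.

For (c), the diagonal matrix coefficient of `t_σ t_τ⋆` at a point mass, after averaging over the
gauge action, is the indicator of `Z(σ)` if `σ = τ` and is 0 otherwise. Integration gives the stated
values of `φ`. The averages are integrals of vector functionals, whence positivity; they vanish on
the ideal because `π^K` kills each generator, a path of infinite degree in direction `i` having
exactly one initial edge of that colour. The KMS condition follows from the values alone: it holds
for each `t_λ` by computation on monomials (`HasWeights.map_t_mul`), hence for monomials, and the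
identity theorem for entire functions extends it to all analytic elements (`HasWeights.kms`).

For (d), rational independence makes every KMS state vanish off the diagonal, so it is determined by
the vector of its values at the `t_v`. By (T4) this vector is subinvariant for `A_i` at the critical
value `r_i = ln ρ(A_i)`, `i ∈ K`; irreducibility forces it to be a multiple of `κ`, and the norm
fixes the multiple (`kms_eq`). -/

open Matrix in
theorem mulVec_mono_of_nonneg {B : Matrix V V ℝ} (hB : ∀ v w, 0 ≤ B v w) {x y : V → ℝ}
    (h : ∀ v, x v ≤ y v) (v : V) : (B *ᵥ x) v ≤ (B *ᵥ y) v :=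
  Finset.sum_le_sum fun w _ => mul_le_mul_of_nonneg_left (h w) (hB v w)

open Matrix in
theorem eigenvalue_nonneg [Nonempty V] {B : Matrix V V ℝ} (hB : ∀ v w, 0 ≤ B v w) {c : ℝ}
    {x : V → ℝ} (hx : ∀ v, 0 < x v) (hBx : B *ᵥ x = c • x) : 0 ≤ c := by
  obtain ⟨v⟩ := ‹Nonempty V›
  have h1 : 0 ≤ (B *ᵥ x) v := Finset.sum_nonneg fun w _ => mul_nonneg (hB v w) (hx w).le
  rw [hBx, Pi.smul_apply, smul_eq_mul] at h1
  exact nonneg_of_mul_nonneg_left h1 (hx v)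

variable [DecidableEq V]

/-- Irreducibility of a non-negative real matrix, in the form that is used here. -/
def MatIrreducible (B : Matrix V V ℝ) : Prop :=
  (∀ v w, 0 ≤ B v w) ∧ ∀ v w, ∃ n : ℕ, 0 < (B ^ n) v w

open Matrix in
theorem matPow_mulVec_le {B : Matrix V V ℝ} (hB : ∀ v w, 0 ≤ B v w) {c : ℝ} (hc : 0 ≤ c)
    {u : V → ℝ} (h : ∀ v, (B *ᵥ u) v ≤ c * u v) (n : ℕ) :
    ∀ v, (B ^ n *ᵥ u) v ≤ c ^ n * u v := by
  induction n with
  | zero => intro v; simp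
  | succ n ih =>
    intro v
    rw [pow_succ', ← mulVec_mulVec]
    have h1 := mulVec_mono_of_nonneg hB (y := c ^ n • u) (fun w => by simpa using ih w) v
    refine h1.trans ?_
    rw [mulVec_smul, Pi.smul_apply, smul_eq_mul, pow_succ, mul_assoc]
    exact mul_le_mul_of_nonneg_left (h v) (pow_nonneg hc n)

-- Subinvariance iterates to `Bⁿu ≤ cⁿu`. At a zero `v` of `u` the non-negative terms `Bⁿ(v,w) u_w`
-- then sum to at most 0, and irreducibility gives, for each `w`, an `n` with a positive
-- coefficient.
open Matrix in
theorem MatIrreducible.eq_zero {B : Matrix V V ℝ} (hB : MatIrreducible B) {c : ℝ} (hc : 0 ≤ c)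
    {u : V → ℝ} (hu : ∀ v, 0 ≤ u v) (h : ∀ v, (B *ᵥ u) v ≤ c * u v) {v : V} (hv : u v = 0) :
    u = 0 := by
  funext w
  obtain ⟨n, hn⟩ := hB.2 v w
  have h1 := matPow_mulVec_le hB.1 hc h n v
  rw [hv, mul_zero] at h1
  have h2 : (B ^ n) v w * u w ≤ (B ^ n *ᵥ u) v :=
    Finset.single_le_sum (f := fun w => (B ^ n) v w * u w)
      (fun i _ => mul_nonneg (Matrix.pow_apply_nonneg hB.1 n v i) (hu i)) (Finset.mem_univ w)
  have h3 := hu w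
  have h4 : u w ≤ 0 := by
    by_contra h5
    push Not at h5
    have := mul_pos hn h5
    linarith
  exact le_antisymm h4 h3

open Matrix in
/-- A subinvariant vector of an irreducible matrix is a multiple of a positive eigenvector. -/
theorem MatIrreducible.eq_smul [Nonempty V] {B : Matrix V V ℝ} (hB : MatIrreducible B) {c : ℝ}
    (hc : 0 ≤ c) {x y : V → ℝ} (hx : ∀ v, 0 < x v) (hBx : B *ᵥ x = c • x)
    (hy : ∀ v, (B *ᵥ y) v ≤ c * y v) : ∃ t : ℝ, y = t • x := by
  -- Subtract the largest multiple of `x` that stays below `y`. The difference is non-negative,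
  -- still subinvariant, and vanishes at the minimiser, so it is 0. No sign of `y` is needed.
  obtain ⟨v, hv⟩ := Finite.exists_min fun v => y v / x v
  refine ⟨y v / x v, ?_⟩
  have h := hB.eq_zero hc (u := y - (y v / x v) • x) (v := v) (fun w => ?_) (fun w => ?_) ?_
  · exact sub_eq_zero.1 h
  · have h1 := (le_div_iff₀ (hx w)).1 (hv w)
    simpa using h1
  · rw [mulVec_sub, mulVec_smul, hBx]
    simp only [Pi.sub_apply, Pi.smul_apply, smul_eq_mul]
    linarith [hy w]
  · have := (hx v).ne'
    simp only [Pi.sub_apply, Pi.smul_apply, smul_eq_mul]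
    field_simp
    simp

open Matrix in
/-- A positive eigenvector belongs to the spectral radius. -/
theorem specRad_eq [Nonempty V] {A : Matrix V V ℕ} {c : ℝ} {x : V → ℝ} (hx : ∀ v, 0 < x v)
    (h : (A.map (Nat.cast : ℕ → ℝ)) *ᵥ x = c • x) : specRad A = c := by
  have hc : 0 ≤ c := eigenvalue_nonneg (fun v w => by simp) hx h
  have key : ∀ z : ℂ, z ∈ spectrum ℂ (A.map (Nat.cast : ℕ → ℂ)) ↔
      ∃ u : V → ℂ, u ≠ 0 ∧ (A.map (Nat.cast : ℕ → ℂ)) *ᵥ u = z • u := by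
    intro z
    rw [spectrum.mem_iff, Matrix.isUnit_iff_isUnit_det, isUnit_iff_ne_zero, not_not,
      ← Matrix.exists_mulVec_eq_zero_iff]
    refine exists_congr fun u => and_congr_right fun _ => ?_
    rw [sub_mulVec, Algebra.algebraMap_eq_smul_one, smul_mulVec, one_mulVec, sub_eq_zero, eq_comm]
  have h1 : (spectralRadius ℂ (A.map (Nat.cast : ℕ → ℂ))) = ENNReal.ofReal c := by
    refine le_antisymm ?_ ?_
    · refine iSup₂_le fun z hz => ?_
      obtain ⟨u, hu, hAu⟩ := (key z).1 hz
      -- An eigenvector `u` is measured in the sup norm weighted by `x`: the eigenvalue equation is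
      -- read at a vertex where `|u|/x` is largest, and there `Ax = cx` bounds the right-hand side.
      obtain ⟨v, hv⟩ := Finite.exists_max fun v => ‖u v‖ / x v
      have hv0 : 0 < ‖u v‖ := by
        obtain ⟨w, hw⟩ := Function.ne_iff.1 hu
        have h2 := hv w
        have h3 : 0 < ‖u w‖ / x w := div_pos (norm_pos_iff.2 hw) (hx w)
        have h4 := h3.trans_le h2
        exact (div_pos_iff_of_pos_right (hx v)).1 h4
      have h5 : ‖z‖ * ‖u v‖ ≤ c * ‖u v‖ := by
        have e := congrFun hAu v
        rw [Pi.smul_apply, smul_eq_mul] at e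
        rw [← norm_mul, ← e]
        calc ‖∑ w, (A v w : ℂ) * u w‖ ≤ ∑ w, (A v w : ℝ) * ‖u w‖ := by
              refine (norm_sum_le _ _).trans (Finset.sum_le_sum fun w _ => ?_)
              rw [norm_mul, Complex.norm_natCast]
          _ ≤ ∑ w, (A v w : ℝ) * (‖u v‖ / x v * x w) := by
              refine Finset.sum_le_sum fun w _ => mul_le_mul_of_nonneg_left ?_ (Nat.cast_nonneg _)
              exact (div_le_iff₀ (hx w)).1 (hv w)
          _ = ‖u v‖ / x v * ∑ w, (A v w : ℝ) * x w := by
              rw [Finset.mul_sum]; refine Finset.sum_congr rfl fun w _ => by ring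
          _ = ‖u v‖ / x v * (c * x v) := by
              congr 1
              exact congrFun h v
          _ = c * ‖u v‖ := by have := (hx v).ne'; field_simp
      have h6 := le_of_mul_le_mul_right h5 hv0
      change ‖z‖ₑ ≤ _
      rw [← ofReal_norm]
      exact ENNReal.ofReal_le_ofReal h6
    · have hz : (c : ℂ) ∈ spectrum ℂ (A.map (Nat.cast : ℕ → ℂ)) := by
        rw [key]
        refine ⟨fun v => (x v : ℂ), ?_, ?_⟩
        · obtain ⟨v⟩ := ‹Nonempty V›
          exact Function.ne_iff.2 ⟨v, by simpa using (hx v).ne'⟩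
        · funext v
          have e := congrFun h v
          simp only [mulVec, dotProduct, map_apply, Pi.smul_apply, smul_eq_mul] at e ⊢
          rw [← Complex.ofReal_mul, ← e]
          push_cast
          rfl
      have h2 := le_iSup₂ (f := fun (z : ℂ) (_ : z ∈ spectrum ℂ (A.map (Nat.cast : ℕ → ℂ))) =>
        (‖z‖₊ : ℝ≥0∞)) _ hz
      refine le_trans (le_of_eq ?_) h2
      simp only [Complex.nnnorm_real]
      rw [← Real.enorm_of_nonneg hc]
      rfl
  rw [specRad, h1, ENNReal.toReal_ofReal hc]

open Matrix in
/-- Existence of a positive eigenvector of an irreducible matrix. -/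
theorem MatIrreducible.exists_eigenvector [Nonempty V] {B : Matrix V V ℝ}
    (hB : MatIrreducible B) : ∃ (c : ℝ) (x : V → ℝ), (∀ v, 0 < x v) ∧ B *ᵥ x = c • x := by
  choose N hN using hB.2
  -- `Q` contains a positive power for each entry, so it is strictly positive, and it commutes with
  -- `B`. It will turn a non-zero defect into a strictly positive one.
  set Q : Matrix V V ℝ := ∑ p : V × V, B ^ N p.1 p.2 with hQ
  have hQpos : ∀ v w, 0 < Q v w := fun v w => by
    rw [hQ, Matrix.sum_apply]
    exact (hN v w).trans_le (Finset.single_le_sum (f := fun p : V × V => (B ^ N p.1 p.2) v w)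
      (fun p _ => Matrix.pow_apply_nonneg hB.1 _ v w) (Finset.mem_univ (v, w)))
  have hcomm : Commute B Q := Commute.sum_right _ _ _ fun p _ => (Commute.refl B).pow_right _
  have hQx : ∀ x : V → ℝ, (∀ v, 0 ≤ x v) → x ≠ 0 → ∀ v, 0 < (Q *ᵥ x) v := fun x hx hx0 v => by
    obtain ⟨w, hw⟩ := Function.ne_iff.1 hx0
    exact Finset.sum_pos' (fun u _ => mul_nonneg (hQpos v u).le (hx u))
      ⟨w, Finset.mem_univ w, mul_pos (hQpos v w) ((hx w).lt_of_ne' hw)⟩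
  set R : ℝ := ∑ v, ∑ w, B v w with hR
  have hbound : ∀ (t : ℝ) (x : V → ℝ), x ∈ stdSimplex ℝ V → (∀ v, t * x v ≤ (B *ᵥ x) v) →
      t ≤ R := fun t x hx ht => by
    have h1 : t = ∑ v, t * x v := by rw [← Finset.mul_sum, hx.2, mul_one]
    rw [h1]
    refine Finset.sum_le_sum fun v _ => (ht v).trans (Finset.sum_le_sum fun w _ => ?_)
    refine mul_le_of_le_one_right (hB.1 v w) ?_
    rw [← hx.2]
    exact Finset.single_le_sum (fun i _ => hx.1 i) (Finset.mem_univ w)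
  -- The Collatz-Wielandt argument: maximise `t` subject to `t x ≤ Bx` with `x` in the simplex. The
  -- bound `R`, the sum of all entries, makes the set of pairs compact.
  set S : Set (ℝ × (V → ℝ)) := (Set.Icc 0 R ×ˢ stdSimplex ℝ V) ∩
    {p | ∀ v, p.1 * p.2 v ≤ (B *ᵥ p.2) v} with hS
  have hScpt : IsCompact S := by
    refine (isCompact_Icc.prod (isCompact_stdSimplex ℝ V)).inter_right ?_
    rw [Set.ofPred_forall]
    refine isClosed_iInter fun v => isClosed_le (by fun_prop) ?_
    simp only [mulVec, dotProduct]
    fun_prop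
  have hSmem : ∀ (t : ℝ) (y : V → ℝ), 0 ≤ t → (∀ v, 0 < y v) → (∀ v, t * y v ≤ (B *ᵥ y) v) →
      ∃ z, (t, z) ∈ S := fun t y ht hy hty => by
    have hs : 0 < ∑ v, y v := Finset.sum_pos (fun v _ => hy v) Finset.univ_nonempty
    have h1 : (∑ v, y v)⁻¹ • y ∈ stdSimplex ℝ V := by
      refine ⟨fun v => mul_nonneg (inv_nonneg.2 hs.le) (hy v).le, ?_⟩
      simp only [Pi.smul_apply, smul_eq_mul]
      rw [← Finset.mul_sum, inv_mul_cancel₀ hs.ne']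
    have h2 : ∀ v, t * ((∑ v, y v)⁻¹ • y) v ≤ (B *ᵥ ((∑ v, y v)⁻¹ • y)) v := fun v => by
      rw [mulVec_smul]
      simp only [Pi.smul_apply, smul_eq_mul]
      rw [mul_left_comm]
      exact mul_le_mul_of_nonneg_left (hty v) (inv_nonneg.2 hs.le)
    exact ⟨_, ⟨⟨ht, hbound t _ h1 h2⟩, h1⟩, h2⟩
  obtain ⟨z0, hz0⟩ := hSmem 0 (fun _ => 1) le_rfl (fun _ => one_pos) (fun v => by
    rw [zero_mul]
    exact Finset.sum_nonneg fun w _ => mul_nonneg (hB.1 v w) zero_le_one)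
  obtain ⟨⟨c, x⟩, ⟨⟨hc, hx⟩, hcx⟩, hmax⟩ := hScpt.exists_isMaxOn ⟨_, hz0⟩
    continuous_fst.continuousOn
  simp only [Set.mem_Icc] at hc hx
  have hx0 : x ≠ 0 := by
    rintro rfl
    simpa using hx.2
  have hBx : B *ᵥ x = c • x := by
    -- If `Bx ≥ cx` is not an equality, then `Q(Bx - cx)` is strictly positive, so `Qx` satisfies
    -- the constraint with `c + ε`, against maximality.
    by_contra hne
    have hd := hQx (B *ᵥ x - c • x) (fun v => by simpa using hcx v) (sub_ne_zero.2 hne)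
    have hy := hQx x hx.1 hx0
    obtain ⟨v, hv⟩ := Finite.exists_min fun v => (Q *ᵥ (B *ᵥ x - c • x)) v / (Q *ᵥ x) v
    set ε := (Q *ᵥ (B *ᵥ x - c • x)) v / (Q *ᵥ x) v with hε
    have hεpos : 0 < ε := div_pos (hd v) (hy v)
    obtain ⟨z, hz⟩ := hSmem (c + ε) (Q *ᵥ x) (by linarith [hc.1]) hy fun w => by
      have h1 := (le_div_iff₀ (hy w)).1 (hv w)
      have h2 : Q *ᵥ (B *ᵥ x - c • x) = B *ᵥ (Q *ᵥ x) - c • (Q *ᵥ x) := by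
        rw [mulVec_sub, mulVec_smul, mulVec_mulVec, mulVec_mulVec, hcomm.eq]
      rw [h2] at h1
      simp only [Pi.sub_apply, Pi.smul_apply, smul_eq_mul] at h1
      linarith
    have h3 : c + ε ≤ c := hmax hz
    linarith
  refine ⟨c, x, fun v => (hx.1 v).lt_of_ne' fun hv => hx0 ?_, hBx⟩
  exact hB.eq_zero hc.1 hx.1 (fun w => by rw [hBx]; simp) hv

end PerronFrobenius

namespace FiniteKGraph
variable {k : ℕ} {V P : Type u} (Λ : FiniteKGraph k V P)

/-! ### Sums over paths and the common Perron-Frobenius eigenvector -/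

/-- By unique factorisation, `(a,b) ↦ ab` is a bijection from composable pairs of degrees `m`, `n`
onto the paths of degree `m + n`. -/
theorem sum_pathsFrom_add {M : Type*} [AddCommMonoid M] (v : V) (m n : Fin k → ℕ) (f : P → M) :
    ∑ l ∈ Λ.pathsFrom v (m + n), f l =
      ∑ a ∈ Λ.pathsFrom v m, ∑ b ∈ Λ.pathsFrom (Λ.s a) n, f (Λ.comp a b) := by
  rw [Finset.sum_sigma']
  symm
  refine Finset.sum_bij (fun p _ => Λ.comp p.1 p.2) ?_ ?_ ?_ fun _ _ => rfl
  · rintro ⟨a, b⟩ h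
    simp only [Finset.mem_sigma, mem_pathsFrom] at h ⊢
    rw [Λ.d_comp _ _ h.2.2.symm, Λ.r_comp _ _ h.2.2.symm, h.1.1, h.2.1]
    exact ⟨rfl, h.1.2⟩
  · rintro ⟨a, b⟩ h ⟨a', b'⟩ h' e
    simp only [Finset.mem_sigma, mem_pathsFrom] at h h' e
    obtain ⟨rfl, rfl⟩ := Λ.comp_inj h.2.2.symm h'.2.2.symm (h.1.1.trans h'.1.1.symm) e
    rfl
  · intro l hl
    rw [mem_pathsFrom] at hl
    obtain ⟨p, ⟨h1, h2, h3, h4⟩, -⟩ := Λ.factor l m n hl.1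
    refine ⟨⟨p.1, p.2⟩, ?_, h4⟩
    simp only [Finset.mem_sigma, mem_pathsFrom]
    exact ⟨⟨h2, by rw [← hl.2, ← h4, Λ.r_comp _ _ h1]⟩, h3, h1.symm⟩

theorem pathsFrom_zero (v : V) : Λ.pathsFrom v 0 = {Λ.vtx v} := by
  ext l
  rw [mem_pathsFrom, Finset.mem_singleton]
  refine ⟨fun h => ?_, ?_⟩
  · rw [Λ.eq_vtx h.1, h.2]
  · rintro rfl
    exact ⟨Λ.d_vtx v, Λ.r_vtx v⟩

open Matrix in
theorem vertexMatrix_mulVec [Fintype V] (i : Fin k) (x : V → ℝ) (v : V) :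
    ((Λ.vertexMatrix i).map (Nat.cast : ℕ → ℝ) *ᵥ x) v =
      ∑ e ∈ Λ.pathsFrom v (Pi.single i 1), x (Λ.s e) := by
  classical
  rw [← Finset.sum_fiberwise (Λ.pathsFrom v (Pi.single i 1)) Λ.s]
  refine Finset.sum_congr rfl fun w _ => ?_
  rw [Finset.sum_congr rfl (g := fun _ => x w) fun e he => by rw [(Finset.mem_filter.1 he).2],
    Finset.sum_const, nsmul_eq_mul]
  change ((Λ.vertexMatrix i v w : ℕ) : ℝ) * x w = _
  congr 2
  rw [vertexMatrix, ← Set.ncard_coe_finset]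
  congr 1
  ext l
  simp [mem_pathsFrom, and_assoc]

-- Both sides sum `x` over the sources of the paths of degree `e_i + e_j`, factorised in the two
-- possible orders.
open Matrix in
theorem vertexMatrix_comm [Fintype V] (i j : Fin k) (x : V → ℝ) :
    (Λ.vertexMatrix i).map (Nat.cast : ℕ → ℝ) *ᵥ
        ((Λ.vertexMatrix j).map (Nat.cast : ℕ → ℝ) *ᵥ x) =
      (Λ.vertexMatrix j).map (Nat.cast : ℕ → ℝ) *ᵥ
        ((Λ.vertexMatrix i).map (Nat.cast : ℕ → ℝ) *ᵥ x) := by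
  have key : ∀ (i j : Fin k) (v : V), ((Λ.vertexMatrix i).map (Nat.cast : ℕ → ℝ) *ᵥ
      ((Λ.vertexMatrix j).map (Nat.cast : ℕ → ℝ) *ᵥ x)) v =
      ∑ l ∈ Λ.pathsFrom v (Pi.single i 1 + Pi.single j 1), x (Λ.s l) := by
    intro i j v
    rw [sum_pathsFrom_add, vertexMatrix_mulVec]
    refine Finset.sum_congr rfl fun a _ => ?_
    rw [vertexMatrix_mulVec]
    refine Finset.sum_congr rfl fun b hb => ?_
    rw [Λ.s_comp _ _ (Λ.mem_pathsFrom.1 hb).2.symm]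
  funext v
  rw [key, key, add_comm]

variable {Λ}

theorem CoordinatewiseIrreducible.matIrreducible [Fintype V] [DecidableEq V]
    (h : Λ.CoordinatewiseIrreducible) (i : Fin k) :
    MatIrreducible ((Λ.vertexMatrix i).map (Nat.cast : ℕ → ℝ)) := by
  refine ⟨fun v w => by simp, fun v w => ?_⟩
  obtain ⟨n, hn⟩ := h i v w
  refine ⟨n, ?_⟩
  have h1 : (Λ.vertexMatrix i).map (Nat.cast : ℕ → ℝ) ^ n =
      (Λ.vertexMatrix i ^ n).map (Nat.cast : ℕ → ℝ) :=
    (map_pow (Nat.castRingHom ℝ).mapMatrix (Λ.vertexMatrix i) n).symm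
  rw [h1, Matrix.map_apply]
  exact_mod_cast Nat.pos_of_ne_zero hn

open Matrix in
theorem CoordinatewiseIrreducible.eq_smul [Fintype V] [DecidableEq V] [Nonempty V]
    (h : Λ.CoordinatewiseIrreducible) {i : Fin k} {κ y : V → ℝ}
    (hκ : IsPerronVector (Λ.vertexMatrix i) κ)
    (hy : ∀ v, ((Λ.vertexMatrix i).map (Nat.cast : ℕ → ℝ) *ᵥ y) v ≤
      specRad (Λ.vertexMatrix i) * y v) : ∃ t : ℝ, y = t • κ :=
  (h.matIrreducible i).eq_smul ENNReal.toReal_nonneg hκ.1 hκ.2.2 hy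

open Matrix in
/-- The vertex matrices of a coordinatewise irreducible graph have the same unimodular
Perron-Frobenius eigenvector. -/
theorem CoordinatewiseIrreducible.exists_perron [Fintype V] [DecidableEq V] [Nonempty V]
    (h : Λ.CoordinatewiseIrreducible) (i₀ : Fin k) :
    ∃ κ : V → ℝ, ∀ i, IsPerronVector (Λ.vertexMatrix i) κ ∧
        ∀ κ', IsPerronVector (Λ.vertexMatrix i) κ' → κ' = κ := by
  obtain ⟨c, x, hx, hBx⟩ := (h.matIrreducible i₀).exists_eigenvector
  have hs : 0 < ∑ v, x v := Finset.sum_pos (fun v _ => hx v) Finset.univ_nonempty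
  set κ := (∑ v, x v)⁻¹ • x with hκ
  have hpos : ∀ v, 0 < κ v := fun v => mul_pos (inv_pos.2 hs) (hx v)
  have hsum : ∑ v, κ v = 1 := by
    simp only [hκ, Pi.smul_apply, smul_eq_mul]
    rw [← Finset.mul_sum, inv_mul_cancel₀ hs.ne']
  have hc : 0 ≤ c := eigenvalue_nonneg (h.matIrreducible i₀).1 hx hBx
  have hBκ : (Λ.vertexMatrix i₀).map (Nat.cast : ℕ → ℝ) *ᵥ κ = c • κ := by
    rw [hκ, mulVec_smul, hBx, smul_comm]
  have hall : ∀ i, IsPerronVector (Λ.vertexMatrix i) κ := fun i => by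
    refine ⟨hpos, hsum, ?_⟩
    -- Since the matrices commute, `A_i κ` is again an eigenvector of `A_{i₀}` for `c`, hence a
    -- multiple of `κ`; `specRad_eq` identifies the multiplier as `ρ(A_i)`.
    obtain ⟨t, ht⟩ := (h.matIrreducible i₀).eq_smul hc hpos hBκ
      (y := (Λ.vertexMatrix i).map (Nat.cast : ℕ → ℝ) *ᵥ κ) (fun v => by
        rw [vertexMatrix_comm, hBκ, mulVec_smul, Pi.smul_apply, smul_eq_mul])
    rw [specRad_eq hpos ht, ht]
  refine ⟨κ, fun i => ⟨hall i, fun κ' h' => ?_⟩⟩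
  obtain ⟨t, rfl⟩ := h.eq_smul (hall i) (y := κ') (fun v => by rw [h'.2.2]; rfl)
  have h1 := h'.2.1
  simp only [Pi.smul_apply, smul_eq_mul] at h1
  rw [← Finset.mul_sum, hsum, mul_one] at h1
  rw [h1, one_smul]

end FiniteKGraph

/-! ### Weights of paths and their sums -/

theorem degDot_add {k : ℕ} (r : Fin k → ℝ) (m n : Fin k → ℕ) :
    degDot r (m + n) = degDot r m + degDot r n := by
  simp [degDot, mul_add, Finset.sum_add_distrib]

theorem degDot_zero {k : ℕ} (r : Fin k → ℝ) : degDot r 0 = 0 := by simp [degDot]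

theorem degDot_single {k : ℕ} (r : Fin k → ℝ) (i : Fin k) : degDot r (Pi.single i 1) = r i := by
  rw [degDot, Finset.sum_eq_single i] <;> simp +contextual

namespace FiniteKGraph
variable {k : ℕ} {V P : Type u} (Λ : FiniteKGraph k V P)

/-- The weight `e^{-r·d(l)} κ_{s(l)}`. -/
noncomputable def weight (r : Fin k → ℝ) (κ : V → ℝ) (l : P) : ℝ :=
  Real.exp (-degDot r (Λ.d l)) * κ (Λ.s l)

theorem weight_comp (r : Fin k → ℝ) (κ : V → ℝ) {a b : P} (h : Λ.s a = Λ.r b) :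
    Λ.weight r κ (Λ.comp a b) = Real.exp (-degDot r (Λ.d a)) * Λ.weight r κ b := by
  rw [weight, weight, Λ.d_comp _ _ h, Λ.s_comp _ _ h, degDot_add, neg_add, Real.exp_add, mul_assoc]

theorem weight_nonneg {r : Fin k → ℝ} {κ : V → ℝ} (hκ : ∀ v, 0 < κ v) (l : P) :
    0 ≤ Λ.weight r κ l := mul_nonneg (Real.exp_pos _).le (hκ _).le

theorem weight_vtx (r : Fin k → ℝ) (κ : V → ℝ) (v : V) : Λ.weight r κ (Λ.vtx v) = κ v := by
  rw [weight, Λ.d_vtx, Λ.s_vtx, degDot_zero, neg_zero, Real.exp_zero, one_mul]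

/-- Induction on the total degree: split off an edge in a direction `i` with `n_i > 0`. The sum over
these edges is `e^{-r_i} A_i κ`, which contributes the factor `e^{-r_i} ρ(A_i)`. -/
theorem sum_weight [Fintype V] [DecidableEq V] (r : Fin k → ℝ) {κ : V → ℝ}
    (hκ : ∀ i, IsPerronVector (Λ.vertexMatrix i) κ) (n : Fin k → ℕ) (v : V) :
    ∑ l ∈ Λ.pathsFrom v n, Λ.weight r κ l =
      (∏ i, (Real.exp (-r i) * specRad (Λ.vertexMatrix i)) ^ n i) * κ v := by
  induction hN : ∑ i, n i generalizing n v with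
  | zero =>
    have h0 : n = 0 := funext fun i => by simpa using (Finset.sum_eq_zero_iff.1 hN i)
    subst h0
    simp [pathsFrom_zero, weight_vtx]
  | succ N ih =>
    obtain ⟨i, -, hi⟩ : ∃ i ∈ Finset.univ, 0 < n i := by
      by_contra h
      push Not at h
      have := Finset.sum_eq_zero fun i hi => Nat.le_zero.1 (h i hi)
      omega
    obtain ⟨m, rfl⟩ : ∃ m, n = Pi.single i 1 + m := ⟨n - Pi.single i 1, by
      rw [add_tsub_cancel_of_le]
      intro j
      by_cases hj : j = i
      · subst hj; rw [Pi.single_eq_same]; exact hi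
      · simp [hj]⟩
    have hm : ∑ j, m j = N := by
      simp only [Pi.add_apply, Finset.sum_add_distrib] at hN
      rw [Finset.sum_pi_single' i 1 Finset.univ] at hN
      simp at hN
      omega
    rw [sum_pathsFrom_add]
    have h1 : ∀ a ∈ Λ.pathsFrom v (Pi.single i 1), ∑ b ∈ Λ.pathsFrom (Λ.s a) m,
        Λ.weight r κ (Λ.comp a b) = Real.exp (-r i) *
        (∏ i, (Real.exp (-r i) * specRad (Λ.vertexMatrix i)) ^ m i) * κ (Λ.s a) := by
      intro a ha
      rw [mul_assoc, ← ih m (Λ.s a) hm, Finset.mul_sum]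
      refine Finset.sum_congr rfl fun b hb => ?_
      rw [Λ.weight_comp _ _ (Λ.mem_pathsFrom.1 hb).2.symm, (Λ.mem_pathsFrom.1 ha).1, degDot_single]
    rw [Finset.sum_congr rfl h1, ← Finset.mul_sum, ← vertexMatrix_mulVec, (hκ i).2.2]
    simp only [Pi.add_apply, pow_add, Finset.prod_mul_distrib, Pi.smul_apply, smul_eq_mul]
    have h2 : ∏ j, (Real.exp (-r j) * specRad (Λ.vertexMatrix j)) ^ (Pi.single i 1 : Fin k → ℕ) j =
        Real.exp (-r i) * specRad (Λ.vertexMatrix i) := by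
      rw [Finset.prod_eq_single i] <;> simp +contextual
    rw [h2]
    ring

end FiniteKGraph

/-! ### Products of series -/

/-- In `[0,∞]` sums may be rearranged freely, so one coordinate at a time is split off. -/
theorem ENNReal.tsum_pi_fin {n : ℕ} (f : Fin n → ℕ → ℝ≥0∞) :
    ∑' p : Fin n → ℕ, ∏ j, f j (p j) = ∏ j, ∑' a, f j a := by
  induction n with
  | zero => rw [tsum_eq_single default fun b hb => absurd (Subsingleton.elim b default) hb]; simp
  | succ n ih =>
    rw [← (Fin.consEquiv fun _ => ℕ).tsum_eq, ENNReal.tsum_prod', Fin.prod_univ_succ, ← ih,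
      ← ENNReal.tsum_mul_right]
    refine tsum_congr fun a => ?_
    rw [← ENNReal.tsum_mul_left]
    refine tsum_congr fun p => ?_
    rw [Fin.prod_univ_succ]
    simp [Fin.consEquiv]

theorem ENNReal.tsum_pi_prod {ι : Type*} [Fintype ι] (f : ι → ℕ → ℝ≥0∞) :
    ∑' p : ι → ℕ, ∏ j, f j (p j) = ∏ j, ∑' a, f j a := by
  set e := Fintype.equivFin ι
  rw [← e.symm.prod_comp fun j => ∑' a, f j a, ← ENNReal.tsum_pi_fin,
    ← (e.arrowCongr (Equiv.refl ℕ)).tsum_eq]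
  refine tsum_congr fun p => ?_
  rw [← e.symm.prod_comp]
  simp

namespace FiniteKGraph
variable {k : ℕ} {V P : Type u} (Λ : FiniteKGraph k V P)

open PathSpace

/-! ### Measurability in the path space -/

theorem countable_paths (Λ : FiniteKGraph k V P) : Countable P := by
  rw [← Set.countable_univ_iff]
  have : (Set.univ : Set P) = ⋃ n, {l | Λ.d l = n} := by ext l; simp
  rw [this]
  exact Set.countable_iUnion fun n => (Λ.finite_deg n).countable

theorem isOpen_cyl (l : P) : IsOpen (cyl l : Set Λ.PathSpace) :=
  TopologicalSpace.isOpen_generateFrom_of_mem ⟨l, ∅, by simp, by simp⟩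

theorem measurableSet_cyl (l : P) : MeasurableSet (cyl l : Set Λ.PathSpace) :=
  (Λ.isOpen_cyl l).measurableSet

/-- There are only countably many paths, so the defining subbasis is countable and generates the
Borel σ-algebra. Its members are Boolean combinations of cylinders. -/
theorem measurable_of_cyl {Ω : Type*} [MeasurableSpace Ω] {X : Ω → Λ.PathSpace}
    (h : ∀ l, MeasurableSet {ω | X ω ∈ (cyl l : Set Λ.PathSpace)}) : Measurable X := by
  have := Λ.countable_paths
  set S : Set (Set Λ.PathSpace) := {U | ∃ (l : P) (G : Finset P), (∀ a ∈ G, Λ.r a = Λ.s l) ∧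
    U = cyl l \ ⋃ a ∈ G, cyl (Λ.comp l a)} with hS
  have hc : S.Countable := by
    refine (Set.countable_range fun p : P × Finset P =>
      (cyl p.1 \ ⋃ a ∈ p.2, cyl (Λ.comp p.1 a) : Set Λ.PathSpace)).mono ?_
    rintro U ⟨l, G, -, rfl⟩
    exact ⟨(l, G), rfl⟩
  have h2 : SecondCountableTopology Λ.PathSpace := ⟨S, hc, rfl⟩
  have h3 : (borel Λ.PathSpace) = MeasurableSpace.generateFrom S :=
    borel_eq_generateFrom_of_subbasis rfl
  suffices h4 : @Measurable _ _ _ (MeasurableSpace.generateFrom S) X by rwa [← h3] at h4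
  refine measurable_generateFrom ?_
  rintro U ⟨l, G, -, rfl⟩
  rw [Set.preimage_sdiff, Set.preimage_iUnion₂]
  exact (h l).diff (Finset.measurableSet_biUnion _ fun a _ => h _)

theorem mem_cyl_comp {l b : P} {x : Λ.PathSpace} (h : Λ.s l = Λ.r b)
    (hx : x ∈ (cyl (Λ.comp l b) : Set Λ.PathSpace)) : x ∈ (cyl l : Set Λ.PathSpace) := by
  have h1 : Λ.d l ≤ Λ.d (Λ.comp l b) := by rw [Λ.d_comp _ _ h]; exact le_self_add
  refine ⟨hx.1.mono h1, ?_⟩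
  have h2 := x.init_isPre _ _ h1 hx.1
  rw [hx.2] at h2
  exact h2.eq ⟨b, h, rfl⟩ (x.d_init _ _)

theorem eq_of_mem_cyl {a b : P} {x : Λ.PathSpace} (ha : x ∈ (cyl a : Set Λ.PathSpace))
    (hb : x ∈ (cyl b : Set Λ.PathSpace)) (h : Λ.d a = Λ.d b) : a = b := by
  rw [← ha.2, ← hb.2, init_congr _ h]

/-- A path of `Z(l)` whose degree is at least `d(l) + q` passes through exactly one `lb` with `d(b)
= q`. Only the coordinates outside `K` need checking, since those in `K` are infinite. -/
theorem measure_cyl_eq_sum {K : Finset (Fin k)} {m : {j // j ∉ K} → ℕ} (l : P) (q : Fin k → ℕ)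
    (h : ∀ j : {j // j ∉ K}, Λ.d l j + q j ≤ m j) (ν : Measure (Λ.semiPaths K m)) :
    ν {x | x.1 ∈ (cyl l : Set Λ.PathSpace)} =
      ∑ b ∈ Λ.pathsFrom (Λ.s l) q, ν {x | x.1 ∈ (cyl (Λ.comp l b) : Set Λ.PathSpace)} := by
  rw [← measure_biUnion_finset]
  · congr 1
    ext x
    simp only [Set.mem_ofPred_eq, Set.mem_iUnion, exists_prop]
    constructor
    · intro hx
      have hB : Below (Λ.d l + q) x.1.deg := fun i => by
        by_cases hi : i ∈ K
        · rw [x.2.2 i hi]; exact le_top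
        · rw [x.2.1 ⟨i, hi⟩]; exact_mod_cast h ⟨i, hi⟩
      have h1 := x.1.s_init _ _ (le_self_add : Λ.d l ≤ Λ.d l + q) hB
      have h2 := x.1.init_comp _ _ (le_self_add : Λ.d l ≤ Λ.d l + q) hB
      have h3 := x.1.d_mor _ _ (le_self_add : Λ.d l ≤ Λ.d l + q) hB
      have h4 : x.1.init (Λ.d l) (hB.mono le_self_add) = l := hx.2
      rw [h4] at h1 h2
      rw [add_tsub_cancel_left] at h3
      refine ⟨_, Λ.mem_pathsFrom.2 ⟨h3, h1.symm⟩, ?_⟩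
      have h5 : Λ.d (Λ.comp l (x.1.mor _ _ le_self_add hB)) = Λ.d l + q := by
        rw [h2, d_init]
      rw [cyl]
      refine ⟨by rw [h5]; exact hB, ?_⟩
      exact (init_congr _ h5 _).trans h2.symm
    · rintro ⟨b, hb, hx⟩
      exact Λ.mem_cyl_comp (Λ.mem_pathsFrom.1 hb).2.symm hx
  · intro a ha b hb hab
    refine Set.disjoint_left.2 fun x hx hx' => hab ?_
    have ha' := Λ.mem_pathsFrom.1 ha
    have hb' := Λ.mem_pathsFrom.1 hb
    have h1 := Λ.eq_of_mem_cyl hx hx'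
      (by rw [Λ.d_comp _ _ ha'.2.symm, Λ.d_comp _ _ hb'.2.symm, ha'.1, hb'.1])
    exact (Λ.comp_inj ha'.2.symm hb'.2.symm rfl h1).2
  · exact fun b _ => measurable_subtype_coe (Λ.measurableSet_cyl _)

/-! ### Random walks on the graph -/

/-- The possible steps of degree `u` from `v`. -/
def Step (u : Fin k → ℕ) (v : V) : Type u := {e // e ∈ Λ.pathsFrom v u}

instance (u : Fin k → ℕ) (v : V) : MeasurableSpace (Λ.Step u v) := ⊤

instance (u : Fin k → ℕ) (v : V) : DiscreteMeasurableSpace (Λ.Step u v) := ⟨fun _ => trivial⟩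

noncomputable instance (u : Fin k → ℕ) (v : V) : Fintype (Λ.Step u v) :=
  inferInstanceAs (Fintype {e // e ∈ Λ.pathsFrom v u})

variable {Λ} in
/-- The path that starts with `a` and follows the steps prescribed by `ω`. -/
noncomputable def walk {u : Fin k → ℕ} (ω : ∀ p : ℕ × V, Λ.Step u p.2) (a : P) : ℕ → P
  | 0 => a
  -- A step is reserved for every time and every vertex, and the one at the current source is used.
  -- A Markov walk is thus a function of independent coordinates, so a product measure suffices.
  | n + 1 => Λ.comp (walk ω a n) (ω (n, Λ.s (walk ω a n))).1

section walk
variable {u : Fin k → ℕ} (ω : ∀ p : ℕ × V, Λ.Step u p.2) (a : P)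

theorem s_walk (n : ℕ) : Λ.s (walk ω a n) = Λ.r (ω (n, Λ.s (walk ω a n))).1 :=
  (Λ.mem_pathsFrom.1 (ω (n, Λ.s (walk ω a n))).2).2.symm

theorem d_walk (n : ℕ) : Λ.d (walk ω a n) = Λ.d a + n • u := by
  induction n with
  | zero => simp [walk]
  | succ n ih =>
    rw [walk, Λ.d_comp _ _ (Λ.s_walk ω a n), ih, (Λ.mem_pathsFrom.1 (ω _).2).1, add_smul, one_smul,
      add_assoc]

theorem walk_isPre {m n : ℕ} (h : m ≤ n) : Λ.IsPre (walk ω a m) (walk ω a n) := by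
  induction n, h using Nat.le_induction with
  | base => exact IsPre.refl _
  | succ n _ ih => exact ih.trans ⟨_, Λ.s_walk ω a n, rfl⟩

/-- The next position depends on a coordinate chosen by the present position. Splitting over the
countably many present positions makes that coordinate fixed. -/
theorem measurableSet_walk (n : ℕ) (S : Set P) :
    MeasurableSet {ω : ∀ p : ℕ × V, Λ.Step u p.2 | walk ω a n ∈ S} := by
  have := Λ.countable_paths
  induction n generalizing S with
  | zero => exact MeasurableSet.const (a ∈ S)
  | succ n ih =>
    have h1 : {ω : ∀ p : ℕ × V, Λ.Step u p.2 | walk ω a (n + 1) ∈ S} =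
        ⋃ b : P, {ω | walk ω a n ∈ ({b} : Set P)} ∩ {ω | Λ.comp b (ω (n, Λ.s b)).1 ∈ S} := by
      ext ω
      simp [walk]
    rw [h1]
    refine MeasurableSet.iUnion fun b => (ih {b}).inter ?_
    have hm : Measurable fun ω : ∀ p : ℕ × V, Λ.Step u p.2 => ω (n, Λ.s b) :=
      measurable_pi_apply _
    exact hm (MeasurableSet.of_discrete (s := {e : Λ.Step u (Λ.s b) | Λ.comp b e.1 ∈ S}))

end walk

theorem weight_pos {r : Fin k → ℝ} {κ : V → ℝ} (hκ : ∀ v, 0 < κ v) (l : P) :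
    0 < Λ.weight r κ l := mul_pos (Real.exp_pos _) (hκ _)

section stepMeasure
variable [Fintype V] {r : Fin k → ℝ} {κ : V → ℝ} {u : Fin k → ℕ}

/-- The law of a step: it is proportional to the weight. -/
noncomputable def stepLaw (hκ : ∀ v, 0 < κ v)
    (hu : ∀ v, ∑ l ∈ Λ.pathsFrom v u, Λ.weight r κ l = κ v) (v : V) : PMF (Λ.Step u v) :=
  PMF.ofFintype (fun e => ENNReal.ofReal (Λ.weight r κ e.1 / κ v)) (by
    rw [← ENNReal.ofReal_sum_of_nonneg fun e _ => div_nonneg (Λ.weight_nonneg hκ _) (hκ v).le,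
      ← Finset.sum_div]
    have h1 : ∑ e : Λ.Step u v, Λ.weight r κ e.1 = ∑ l ∈ Λ.pathsFrom v u, Λ.weight r κ l :=
      Finset.sum_coe_sort (Λ.pathsFrom v u) (Λ.weight r κ)
    rw [h1, hu, div_self (hκ v).ne', ENNReal.ofReal_one])

/-- The law of the steps of a walk. -/
noncomputable def stepsLaw (hκ : ∀ v, 0 < κ v)
    (hu : ∀ v, ∑ l ∈ Λ.pathsFrom v u, Λ.weight r κ l = κ v) :
    Measure (∀ p : ℕ × V, Λ.Step u p.2) :=
  Measure.infinitePi fun p => (Λ.stepLaw hκ hu p.2).toMeasure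

variable (hκ : ∀ v, 0 < κ v) (hu : ∀ v, ∑ l ∈ Λ.pathsFrom v u, Λ.weight r κ l = κ v)

instance : IsProbabilityMeasure (Λ.stepsLaw hκ hu) := by unfold stepsLaw; infer_instance

/-- Being at `b` after `n` steps prescribes one coordinate at each time, the one at the source of
the corresponding initial segment of `b`. The event is therefore a finite-dimensional box, and its
probability is a telescoping product of quotients of weights. -/
theorem walk_eq_box (a : P) (n : ℕ) (b : P) (hab : Λ.IsPre a b) (hd : Λ.d b = Λ.d a + n • u) :
    ∃ T : ∀ p : ℕ × V, Set (Λ.Step u p.2),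
      {ω | walk ω a n = b} = Set.pi (Finset.range n ×ˢ (Finset.univ : Finset V) :) T ∧
      ∏ p ∈ Finset.range n ×ˢ (Finset.univ : Finset V), (Λ.stepLaw hκ hu p.2).toMeasure (T p) =
        ENNReal.ofReal (Λ.weight r κ b / Λ.weight r κ a) := by
  classical
  induction n generalizing b with
  | zero =>
    obtain rfl : a = b := hab.eq (IsPre.refl b) (by simpa using hd.symm)
    refine ⟨fun _ => Set.univ, ?_, ?_⟩
    · ext ω; simp [walk]
    · rw [div_self (Λ.weight_pos hκ a).ne']; simp
  | succ n ih =>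
    obtain ⟨c, hcb, hc⟩ := Λ.exists_pre b (Λ.d a + n • u) (by
      rw [hd, add_smul, ← add_assoc]; exact le_self_add)
    obtain ⟨T, hT, hTm⟩ := ih c (hab.of_le hcb (by rw [hc]; exact le_self_add)) hc
    obtain ⟨e, he, rfl⟩ := hcb
    have hde : Λ.d e = u := by
      rw [Λ.d_comp _ _ he, hc, add_smul, one_smul, ← add_assoc] at hd
      exact add_left_cancel hd
    -- At time `n` only the coordinate at `s(c)` is restricted, to the single step `e`. The
    -- coordinates at the other vertices stay free and contribute the factor 1.
    refine ⟨fun p => if p.1 < n then T p else {x | p.2 = Λ.s c → x.1 = e}, ?_, ?_⟩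
    · ext ω
      have h1 : walk ω a (n + 1) = Λ.comp c e ↔ walk ω a n = c ∧ (ω (n, Λ.s c)).1 = e := by
        constructor
        · intro h
          obtain ⟨h1, h2⟩ := Λ.comp_inj (Λ.s_walk ω a n) he (by rw [d_walk, hc]) h
          rw [h1] at h2
          exact ⟨h1, h2⟩
        · rintro ⟨h1, h2⟩
          rw [walk, h1, h2]
      have h2 : walk ω a n = c ↔ ∀ p ∈ Finset.range n ×ˢ (Finset.univ : Finset V), ω p ∈ T p := by
        have := Set.ext_iff.1 hT ω
        simpa only [Set.mem_ofPred_eq, Set.mem_pi, Finset.mem_coe] using this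
      simp only [Set.mem_ofPred_eq, Set.mem_pi, Finset.mem_coe, h1, h2, Finset.mem_product,
        Finset.mem_range, Finset.mem_univ, and_true]
      constructor
      · rintro ⟨h3, h4⟩ ⟨i, v⟩ hi
        split_ifs with h5
        · exact h3 _ h5
        · obtain rfl : i = n := le_antisymm (Nat.lt_succ_iff.1 hi) (not_lt.1 h5)
          rintro rfl
          exact h4
      · intro h3
        refine ⟨fun p hp => ?_, ?_⟩
        · have := h3 p (hp.trans (Nat.lt_succ_self n))
          rwa [if_pos hp] at this
        · have := h3 (n, Λ.s c) (Nat.lt_succ_self n)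
          rw [if_neg (lt_irrefl _)] at this
          exact this rfl
    · rw [Finset.prod_product, Finset.prod_range_succ, ← Finset.prod_product',
        Finset.prod_congr rfl (g := fun p => (Λ.stepLaw hκ hu p.2).toMeasure (T p)), hTm,
        Finset.prod_eq_single (Λ.s c)]
      · simp only [lt_irrefl, if_false, true_imp_iff]
        have hm : e ∈ Λ.pathsFrom (Λ.s c) u := Λ.mem_pathsFrom.2 ⟨hde, he.symm⟩
        obtain ⟨e', he'⟩ : ∃ e' : Λ.Step u (Λ.s c), e'.1 = e := ⟨⟨e, hm⟩, rfl⟩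
        have h1 : {x : Λ.Step u (Λ.s c) | x.1 = e} = {e'} := by
          ext x
          exact ⟨fun h => Subtype.ext (h.trans he'.symm),
            fun h => (congrArg Subtype.val h).trans he'⟩
        rw [h1, PMF.toMeasure_apply_singleton _ _ (MeasurableSet.of_discrete), stepLaw,
          PMF.ofFintype_apply, he', ← ENNReal.ofReal_mul (div_nonneg (Λ.weight_nonneg hκ _)
            (Λ.weight_nonneg hκ _)), Λ.weight_comp _ _ he]
        congr 1
        have := (Λ.weight_pos (r := r) hκ a).ne'
        have := (hκ (Λ.s c)).ne'
        rw [weight, weight, weight] at *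
        field_simp
      · intro v _ hv
        have h1 : {x : Λ.Step u v | v = Λ.s c → x.1 = e} = Set.univ := by
          ext x; simp [hv]
        simp only [lt_irrefl, if_false]
        rw [h1, measure_univ]
      · simp
      · rintro ⟨i, v⟩ hp
        have : i < n := by simpa using hp
        simp [this]

theorem stepsLaw_walk (a : P) (n : ℕ) (b : P) (hab : Λ.IsPre a b) (hd : Λ.d b = Λ.d a + n • u) :
    Λ.stepsLaw hκ hu {ω | walk ω a n = b} =
      ENNReal.ofReal (Λ.weight r κ b / Λ.weight r κ a) := by
  obtain ⟨T, h1, h2⟩ := Λ.walk_eq_box hκ hu a n b hab hd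
  rw [h1, stepsLaw, Measure.infinitePi_pi _ fun _ _ => MeasurableSet.of_discrete, h2]

end stepMeasure

end FiniteKGraph

namespace FiniteKGraph
variable {k : ℕ} {V P : Type u} (Λ : FiniteKGraph k V P)

open PathSpace

/-! ### Infinite walks in the directions of `K` -/

section joinDeg
variable (K : Finset (Fin k))

theorem joinDeg_of_mem (m : {j // j ∉ K} → ℕ) (n : {i // i ∈ K} → ℕ) {i : Fin k} (hi : i ∈ K) :
    joinDeg K m n i = n ⟨i, hi⟩ := dif_pos hi

theorem joinDeg_of_notMem (m : {j // j ∉ K} → ℕ) (n : {i // i ∈ K} → ℕ) {i : Fin k}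
    (hi : i ∉ K) : joinDeg K m n i = m ⟨i, hi⟩ := dif_neg hi

/-- Applied to `x_i = e^{-r_i} ρ(A_i)`: extending a path in the directions of `K` does not change
the total weight. -/
theorem prod_pow_joinDeg {x : Fin k → ℝ} (hx : ∀ i ∈ K, x i = 1) (m : {j // j ∉ K} → ℕ)
    (n : {i // i ∈ K} → ℕ) : ∏ i, x i ^ joinDeg K m n i = ∏ j : {j // j ∉ K}, x j ^ m j := by
  classical
  rw [← Finset.prod_compl_mul_prod K, Finset.prod_eq_one (s := K) fun i hi => by
    rw [hx i hi, one_pow], mul_one,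
    Finset.prod_subtype (p := fun j => j ∉ K) Kᶜ (by simp)]
  refine Finset.prod_congr rfl fun j _ => ?_
  rw [joinDeg_of_notMem K m n j.2]

end joinDeg

section semiWalk
variable {K : Finset (Fin k)} (ω : ∀ p : ℕ × V, Λ.Step (joinDeg K 0 1) p.2) (a : P)

/-- Every step adds one in each direction of `K`, so `∑ q_i` steps are enough for all coordinates at
once. The number of steps is generous but depends monotonically on `q`, which makes the initial
segments of `semiWalk` coherent. -/
theorem le_d_walk {q : Fin k → ℕ}
    (hq : Below q fun i => if i ∈ K then ⊤ else (Λ.d a i : ℕ∞)) {n : ℕ} (hn : ∑ i, q i ≤ n) :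
    q ≤ Λ.d (walk ω a n) := by
  intro i
  rw [d_walk, Pi.add_apply, Pi.smul_apply, smul_eq_mul]
  have h : (q i : ℕ∞) ≤ if i ∈ K then ⊤ else (Λ.d a i : ℕ∞) := hq i
  by_cases hi : i ∈ K
  · rw [joinDeg_of_mem K _ _ hi, Pi.one_apply, mul_one]
    have := Finset.single_le_sum (f := q) (fun _ _ => Nat.zero_le _) (Finset.mem_univ i)
    exact this.trans (hn.trans (Nat.le_add_left _ _))
  · rw [if_neg hi] at h
    exact (Nat.cast_le.1 h).trans (Nat.le_add_right _ _)

variable {Λ} in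
/-- The path that starts with `a` and follows all the steps prescribed by `ω`. -/
noncomputable def semiWalk : Λ.PathSpace :=
  ofInit (fun i => if i ∈ K then ⊤ else (Λ.d a i : ℕ∞))
    (fun q hq => Λ.pre (walk ω a (∑ i, q i)) q (Λ.le_d_walk ω a hq le_rfl))
    (fun q hq => Λ.d_pre _ _ _)
    (fun p q hpq hq => by
      refine IsPre.of_le (l := walk ω a (∑ i, q i)) ?_ (Λ.pre_isPre _ _ _) ?_
      · exact (Λ.pre_isPre _ _ _).trans
          (Λ.walk_isPre ω a (Finset.sum_le_sum fun i _ => hpq i))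
      · rw [Λ.d_pre, Λ.d_pre]; exact hpq)

theorem semiWalk_mem {m : {j // j ∉ K} → ℕ} (ha : Λ.d a = joinDeg K m 0) :
    semiWalk ω a ∈ Λ.semiPaths K m := by
  refine ⟨fun j => ?_, fun i hi => if_pos hi⟩
  change (if j.1 ∈ K then ⊤ else (Λ.d a j : ℕ∞)) = _
  rw [if_neg j.2, ha, joinDeg_of_notMem K _ _ j.2]

/-- Membership of the infinite path in a cylinder is decided at any sufficiently late finite time.
Measurability and probabilities are thereby reduced to the finite walk. -/
theorem semiWalk_mem_cyl {l : P} {n : ℕ} (hn : ∑ i, Λ.d l i ≤ n) :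
    semiWalk ω a ∈ (cyl l : Set Λ.PathSpace) ↔
      Below (Λ.d l) (fun i => if i ∈ K then ⊤ else (Λ.d a i : ℕ∞)) ∧
        Λ.IsPre l (walk ω a n) := by
  have key : ∀ hB : Below (Λ.d l) (fun i => if i ∈ K then ⊤ else (Λ.d a i : ℕ∞)),
      Λ.IsPre ((semiWalk ω a).init (Λ.d l) hB) (walk ω a n) := fun hB => by
    have e : (semiWalk ω a).init (Λ.d l) hB = Λ.pre (walk ω a (∑ i, Λ.d l i)) (Λ.d l)
      (Λ.le_d_walk ω a hB le_rfl) := ofInit_init _ _ _ _ _ _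
    rw [e]
    exact (Λ.pre_isPre _ _ _).trans (Λ.walk_isPre ω a hn)
  constructor
  · rintro ⟨hB, h⟩
    refine ⟨hB, ?_⟩
    have := key hB
    rwa [h] at this
  · rintro ⟨hB, h⟩
    exact ⟨hB, (key hB).eq h (d_init _ _ _)⟩

theorem measurable_semiWalk :
    Measurable fun ω : ∀ p : ℕ × V, Λ.Step (joinDeg K 0 1) p.2 => semiWalk ω a := by
  refine Λ.measurable_of_cyl fun l => ?_
  simp only [Λ.semiWalk_mem_cyl _ a (le_refl (∑ i, Λ.d l i))]
  exact (MeasurableSet.const _).inter (Λ.measurableSet_walk a _ {b | Λ.IsPre l b})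

/-- When `d(l)` is exactly the degree of the walk after `n` steps, both `l` and the position at time
`n` are initial segments of the same degree of a later position, so they agree. -/
theorem semiWalk_mem_cyl_iff_walk_eq {l : P} {n : ℕ} (hl : Λ.d l = Λ.d a + n • joinDeg K 0 1) :
    semiWalk ω a ∈ (cyl l : Set Λ.PathSpace) ↔ walk ω a n = l := by
  have hB : Below (Λ.d l) (fun i => if i ∈ K then ⊤ else (Λ.d a i : ℕ∞)) := fun i => by
    by_cases hi : i ∈ K
    · simp [hi]
    · simp [hi, hl, joinDeg_of_notMem]
  have hw := Λ.walk_isPre ω a (le_max_right (∑ i, Λ.d l i) n)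
  rw [Λ.semiWalk_mem_cyl ω a (le_max_left (∑ i, Λ.d l i) n)]
  constructor
  · rintro ⟨-, h⟩
    exact hw.eq h (by rw [d_walk, hl])
  · rintro rfl
    exact ⟨hB, hw⟩

end semiWalk

/-! ### The measures -/

section pathMeasure
variable [Fintype V] {r : Fin k → ℝ} {κ : V → ℝ} {K : Finset (Fin k)}
  (hκ : ∀ v, 0 < κ v)
  (hu : ∀ v, ∑ l ∈ Λ.pathsFrom v (joinDeg K 0 1), Λ.weight r κ l = κ v)

/-- The measure on `Λ^{m,∞_K}` that gives each cylinder set `Z(l)`, for `d(l)_J = m`, the mass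
`C e^{-r·d(l)} κ_{s(l)}`. -/
noncomputable def pathMeasure (C : ℝ) (m : {j // j ∉ K} → ℕ) : Measure (Λ.semiPaths K m) :=
  -- Each path in `Λ^{m,∞_K}` has one initial segment `a` of degree `(m,0)`; the measure is
  -- assembled from the laws of the walks starting at these `a`.
  Measure.sum fun a : {a // Λ.d a = joinDeg K m 0} =>
    ENNReal.ofReal (C * Λ.weight r κ a.1) •
      (Λ.stepsLaw hκ hu).map fun ω => ⟨semiWalk ω a.1, Λ.semiWalk_mem ω a.1 a.2⟩

/-- Only the walk that starts at the initial segment `a` of `l` can enter `Z(l)`. Its mass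
`C·weight(a)` is multiplied by the probability `weight(l)/weight(a)`. -/
theorem pathMeasure_cyl_of_steps {C : ℝ} (hC : 0 ≤ C) (m : {j // j ∉ K} → ℕ) (n : ℕ) (l : P)
    (hl : Λ.d l = joinDeg K m 0 + n • joinDeg K 0 1) :
    Λ.pathMeasure hκ hu C m {x | x.1 ∈ (cyl l : Set Λ.PathSpace)} =
      ENNReal.ofReal (C * Λ.weight r κ l) := by
  have hms : MeasurableSet {x : Λ.semiPaths K m | x.1 ∈ (cyl l : Set Λ.PathSpace)} :=
    measurable_subtype_coe (Λ.measurableSet_cyl l)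
  obtain ⟨a, ha, had⟩ := Λ.exists_pre l (joinDeg K m 0) (by rw [hl]; exact le_self_add)
  have h1 : ∀ b : {a // Λ.d a = joinDeg K m 0}, (Λ.stepsLaw hκ hu).map (fun ω =>
      (⟨semiWalk ω b.1, Λ.semiWalk_mem ω b.1 b.2⟩ : Λ.semiPaths K m))
        {x | x.1 ∈ (cyl l : Set Λ.PathSpace)} = Λ.stepsLaw hκ hu {ω | walk ω b.1 n = l} :=
    fun b => by
      rw [Measure.map_apply ((Λ.measurable_semiWalk b.1).subtype_mk) hms]
      congr 1
      ext ω
      exact Λ.semiWalk_mem_cyl_iff_walk_eq ω b.1 (by rw [b.2, hl])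
  rw [pathMeasure, Measure.sum_apply _ hms, tsum_eq_single ⟨a, had⟩]
  · rw [Measure.smul_apply, h1, Λ.stepsLaw_walk hκ hu a n l ha (by rw [had, hl]), smul_eq_mul,
      ← ENNReal.ofReal_mul (mul_nonneg hC (Λ.weight_nonneg hκ _))]
    congr 1
    have := (Λ.weight_pos (r := r) hκ a).ne'
    field_simp
  · rintro ⟨b, hb⟩ hba
    have h2 : {ω : ∀ p : ℕ × V, Λ.Step (joinDeg K 0 1) p.2 | walk ω b n = l} = ∅ := by
      refine Set.eq_empty_of_forall_notMem fun ω hω => hba (Subtype.ext ?_)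
      refine IsPre.eq (l := l) ?_ ha (hb.trans had.symm)
      rw [← show walk ω b n = l from hω]
      exact Λ.walk_isPre ω b (Nat.zero_le n)
    rw [Measure.smul_apply, h1, h2, measure_empty, smul_zero]

variable [DecidableEq V]

/-- The degree of `l` may be unbalanced in the directions of `K`, hence not of the form reached by
the walk. The cylinder is split into cylinders of paths with `N` in all these directions, and the
weights add up again because every factor belonging to `K` is 1. -/
theorem pathMeasure_cyl (hP : ∀ i, IsPerronVector (Λ.vertexMatrix i) κ)
    (hK : ∀ i ∈ K, Real.exp (-r i) * specRad (Λ.vertexMatrix i) = 1)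
    {C : ℝ} (hC : 0 ≤ C) (m : {j // j ∉ K} → ℕ) (n : {i // i ∈ K} → ℕ)
    (l : P) (hl : Λ.d l = joinDeg K m n) :
    Λ.pathMeasure hκ hu C m {x | x.1 ∈ (cyl l : Set Λ.PathSpace)} =
      ENNReal.ofReal (C * Λ.weight r κ l) := by
  -- Any common upper bound of the `n i` would do.
  set N := ∑ i, n i with hN
  have hq : joinDeg K m n + joinDeg K 0 (fun i => N - n i) =
      joinDeg K m 0 + N • joinDeg K 0 1 := by
    funext i
    by_cases hi : i ∈ K
    · simp only [Pi.add_apply, joinDeg_of_mem K _ _ hi, Pi.smul_apply]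
      have := Finset.single_le_sum (f := n) (fun _ _ => Nat.zero_le _)
        (Finset.mem_univ (⟨i, hi⟩ : {i // i ∈ K}))
      simp only [Pi.zero_apply, Pi.one_apply, smul_eq_mul]
      omega
    · simp [joinDeg_of_notMem K _ _ hi]
  rw [Λ.measure_cyl_eq_sum l (joinDeg K 0 (fun i => N - n i)) fun j => by
    rw [hl, joinDeg_of_notMem K _ _ j.2, joinDeg_of_notMem K _ _ j.2]; simp]
  have h1 : ∀ b ∈ Λ.pathsFrom (Λ.s l) (joinDeg K 0 (fun i => N - n i)),
      Λ.pathMeasure hκ hu C m {x | x.1 ∈ (cyl (Λ.comp l b) : Set Λ.PathSpace)} =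
      ENNReal.ofReal (C * (Real.exp (-degDot r (Λ.d l)) * Λ.weight r κ b)) := fun b hb => by
    obtain ⟨hb1, hb2⟩ := Λ.mem_pathsFrom.1 hb
    rw [Λ.pathMeasure_cyl_of_steps hκ hu hC m N _
      (by rw [Λ.d_comp _ _ hb2.symm, hb1, hl, hq]), Λ.weight_comp _ _ hb2.symm]
  rw [Finset.sum_congr rfl h1, ← ENNReal.ofReal_sum_of_nonneg fun b _ =>
    mul_nonneg hC (mul_nonneg (Real.exp_pos _).le (Λ.weight_nonneg hκ b)), ← Finset.mul_sum,
    ← Finset.mul_sum, Λ.sum_weight r hP, prod_pow_joinDeg K hK]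
  simp [weight]

/-- Splitting `Z(l)` along extensions of degree `(p,0)` and summing their weights produces the
factor `x_j^{p_j}` in each direction outside `K`. -/
theorem pathMeasure_cyl_add (hP : ∀ i, IsPerronVector (Λ.vertexMatrix i) κ)
    (hK : ∀ i ∈ K, Real.exp (-r i) * specRad (Λ.vertexMatrix i) = 1)
    {C : ℝ} (hC : 0 ≤ C) (m p : {j // j ∉ K} → ℕ) (n : {i // i ∈ K} → ℕ)
    (l : P) (hl : Λ.d l = joinDeg K m n) :
    Λ.pathMeasure hκ hu C (m + p) {x | x.1 ∈ (cyl l : Set Λ.PathSpace)} =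
      ENNReal.ofReal (C * Λ.weight r κ l) *
        ∏ j : {j // j ∉ K}, ENNReal.ofReal
          (Real.exp (-r j) * specRad (Λ.vertexMatrix j)) ^ p j := by
  have hx : ∀ i, 0 ≤ Real.exp (-r i) * specRad (Λ.vertexMatrix i) := fun i =>
    mul_nonneg (Real.exp_pos _).le ENNReal.toReal_nonneg
  have hq : joinDeg K m n + joinDeg K p 0 = joinDeg K (m + p) n := by
    funext i
    by_cases hi : i ∈ K
    · simp [joinDeg_of_mem K _ _ hi]
    · simp [joinDeg_of_notMem K _ _ hi]
  rw [Λ.measure_cyl_eq_sum l (joinDeg K p 0) fun j => by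
    rw [hl, joinDeg_of_notMem K _ _ j.2, joinDeg_of_notMem K _ _ j.2]; simp]
  have h1 : ∀ b ∈ Λ.pathsFrom (Λ.s l) (joinDeg K p 0),
      Λ.pathMeasure hκ hu C (m + p) {x | x.1 ∈ (cyl (Λ.comp l b) : Set Λ.PathSpace)} =
      ENNReal.ofReal (C * (Real.exp (-degDot r (Λ.d l)) * Λ.weight r κ b)) := fun b hb => by
    obtain ⟨hb1, hb2⟩ := Λ.mem_pathsFrom.1 hb
    rw [Λ.pathMeasure_cyl hκ hu hP hK hC (m + p) n _
      (by rw [Λ.d_comp _ _ hb2.symm, hb1, hl, hq]), Λ.weight_comp _ _ hb2.symm]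
  rw [Finset.sum_congr rfl h1, ← ENNReal.ofReal_sum_of_nonneg fun b _ =>
    mul_nonneg hC (mul_nonneg (Real.exp_pos _).le (Λ.weight_nonneg hκ b)), ← Finset.mul_sum,
    ← Finset.mul_sum, Λ.sum_weight r hP, prod_pow_joinDeg K hK]
  simp_rw [← ENNReal.ofReal_pow (hx _)]
  rw [← ENNReal.ofReal_prod_of_nonneg fun j _ => pow_nonneg (hx _) _,
    ← ENNReal.ofReal_mul (mul_nonneg hC (Λ.weight_nonneg hκ _))]
  congr 1
  rw [weight]
  ring

/-- After the substitution `p ↦ m + p` the series is a product of geometric series with ratios `x_j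
< 1`. The constant `C_J` is the inverse of that product. -/
theorem tsum_pathMeasure_cyl (hP : ∀ i, IsPerronVector (Λ.vertexMatrix i) κ)
    (hK : ∀ i ∈ K, Real.exp (-r i) * specRad (Λ.vertexMatrix i) = 1)
    (hJ : ∀ j ∉ K, Real.exp (-r j) * specRad (Λ.vertexMatrix j) < 1)
    (m : {j // j ∉ K} → ℕ) (n : {i // i ∈ K} → ℕ) (l : P) (hl : Λ.d l = joinDeg K m n) :
    ∑' p : {p // m ≤ p}, Λ.pathMeasure hκ hu
        (∏ j ∈ Kᶜ, (1 - Real.exp (-r j) * specRad (Λ.vertexMatrix j))) p.1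
        {x | x.1 ∈ (cyl l : Set Λ.PathSpace)} = ENNReal.ofReal (Λ.weight r κ l) := by
  have hx : ∀ i, 0 ≤ Real.exp (-r i) * specRad (Λ.vertexMatrix i) := fun i =>
    mul_nonneg (Real.exp_pos _).le ENNReal.toReal_nonneg
  have hpos : ∀ j ∉ K, 0 < 1 - Real.exp (-r j) * specRad (Λ.vertexMatrix j) := fun j hj =>
    sub_pos.2 (hJ j hj)
  have hC : 0 < ∏ j ∈ Kᶜ, (1 - Real.exp (-r j) * specRad (Λ.vertexMatrix j)) :=
    Finset.prod_pos fun j hj => hpos j (Finset.mem_compl.1 hj)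
  let e : ({j // j ∉ K} → ℕ) ≃ {p : {j // j ∉ K} → ℕ // m ≤ p} :=
    { toFun := fun p => ⟨m + p, le_self_add⟩
      invFun := fun p => p.1 - m
      left_inv := fun p => add_tsub_cancel_left m p
      right_inv := fun p => Subtype.ext (add_tsub_cancel_of_le p.2) }
  rw [← e.tsum_eq]
  refine (tsum_congr fun p => Λ.pathMeasure_cyl_add hκ hu hP hK hC.le m p n l hl).trans ?_
  rw [ENNReal.tsum_mul_left, ENNReal.tsum_pi_prod (fun (j : {j // j ∉ K}) a =>
    ENNReal.ofReal (Real.exp (-r j) * specRad (Λ.vertexMatrix j)) ^ a)]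
  simp_rw [ENNReal.tsum_geometric]
  have h1 : ∀ j : {j // j ∉ K},
      (1 - ENNReal.ofReal (Real.exp (-r j) * specRad (Λ.vertexMatrix j)))⁻¹ =
      ENNReal.ofReal (1 - Real.exp (-r j) * specRad (Λ.vertexMatrix j))⁻¹ := fun j => by
    rw [ENNReal.ofReal_inv_of_pos (hpos j j.2), ENNReal.ofReal_sub _ (hx _), ENNReal.ofReal_one]
  rw [Finset.prod_congr rfl fun j _ => h1 j, ← ENNReal.ofReal_prod_of_nonneg
    fun (j : {j // j ∉ K}) _ => inv_nonneg.2 (hpos j j.2).le,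
    ← ENNReal.ofReal_mul (mul_nonneg hC.le (Λ.weight_nonneg hκ _))]
  congr 1
  rw [← Finset.prod_subtype (p := fun j => j ∉ K) Kᶜ (by simp) fun j =>
    (1 - Real.exp (-r j) * specRad (Λ.vertexMatrix j))⁻¹, Finset.prod_inv_distrib]
  field_simp

end pathMeasure

theorem measure_cyl_eq_zero {K : Finset (Fin k)} {m p : {j // j ∉ K} → ℕ} {n : {i // i ∈ K} → ℕ}
    {l : P} (hl : Λ.d l = joinDeg K m n) (h : ¬ m ≤ p) (ν : Measure (Λ.semiPaths K p)) :
    ν {x | x.1 ∈ (cyl l : Set Λ.PathSpace)} = 0 := by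
  convert measure_empty (μ := ν)
  refine Set.eq_empty_of_forall_notMem fun x hx => h fun j => ?_
  have h1 := hx.1 j
  rw [hl, joinDeg_of_notMem K _ _ j.2, x.2.1 j] at h1
  exact_mod_cast h1

theorem tsum_measure_cyl {K : Finset (Fin k)} {m : {j // j ∉ K} → ℕ} {n : {i // i ∈ K} → ℕ}
    {l : P} (hl : Λ.d l = joinDeg K m n) (ν : ∀ p, Measure (Λ.semiPaths K p)) :
    ∑' p, ν p {x | x.1 ∈ (cyl l : Set Λ.PathSpace)} =
      ∑' p : {p // m ≤ p}, ν p.1 {x | x.1 ∈ (cyl l : Set Λ.PathSpace)} := by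
  symm
  refine tsum_subtype_eq_of_support_subset (s := {p | m ≤ p})
    (f := fun p => ν p {x | x.1 ∈ (cyl l : Set Λ.PathSpace)}) fun p hp => ?_
  by_contra h
  exact hp (Λ.measure_cyl_eq_zero hl h _)

theorem exists_joinDeg (K : Finset (Fin k)) (q : Fin k → ℕ) : ∃ m n, q = joinDeg K m n :=
  ⟨fun j => q j, fun i => q i, by
    funext i
    by_cases hi : i ∈ K
    · rw [joinDeg_of_mem K _ _ hi]
    · rw [joinDeg_of_notMem K _ _ hi]⟩

end FiniteKGraph

namespace FiniteKGraph
variable {k : ℕ} {V P : Type u} (Λ : FiniteKGraph k V P)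

open PathSpace

/-! ### The monomials `t_σ t_τ⋆` span a dense subspace -/

theorem t_mul_t {σ τ : P} (h : Λ.s σ = Λ.r τ) : Λ.t σ * Λ.t τ = Λ.t (Λ.comp σ τ) :=
  Λ.isTCK_t.T2 _ _ h

theorem t_mul_vtx (σ : P) : Λ.t σ * Λ.t (Λ.vtx (Λ.s σ)) = Λ.t σ := by
  rw [Λ.t_mul_t (Λ.r_vtx _).symm, Λ.comp_vtx]

theorem vtx_mul_t (σ : P) : Λ.t (Λ.vtx (Λ.r σ)) * Λ.t σ = Λ.t σ := by
  rw [Λ.t_mul_t (Λ.s_vtx _), Λ.vtx_comp]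

theorem t_mul_t_of_ne {σ τ : P} (h : Λ.s σ ≠ Λ.r τ) : Λ.t σ * Λ.t τ = 0 := by
  rw [← Λ.t_mul_vtx σ, ← Λ.vtx_mul_t τ, mul_assoc, ← mul_assoc (Λ.t (Λ.vtx (Λ.s σ))),
    Λ.isTCK_t.T1_orth _ _ h, zero_mul, mul_zero]

theorem star_t_vtx (v : V) : star (Λ.t (Λ.vtx v)) = Λ.t (Λ.vtx v) :=
  (Λ.isTCK_t.T1_proj v).isSelfAdjoint.star_eq

theorem t_eq_monomial (σ : P) : Λ.t σ = Λ.t σ * star (Λ.t (Λ.vtx (Λ.s σ))) := by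
  rw [star_t_vtx, t_mul_vtx]

/-- The monomials `t_σ t_τ⋆`. -/
def monomials : Set Λ.ToeplitzAlgebra := Set.range fun p : P × P => Λ.t p.1 * star (Λ.t p.2)

theorem monomial_mem_span (σ τ : P) :
    Λ.t σ * star (Λ.t τ) ∈ Submodule.span ℂ Λ.monomials :=
  Submodule.subset_span ⟨(σ, τ), rfl⟩

/-- (T5) turns the inner factor `t_τ⋆ t_σ'` into a sum of monomials, and the outer factors are
absorbed by composition or give 0. -/
theorem monomial_mul_monomial_mem (σ τ σ' τ' : P) :
    Λ.t σ * star (Λ.t τ) * (Λ.t σ' * star (Λ.t τ')) ∈ Submodule.span ℂ Λ.monomials := by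
  have e : Λ.t σ * star (Λ.t τ) * (Λ.t σ' * star (Λ.t τ')) =
      Λ.t σ * (star (Λ.t τ) * Λ.t σ') * star (Λ.t τ') := by simp only [mul_assoc]
  rw [e, Λ.isTCK_t.T5, Finset.mul_sum, Finset.sum_mul]
  refine Submodule.sum_mem _ fun p _ => ?_
  have e2 : Λ.t σ * (Λ.t p.1 * star (Λ.t p.2)) * star (Λ.t τ') =
      (Λ.t σ * Λ.t p.1) * star (Λ.t τ' * Λ.t p.2) := by simp only [mul_assoc, star_mul]
  rw [e2]
  by_cases h1 : Λ.s σ = Λ.r p.1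
  · by_cases h2 : Λ.s τ' = Λ.r p.2
    · rw [Λ.t_mul_t h1, Λ.t_mul_t h2]
      exact Λ.monomial_mem_span _ _
    · rw [Λ.t_mul_t_of_ne h2, star_zero, mul_zero]
      exact Submodule.zero_mem _
  · rw [Λ.t_mul_t_of_ne h1, zero_mul]
    exact Submodule.zero_mem _

theorem mul_mem_span {a b : Λ.ToeplitzAlgebra} (ha : a ∈ Submodule.span ℂ Λ.monomials)
    (hb : b ∈ Submodule.span ℂ Λ.monomials) : a * b ∈ Submodule.span ℂ Λ.monomials := by
  induction ha using Submodule.span_induction with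
  | zero => rw [zero_mul]; exact Submodule.zero_mem _
  | add x y _ _ hx hy => rw [add_mul]; exact Submodule.add_mem _ hx hy
  | smul c x _ hx => rw [smul_mul_assoc]; exact Submodule.smul_mem _ c hx
  | mem x hx =>
    obtain ⟨p, rfl⟩ := hx
    induction hb using Submodule.span_induction with
    | zero => rw [mul_zero]; exact Submodule.zero_mem _
    | add x y _ _ hx hy => rw [mul_add]; exact Submodule.add_mem _ hx hy
    | smul c x _ hx => rw [mul_smul_comm]; exact Submodule.smul_mem _ c hx
    | mem x hx =>
      obtain ⟨q, rfl⟩ := hx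
      exact Λ.monomial_mul_monomial_mem _ _ _ _

theorem star_mem_span {a : Λ.ToeplitzAlgebra} (ha : a ∈ Submodule.span ℂ Λ.monomials) :
    star a ∈ Submodule.span ℂ Λ.monomials := by
  induction ha using Submodule.span_induction with
  | zero => rw [star_zero]; exact Submodule.zero_mem _
  | add x y _ _ hx hy => rw [star_add]; exact Submodule.add_mem _ hx hy
  | smul c x _ hx => rw [star_smul]; exact Submodule.smul_mem _ _ hx
  | mem x hx =>
    obtain ⟨p, rfl⟩ := hx
    simp only [star_mul, star_star]
    exact Λ.monomial_mem_span _ _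

/-- The span of the monomials is closed under products and adjoints, and it contains the generators
because `t_l = t_l t_{s(l)}⋆`. -/
theorem mem_closure_span (a : Λ.ToeplitzAlgebra) :
    a ∈ closure (Submodule.span ℂ Λ.monomials : Set Λ.ToeplitzAlgebra) := by
  rw [closure_subtype]
  refine closure_mono ?_ a.2
  intro x hx
  induction hx using NonUnitalStarAlgebra.adjoin_induction with
  | mem x hx =>
    obtain ⟨l, rfl⟩ := hx
    exact ⟨Λ.t l, by rw [Λ.t_eq_monomial]; exact Λ.monomial_mem_span _ _, rfl⟩
  | add x y _ _ hx hy =>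
    obtain ⟨x, hx, rfl⟩ := hx
    obtain ⟨y, hy, rfl⟩ := hy
    exact ⟨x + y, Submodule.add_mem _ hx hy, rfl⟩
  | zero => exact ⟨0, Submodule.zero_mem _, rfl⟩
  | mul x y _ _ hx hy =>
    obtain ⟨x, hx, rfl⟩ := hx
    obtain ⟨y, hy, rfl⟩ := hy
    exact ⟨x * y, Λ.mul_mem_span hx hy, rfl⟩
  | smul c x _ hx =>
    obtain ⟨x, hx, rfl⟩ := hx
    exact ⟨c • x, Submodule.smul_mem _ c hx, rfl⟩
  | star x _ hx =>
    obtain ⟨x, hx, rfl⟩ := hx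
    exact ⟨star x, Λ.star_mem_span hx, rfl⟩

variable {Λ} in
/-- To prove a closed property of all elements of the Toeplitz algebra, it suffices to treat the
monomials and linear combinations. -/
theorem toeplitz_induction {p : Λ.ToeplitzAlgebra → Prop}
    (monomial : ∀ σ τ, p (Λ.t σ * star (Λ.t τ))) (zero : p 0) (add : ∀ a b, p a → p b → p (a + b))
    (smul : ∀ (c : ℂ) a, p a → p (c • a))
    (closed : ∀ a, a ∈ closure {b | p b} → p a) (a : Λ.ToeplitzAlgebra) : p a := by
  refine closed a (closure_mono ?_ (Λ.mem_closure_span a))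
  intro b hb
  induction hb using Submodule.span_induction with
  | zero => exact zero
  | add x y _ _ hx hy => exact add x y hx hy
  | smul c x _ hx => exact smul c x hx
  | mem x hx => obtain ⟨q, rfl⟩ := hx; exact monomial _ _

theorem clm_ext {E : Type*} [NormedAddCommGroup E] [NormedSpace ℂ E]
    {f g : Λ.ToeplitzAlgebra →L[ℂ] E}
    (h : ∀ σ τ, f (Λ.t σ * star (Λ.t τ)) = g (Λ.t σ * star (Λ.t τ))) : f = g := by
  refine ContinuousLinearMap.ext_on (s := Λ.monomials) (fun a => Λ.mem_closure_span a) ?_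
  rintro _ ⟨p, rfl⟩
  exact h _ _

/-! ### The gauge action and the expectation -/

theorem norm_gauge_le (z : Fin k → Circle) (a : Λ.ToeplitzAlgebra) : ‖Λ.gauge z a‖ ≤ ‖a‖ :=
  NonUnitalStarAlgHom.norm_apply_le _ a

theorem gauge_monomial (z : Fin k → Circle) (σ τ : P) : Λ.gauge z (Λ.t σ * star (Λ.t τ)) =
    ((mpow z (Λ.d σ) : Circle) * star ((mpow z (Λ.d τ) : Circle) : ℂ)) •
      (Λ.t σ * star (Λ.t τ)) := by
  rw [map_mul, map_star, gauge_t, gauge_t, star_smul, smul_mul_smul_comm]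

/-- The action `θ ↦ γ_{e^{2πiθ}}` of the torus `(ℝ/ℤ)ᵏ`. -/
noncomputable def torusGauge (θ : Fin k → UnitAddCircle) :
    Λ.ToeplitzAlgebra →⋆ₙₐ[ℂ] Λ.ToeplitzAlgebra :=
  Λ.gauge fun i => AddCircle.toCircle (θ i)

theorem coe_mpow (z : Fin k → Circle) (n : Fin k → ℕ) :
    ((mpow z n : Circle) : ℂ) = ∏ i, (z i : ℂ) ^ n i := by
  rw [mpow]
  exact (map_prod Circle.coeHom _ _).trans (by simp only [map_pow]; rfl)

theorem torusGauge_monomial (θ : Fin k → UnitAddCircle) (σ τ : P) :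
    Λ.torusGauge θ (Λ.t σ * star (Λ.t τ)) =
      (∏ i, fourier ((Λ.d σ i : ℤ) - Λ.d τ i) (θ i)) • (Λ.t σ * star (Λ.t τ)) := by
  rw [torusGauge, gauge_monomial]
  congr 1
  rw [coe_mpow, coe_mpow, star_prod, ← Finset.prod_mul_distrib]
  refine Finset.prod_congr rfl fun i _ => ?_
  rw [sub_eq_add_neg, fourier_add, fourier_neg, fourier_apply, fourier_apply, natCast_zsmul,
    natCast_zsmul, AddCircle.toCircle_nsmul, AddCircle.toCircle_nsmul]
  simp

/-- On monomials the orbit is a trigonometric polynomial. Since every `γ_z` is contractive,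
approximation of `a` gives uniform approximation of its orbit. -/
theorem continuous_torusGauge (a : Λ.ToeplitzAlgebra) :
    Continuous fun θ => Λ.torusGauge θ a := by
  induction a using toeplitz_induction with
  | monomial σ τ =>
    simp only [torusGauge_monomial]
    fun_prop
  | zero => simpa only [map_zero] using continuous_const
  | add a b ha hb =>
    simp only [map_add]
    exact ha.add hb
  | smul c a ha =>
    simp only [map_smul]
    exact ha.const_smul c
  | closed a ha =>
    refine continuous_of_uniform_approx_of_continuous fun U hU => ?_
    obtain ⟨ε, hε, hεU⟩ := Metric.mem_uniformity_dist.1 hU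
    obtain ⟨b, hb, hab⟩ := Metric.mem_closure_iff.1 ha ε hε
    refine ⟨_, hb, fun θ => hεU ?_⟩
    rw [dist_eq_norm, ← map_sub]
    exact (Λ.norm_gauge_le _ _).trans_lt (by rwa [← dist_eq_norm])

/-- The normalised Haar measure of the torus. -/
noncomputable abbrev torusMeasure (k : ℕ) : Measure (Fin k → UnitAddCircle) :=
  Measure.pi fun _ => AddCircle.haarAddCircle

theorem integrable_torusGauge (a : Λ.ToeplitzAlgebra) :
    Integrable (fun θ => Λ.torusGauge θ a) (torusMeasure k) :=
  (Λ.continuous_torusGauge a).integrable_of_hasCompactSupport (HasCompactSupport.of_compactSpace _)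

theorem expectation_eq (a : Λ.ToeplitzAlgebra) :
    Λ.expectation a = ∫ θ, Λ.torusGauge θ a ∂torusMeasure k := rfl

theorem clm_expectation {E : Type*} [NormedAddCommGroup E] [NormedSpace ℂ E] [CompleteSpace E]
    (f : Λ.ToeplitzAlgebra →L[ℂ] E) (a : Λ.ToeplitzAlgebra) :
    f (Λ.expectation a) = ∫ θ, f (Λ.torusGauge θ a) ∂torusMeasure k :=
  (f.integral_comp_comm (Λ.integrable_torusGauge a)).symm

theorem norm_expectation_le (a : Λ.ToeplitzAlgebra) : ‖Λ.expectation a‖ ≤ ‖a‖ := by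
  refine (norm_integral_le_of_norm_le_const (C := ‖a‖)
    (Filter.Eventually.of_forall fun θ => Λ.norm_gauge_le _ a)).trans ?_
  simp

/-- The expectation, as a bounded linear map. -/
noncomputable def expectationL : Λ.ToeplitzAlgebra →L[ℂ] Λ.ToeplitzAlgebra :=
  LinearMap.mkContinuous
    { toFun := Λ.expectation
      map_add' := fun a b => by
        simp only [expectation_eq, map_add]
        exact integral_add (Λ.integrable_torusGauge a) (Λ.integrable_torusGauge b)
      map_smul' := fun c a => by
        simp only [expectation_eq, map_smul, RingHom.id_apply]
        exact integral_smul c _ } 1 fun a => by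
    rw [one_mul]; exact Λ.norm_expectation_le a

/-- The integral is the inner product with the constant character, so this is the orthonormality of
the characters. -/
theorem integral_fourier (n : ℤ) :
    ∫ x, fourier n x ∂(AddCircle.haarAddCircle (T := (1 : ℝ))) = if n = 0 then 1 else 0 := by
  have h := orthonormal_iff_ite.1 (orthonormal_fourier (T := (1 : ℝ))) 0 n
  have h2 := ContinuousMap.inner_toLp (𝕜 := ℂ) (AddCircle.haarAddCircle (T := (1 : ℝ)))
    (fourier 0) (fourier n)
  rw [fourierLp, fourierLp, h2] at h
  simpa [eq_comm] using h

/-- The integral factors over the coordinates of the torus, and a coordinate in which the degrees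
differ integrates a non-trivial character. -/
theorem expectation_monomial (σ τ : P) : Λ.expectation (Λ.t σ * star (Λ.t τ)) =
    if Λ.d σ = Λ.d τ then Λ.t σ * star (Λ.t τ) else 0 := by
  simp only [expectation_eq, torusGauge_monomial]
  rw [integral_smul_const, integral_fintype_prod_eq_prod (fun i => fourier
    ((Λ.d σ i : ℤ) - Λ.d τ i))]
  simp only [integral_fourier, sub_eq_zero, Nat.cast_inj]
  split_ifs with h
  · simp [h]
  · obtain ⟨i, hi⟩ := Function.ne_iff.1 h
    rw [Finset.prod_eq_zero (Finset.mem_univ i) (if_neg hi), zero_smul]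

end FiniteKGraph

namespace FiniteKGraph
variable {k : ℕ} {V P : Type u} (Λ : FiniteKGraph k V P)

open PathSpace

/-! ### The vector functionals of the semi-infinite path representation -/

section vectorFunctional
variable (K : Finset (Fin k)) (m : {j // j ∉ K} → ℕ) (x : Λ.semiPaths K m)

theorem norm_pointMass : ‖Λ.pointMass K m x‖ = 1 := by
  classical
  rw [pointMass, lp.norm_single (by norm_num), norm_one]

theorem norm_semiRep_le (a : Λ.ToeplitzAlgebra) : ‖Λ.semiRep K a‖ ≤ ‖a‖ :=
  NonUnitalStarAlgHom.norm_apply_le _ a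

/-- The vector functional `a ↦ (π^K(a) ξ_{m,x} | ξ_{m,x})`. -/
noncomputable def vectorFunctional : Λ.ToeplitzAlgebra →L[ℂ] ℂ :=
  LinearMap.mkContinuous
    { toFun := fun a => inner ℂ (Λ.pointMass K m x) (Λ.semiRep K a (Λ.pointMass K m x))
      map_add' := fun a b => by rw [map_add, add_apply, inner_add_right]
      map_smul' := fun c a => by
        rw [map_smul, smul_apply, inner_smul_right, RingHom.id_apply, smul_eq_mul] } 1 fun a => by
    refine (norm_inner_le_norm (𝕜 := ℂ) (Λ.pointMass K m x)
      (Λ.semiRep K a (Λ.pointMass K m x))).trans ?_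
    have h := (Λ.semiRep K a).le_opNorm (Λ.pointMass K m x)
    rw [norm_pointMass, mul_one] at h
    rw [norm_pointMass, one_mul, one_mul]
    exact h.trans (Λ.norm_semiRep_le K a)

theorem vectorFunctional_apply (a : Λ.ToeplitzAlgebra) : Λ.vectorFunctional K m x a =
    inner ℂ (Λ.pointMass K m x) (Λ.semiRep K a (Λ.pointMass K m x)) := rfl

theorem norm_vectorFunctional_le (a : Λ.ToeplitzAlgebra) :
    ‖Λ.vectorFunctional K m x a‖ ≤ ‖a‖ := by
  have h := (Λ.vectorFunctional K m x).le_of_opNorm_le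
    (LinearMap.mkContinuous_norm_le _ zero_le_one _) a
  rwa [one_mul] at h

theorem vectorFunctional_star_mul (a : Λ.ToeplitzAlgebra) :
    Λ.vectorFunctional K m x (star a * a) =
      ((‖Λ.semiRep K a (Λ.pointMass K m x)‖ ^ 2 : ℝ) : ℂ) := by
  rw [vectorFunctional_apply, map_mul, map_star, mul_apply_eq_comp,
    ContinuousLinearMap.star_eq_adjoint, ContinuousLinearMap.adjoint_inner_right,
    inner_self_eq_norm_sq_to_K]
  norm_cast

theorem semiRep_monomial (σ τ : P) : Λ.semiRep K (Λ.t σ * star (Λ.t τ)) =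
    pequivOp ((Λ.cons K τ).symm.trans (Λ.cons K σ)) := by
  have h : ∀ l, Λ.semiRep K (Λ.t l) = pequivOp (Λ.cons K l) := fun l => rfl
  rw [map_mul, map_star, h, h, star_pequivOp, ← pequivOp_trans]

theorem cons_symm_trans_cons {σ τ : P} {x y : Λ.semiInf K}
    (h : (Λ.cons K τ).symm.trans (Λ.cons K σ) x = some y) :
    x.1 ∈ (cyl τ : Set Λ.PathSpace) ∧ y.1 ∈ (cyl σ : Set Λ.PathSpace) := by
  obtain ⟨z, h1, h2⟩ := Option.bind_eq_some_iff.1 h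
  obtain ⟨h3, h4⟩ := Λ.cons_eq_some ((PEquiv.eq_some_iff _).1 h1)
  obtain ⟨h5, h6⟩ := Λ.cons_eq_some h2
  exact ⟨h4 ▸ prepend_mem_cyl _ _ h3, h6 ▸ prepend_mem_cyl _ _ h5⟩

open Classical in
theorem cons_symm_trans_cons_self (σ : P) (x : Λ.semiInf K) :
    (Λ.cons K σ).symm.trans (Λ.cons K σ) x =
      if x.1 ∈ (cyl σ : Set Λ.PathSpace) then some x else none := by
  split_ifs with h
  · have h1 : (Λ.cons K σ).symm x = some ⟨x.1.shift (Λ.d σ) h.1, shift_mem h.1 x.2⟩ := dif_pos h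
    change ((Λ.cons K σ).symm x).bind (Λ.cons K σ) = some x
    rw [h1, Option.bind_some, ← PEquiv.eq_some_iff, h1]
  · cases h1 : (Λ.cons K σ).symm.trans (Λ.cons K σ) x with
    | none => rfl
    | some y => exact absurd (Λ.cons_symm_trans_cons K h1).1 h

-- The operator of the monomial moves a point mass from `Z(τ)` to `Z(σ)`. A fixed point lies in both
-- cylinders, which for equal degrees forces `σ = τ`.
open Classical in
theorem vectorFunctional_monomial {σ τ : P} (hd : Λ.d σ = Λ.d τ) :
    Λ.vectorFunctional K m x (Λ.t σ * star (Λ.t τ)) =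
      if σ = τ ∧ x.1 ∈ (cyl σ : Set Λ.PathSpace) then 1 else 0 := by
  rw [vectorFunctional_apply, semiRep_monomial, pointMass, pequivOp_single]
  by_cases hστ : σ = τ
  · subst hστ
    rw [cons_symm_trans_cons_self]
    have hx : (Λ.toSemiInf K m x).1 = x.1 := rfl
    simp only [hx, true_and]
    split_ifs
    · rw [Option.elim_some, lp.inner_single_left]
      simp
    · simp
  · rw [if_neg fun h => hστ h.1]
    cases h1 : (Λ.cons K τ).symm.trans (Λ.cons K σ) (Λ.toSemiInf K m x) with
    | none => simp
    | some y =>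
      obtain ⟨h2, h3⟩ := Λ.cons_symm_trans_cons K h1
      have hne : Λ.toSemiInf K m x ≠ y := by
        rintro rfl
        exact hστ (Λ.eq_of_mem_cyl h3 h2 hd)
      rw [Option.elim_some, lp.inner_single_left]
      simp [hne]

/-- A semi-infinite path has infinite degree in direction `i ∈ K`, so it has exactly one initial
edge of degree `e_i`. The range projections of the edges from `v` therefore exhaust the projection
of `v`. -/
theorem semiRep_gap {i : Fin k} (hi : i ∈ K) (v : V) : Λ.semiRep K (Λ.gap v i) = 0 := by
  classical
  rw [gap, map_sub, map_sum, sub_eq_zero]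
  simp only [semiRep_monomial]
  have h : Λ.semiRep K (Λ.t (Λ.vtx v)) = pequivOp (Λ.cons K (Λ.vtx v)) := rfl
  rw [h]
  ext f x
  rw [sum_apply, lp.coeFn_sum, Finset.sum_apply, pequivOp_apply, cons_vtx_symm, cons_vtx]
  have h1 : ∀ e, pequivOp ((Λ.cons K e).symm.trans (Λ.cons K e)) f x =
      if x.1 ∈ (cyl e : Set Λ.PathSpace) then f x else 0 := fun e => by
    rw [pequivOp_apply, PEquiv.symm_trans_rev, PEquiv.symm_symm, cons_symm_trans_cons_self]
    split_ifs <;> rfl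
  simp only [h1]
  split_ifs with hv
  · have hB : Below (Pi.single i 1) x.1.deg := fun j => by
      by_cases hj : j = i
      · subst hj; rw [(mem_semiInf.1 x.2).2 j hi]; exact le_top
      · simp [hj]
    have hd := x.1.d_init _ hB
    have hmem : x.1 ∈ (cyl (x.1.init _ hB) : Set Λ.PathSpace) :=
      ⟨by rw [hd]; exact hB, init_congr _ hd _⟩
    rw [Finset.sum_eq_single (x.1.init _ hB), if_pos hmem]
    · rfl
    · intro e he hne
      refine if_neg fun hx => hne (Λ.eq_of_mem_cyl hx hmem ?_)
      rw [(Λ.mem_pathsFrom.1 he).1, hd]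
    · intro hn
      exact absurd (Λ.mem_pathsFrom.2 ⟨hd, by rw [r_init, hv]⟩) hn
  · symm
    refine Finset.sum_eq_zero fun e he => if_neg fun hx => hv ?_
    rw [range_of_mem_cyl hx, (Λ.mem_pathsFrom.1 he).2]

/-- The functional `a ↦ (π^K(Φ^γ(a)) ξ_{m,x} | ξ_{m,x})`. -/
noncomputable def diagFunctional : Λ.ToeplitzAlgebra →L[ℂ] ℂ :=
  (Λ.vectorFunctional K m x).comp Λ.expectationL

theorem diagFunctional_apply (a : Λ.ToeplitzAlgebra) :
    Λ.diagFunctional K m x a = Λ.vectorFunctional K m x (Λ.expectation a) := rfl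

theorem diagFunctional_eq_integral (a : Λ.ToeplitzAlgebra) : Λ.diagFunctional K m x a =
    ∫ θ, Λ.vectorFunctional K m x (Λ.torusGauge θ a) ∂torusMeasure k :=
  Λ.clm_expectation (Λ.vectorFunctional K m x) a

theorem norm_diagFunctional_le (a : Λ.ToeplitzAlgebra) : ‖Λ.diagFunctional K m x a‖ ≤ ‖a‖ :=
  (Λ.norm_vectorFunctional_le K m x _).trans (Λ.norm_expectation_le a)

/-- The functional is the average over the torus of `‖π^K(γ_z(a)) ξ‖²`, which is visibly
non-negative. -/
theorem diagFunctional_star_mul (a : Λ.ToeplitzAlgebra) :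
    ∃ c : ℝ, 0 ≤ c ∧ Λ.diagFunctional K m x (star a * a) = c := by
  refine ⟨∫ θ, ‖Λ.semiRep K (Λ.torusGauge θ a) (Λ.pointMass K m x)‖ ^ 2 ∂torusMeasure k,
    integral_nonneg fun _ => sq_nonneg _, ?_⟩
  rw [diagFunctional_eq_integral, ← integral_complex_ofReal]
  simp only [map_mul, map_star, vectorFunctional_star_mul]

open Classical in
theorem diagFunctional_monomial (σ τ : P) :
    Λ.diagFunctional K m x (Λ.t σ * star (Λ.t τ)) =
      if σ = τ ∧ x.1 ∈ (cyl σ : Set Λ.PathSpace) then 1 else 0 := by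
  rw [diagFunctional_apply, expectation_monomial]
  split_ifs with h1 h2 h2
  · rw [vectorFunctional_monomial _ _ _ _ h1, if_pos h2]
  · rw [vectorFunctional_monomial _ _ _ _ h1, if_neg h2]
  · exact absurd (congrArg Λ.d h2.1) h1
  · rw [map_zero]

/-- The generators of the ideal are gauge invariant and are killed by `π^K`. Hence each `π^K ∘ γ_z`
vanishes on the whole closed ideal, and so does the integrand of the average. -/
theorem diagFunctional_of_mem_closedIdeal {a : Λ.ToeplitzAlgebra}
    (ha : a ∈ closedIdeal {b | ∃ v, ∃ i ∈ K, b = Λ.gap v i}) : Λ.diagFunctional K m x a = 0 := by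
  rw [diagFunctional_eq_integral]
  refine integral_eq_zero_of_ae (Filter.Eventually.of_forall fun θ => ?_)
  have hgap : ∀ v i, Λ.torusGauge θ (Λ.gap v i) = Λ.gap v i := fun v i => by
    have h1 := Λ.torusGauge_monomial θ (Λ.vtx v) (Λ.vtx v)
    have h2 := Λ.t_eq_monomial (Λ.vtx v)
    rw [Λ.s_vtx] at h2
    rw [← h2] at h1
    simp only [gap, map_sub, map_sum, torusGauge_monomial, h1]
    simp
  set f : Λ.ToeplitzAlgebra →⋆ₙₐ[ℂ] (Λ.semiHilbert K →L[ℂ] Λ.semiHilbert K) :=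
    (Λ.semiRep K).comp (Λ.torusGauge θ) with hf
  have h0 : f a = 0 := by
    have hsub : closedIdeal {b | ∃ v, ∃ i ∈ K, b = Λ.gap v i} ⊆ {a | f a = 0} := by
      refine closure_minimal ?_ (isClosed_eq
        (AddMonoidHomClass.continuous_of_bound f 1 fun a => by
          rw [one_mul]; exact NonUnitalStarAlgHom.norm_apply_le f a) continuous_const)
      have h1 : TwoSidedIdeal.span {b | ∃ v, ∃ i ∈ K, b = Λ.gap v i} ≤ TwoSidedIdeal.ker f := by
        rw [TwoSidedIdeal.span_le]
        rintro _ ⟨v, i, hi, rfl⟩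
        change _ ∈ TwoSidedIdeal.ker f
        rw [TwoSidedIdeal.mem_ker]
        rw [hf, NonUnitalStarAlgHom.comp_apply, hgap, semiRep_gap _ _ hi]
      intro b hb
      exact (TwoSidedIdeal.mem_ker f).1 (h1 hb)
    exact hsub ha
  have h2 : Λ.semiRep K (Λ.torusGauge θ a) = 0 := h0
  change Λ.vectorFunctional K m x _ = 0
  rw [vectorFunctional_apply, h2]
  simp

end vectorFunctional

/-! ### The state defined by a family of measures -/

section pathState
variable {K : Finset (Fin k)} (ν : ∀ m : {j // j ∉ K} → ℕ, Measure (Λ.semiPaths K m))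

/-- On monomials the function of `x` is zero or the indicator of a cylinder; the general case is a
pointwise limit of linear combinations. -/
theorem measurable_diagFunctional (m : {j // j ∉ K} → ℕ) (a : Λ.ToeplitzAlgebra) :
    Measurable fun x => Λ.diagFunctional K m x a := by
  classical
  induction a using toeplitz_induction with
  | monomial σ τ =>
    simp only [diagFunctional_monomial]
    exact Measurable.ite ((MeasurableSet.const (σ = τ)).inter
      (measurable_subtype_coe (Λ.measurableSet_cyl σ))) measurable_const measurable_const
  | zero => simp only [map_zero]; exact measurable_const
  | add a b ha hb => simp only [map_add]; exact ha.add hb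
  | smul c a ha => simp only [map_smul]; exact ha.const_smul c
  | closed a ha =>
    obtain ⟨b, hb, hlim⟩ := mem_closure_iff_seq_limit.1 ha
    refine measurable_of_tendsto_metrizable hb (tendsto_pi_nhds.2 fun x => ?_)
    exact ((Λ.diagFunctional K m x).continuous.tendsto a).comp hlim

variable {ν} (hν : ∑' m, ν m Set.univ = 1)
include hν

theorem isFiniteMeasure_of_tsum (m : {j // j ∉ K} → ℕ) : IsFiniteMeasure (ν m) :=
  ⟨(ENNReal.le_tsum m).trans_lt (by rw [hν]; exact ENNReal.one_lt_top)⟩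

theorem integrable_diagFunctional (m : {j // j ∉ K} → ℕ) (a : Λ.ToeplitzAlgebra) :
    Integrable (fun x => Λ.diagFunctional K m x a) (ν m) := by
  have := Λ.isFiniteMeasure_of_tsum hν m
  exact Integrable.of_bound (Λ.measurable_diagFunctional m a).aestronglyMeasurable ‖a‖
    (Filter.Eventually.of_forall fun x => Λ.norm_diagFunctional_le K m x a)

theorem hasSum_real_univ : HasSum (fun m => (ν m).real Set.univ) 1 := by
  have h := ENNReal.hasSum_toReal (f := fun m => ν m Set.univ) (by rw [hν]; exact ENNReal.one_ne_top)
  rwa [← ENNReal.tsum_toReal_eq fun m => (Λ.isFiniteMeasure_of_tsum hν m).1.ne, hν,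
    ENNReal.toReal_one] at h

theorem norm_integral_diagFunctional_le (m : {j // j ∉ K} → ℕ) (a : Λ.ToeplitzAlgebra) :
    ‖∫ x, Λ.diagFunctional K m x a ∂ν m‖ ≤ ‖a‖ * (ν m).real Set.univ := by
  have := Λ.isFiniteMeasure_of_tsum hν m
  exact norm_integral_le_of_norm_le_const
    (Filter.Eventually.of_forall fun x => Λ.norm_diagFunctional_le K m x a)

theorem summable_integral_diagFunctional (a : Λ.ToeplitzAlgebra) :
    Summable fun m => ∫ x, Λ.diagFunctional K m x a ∂ν m :=
  Summable.of_norm_bounded ((Λ.hasSum_real_univ hν).summable.mul_left ‖a‖)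
    fun m => Λ.norm_integral_diagFunctional_le hν m a

/-- The functional `a ↦ ∑ₘ ∫ (π^K(Φ^γ(a)) ξ_{m,x} | ξ_{m,x}) dν^m(x)`. -/
noncomputable def pathState : Λ.ToeplitzAlgebra →L[ℂ] ℂ :=
  LinearMap.mkContinuous
    { toFun := fun a => ∑' m, ∫ x, Λ.diagFunctional K m x a ∂ν m
      map_add' := fun a b => by
        rw [← (Λ.summable_integral_diagFunctional hν a).tsum_add
          (Λ.summable_integral_diagFunctional hν b)]
        refine tsum_congr fun m => ?_
        simp only [map_add]
        exact integral_add (Λ.integrable_diagFunctional hν m a)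
          (Λ.integrable_diagFunctional hν m b)
      map_smul' := fun c a => by
        rw [RingHom.id_apply, smul_eq_mul, ← tsum_mul_left]
        refine tsum_congr fun m => ?_
        simp only [map_smul, smul_eq_mul]
        exact integral_const_mul c _ } 1 fun a => by
    -- The terms are bounded by `‖a‖` times the masses of the `ν m`, which add up to 1.
    have h := tsum_of_norm_bounded ((Λ.hasSum_real_univ hν).mul_left ‖a‖)
      fun m => Λ.norm_integral_diagFunctional_le hν m a
    rwa [mul_comm] at h

theorem hasSum_pathState (a : Λ.ToeplitzAlgebra) :
    HasSum (fun m => ∫ x, Λ.diagFunctional K m x a ∂ν m) (Λ.pathState hν a) :=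
  (Λ.summable_integral_diagFunctional hν a).hasSum

theorem norm_pathState_le : ‖Λ.pathState hν‖ ≤ 1 :=
  LinearMap.mkContinuous_norm_le _ zero_le_one _

theorem pathState_star_mul (a : Λ.ToeplitzAlgebra) :
    0 ≤ (Λ.pathState hν (star a * a)).re ∧ (Λ.pathState hν (star a * a)).im = 0 := by
  choose c hc h using fun m x => Λ.diagFunctional_star_mul K m x a
  have h1 : Λ.pathState hν (star a * a) = ((∑' m, ∫ x, c m x ∂ν m : ℝ) : ℂ) := by
    rw [← (Λ.hasSum_pathState hν _).tsum_eq, Complex.ofReal_tsum]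
    refine tsum_congr fun m => ?_
    rw [← integral_complex_ofReal]
    simp only [h]
  rw [h1, Complex.ofReal_re, Complex.ofReal_im]
  exact ⟨tsum_nonneg fun m => integral_nonneg fun x => hc m x, rfl⟩

-- Integrating the indicator of `Z(σ)` gives the measures of (b), so (b) determines all the values
-- of the state.
open Classical in
theorem pathState_monomial (σ τ : P) : Λ.pathState hν (Λ.t σ * star (Λ.t τ)) =
    if σ = τ then (((∑' m, ν m {x | x.1 ∈ (cyl σ : Set Λ.PathSpace)}).toReal : ℝ) : ℂ) else 0 := by
  rw [← (Λ.hasSum_pathState hν _).tsum_eq]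
  simp only [diagFunctional_monomial]
  split_ifs with h
  · rw [ENNReal.tsum_toReal_eq fun m => by
      have := Λ.isFiniteMeasure_of_tsum hν m
      exact measure_ne_top _ _, Complex.ofReal_tsum]
    refine tsum_congr fun m => ?_
    have := Λ.isFiniteMeasure_of_tsum hν m
    have hms : MeasurableSet {x : Λ.semiPaths K m | x.1 ∈ (cyl σ : Set Λ.PathSpace)} :=
      measurable_subtype_coe (Λ.measurableSet_cyl σ)
    have h2 := integral_indicator_const (μ := ν m) (1 : ℂ) hms
    rw [Complex.real_smul, mul_one] at h2
    refine Eq.trans ?_ h2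
    congr 1
    funext x
    simp [Set.indicator_apply, h]
  · simp [h]

theorem pathState_of_mem_closedIdeal {a : Λ.ToeplitzAlgebra}
    (ha : a ∈ closedIdeal {b | ∃ v, ∃ i ∈ K, b = Λ.gap v i}) : Λ.pathState hν a = 0 := by
  rw [← (Λ.hasSum_pathState hν _).tsum_eq]
  simp only [Λ.diagFunctional_of_mem_closedIdeal K _ _ ha, integral_zero, tsum_zero]

end pathState

end FiniteKGraph

namespace FiniteKGraph
variable {k : ℕ} {V P : Type u} (Λ : FiniteKGraph k V P)

/-! ### The KMS condition -/

theorem circle_exp_mpow (r : Fin k → ℝ) (t : ℝ) (n : Fin k → ℕ) :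
    ((mpow (fun i => Circle.exp (t * r i)) n : Circle) : ℂ) =
      Complex.exp (Complex.I * t * degDot r n) := by
  rw [coe_mpow, degDot, Complex.ofReal_sum, Finset.mul_sum, Complex.exp_sum]
  refine Finset.prod_congr rfl fun i _ => ?_
  rw [Circle.coe_exp, ← Complex.exp_nat_mul]
  congr 1
  push_cast
  ring

theorem dynamics_t (r : Fin k → ℝ) (t : ℝ) (σ : P) : Λ.dynamics r t (Λ.t σ) =
    Complex.exp (Complex.I * t * degDot r (Λ.d σ)) • Λ.t σ := by
  rw [dynamics, gauge_t, circle_exp_mpow]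

theorem dynamics_star_t (r : Fin k → ℝ) (t : ℝ) (σ : P) : Λ.dynamics r t (star (Λ.t σ)) =
    Complex.exp (-(Complex.I * t * degDot r (Λ.d σ))) • star (Λ.t σ) := by
  rw [map_star, dynamics_t, star_smul, Complex.star_def, ← Complex.exp_conj]
  simp

theorem dynamics_monomial (r : Fin k → ℝ) (t : ℝ) (σ τ : P) :
    Λ.dynamics r t (Λ.t σ * star (Λ.t τ)) =
      Complex.exp (Complex.I * t * (degDot r (Λ.d σ) - degDot r (Λ.d τ))) •
        (Λ.t σ * star (Λ.t τ)) := by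
  rw [map_mul, dynamics_t, dynamics_star_t, smul_mul_smul_comm, ← Complex.exp_add]
  congr 2
  ring

theorem continuous_dynamics (r : Fin k → ℝ) (t : ℝ) : Continuous (Λ.dynamics r t) :=
  AddMonoidHomClass.continuous_of_bound (Λ.dynamics r t) 1 fun a => by
    rw [one_mul]; exact Λ.norm_gauge_le _ a

theorem isAnalyticExtension_t (r : Fin k → ℝ) (σ : P) :
    IsAnalyticExtension (fun t => Λ.dynamics r t) (Λ.t σ)
      fun z => Complex.exp (Complex.I * z * degDot r (Λ.d σ)) • Λ.t σ :=
  ⟨by fun_prop, fun t => (Λ.dynamics_t r t σ).symm⟩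

theorem isAnalyticExtension_star_t (r : Fin k → ℝ) (σ : P) :
    IsAnalyticExtension (fun t => Λ.dynamics r t) (star (Λ.t σ))
      fun z => Complex.exp (-(Complex.I * z * degDot r (Λ.d σ))) • star (Λ.t σ) :=
  ⟨by fun_prop, fun t => (Λ.dynamics_star_t r t σ).symm⟩

open Classical in
/-- The functional `φ` has the values `φ(t_σ t_τ⋆) = δ_{σ,τ} e^{-r·d(σ)} κ_{s(σ)}`. -/
def HasWeights (r : Fin k → ℝ) (κ : V → ℝ) (φ : Λ.ToeplitzAlgebra →L[ℂ] ℂ) : Prop :=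
  ∀ σ τ, φ (Λ.t σ * star (Λ.t τ)) = if σ = τ then ((Λ.weight r κ σ : ℝ) : ℂ) else 0

/-! ### KMS condition, norm and gap values from the values on monomials -/

section HasWeights
variable {Λ} {r : Fin k → ℝ} {κ : V → ℝ} {φ : Λ.ToeplitzAlgebra →L[ℂ] ℂ}

open Classical in
theorem HasWeights.map_mul_t_mul (h : Λ.HasWeights r κ φ) {σ τ ζ : P} :
    φ (Λ.t σ * Λ.t τ * star (Λ.t ζ)) =
      if Λ.s σ = Λ.r τ ∧ Λ.comp σ τ = ζ then ((Λ.weight r κ ζ : ℝ) : ℂ) else 0 := by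
  by_cases h1 : Λ.s σ = Λ.r τ
  · rw [Λ.t_mul_t h1, h]
    by_cases h2 : Λ.comp σ τ = ζ
    · rw [if_pos h2, if_pos ⟨h1, h2⟩, h2]
    · rw [if_neg h2, if_neg fun h3 => h2 h3.2]
  · rw [Λ.t_mul_t_of_ne h1, zero_mul, map_zero, if_neg fun h3 => h1 h3.1]

theorem HasWeights.map_vtx (h : Λ.HasWeights r κ φ) (v : V) : φ (Λ.t (Λ.vtx v)) = (κ v : ℝ) := by
  have h1 := h (Λ.vtx v) (Λ.vtx v)
  have h2 := Λ.t_eq_monomial (Λ.vtx v)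
  rw [Λ.s_vtx] at h2
  rwa [← h2, if_pos rfl, weight_vtx] at h1

/-- The extensions in `Λ^min(τ,λ)` that contribute to `φ(t_σ t_τ⋆ t_λ)`. -/
theorem mem_minExt_and_comp_iff {σ τ l : P} {p : P × P} :
    (p ∈ Λ.minExt τ l ∧ Λ.s σ = Λ.r p.1 ∧ Λ.comp σ p.1 = p.2) ↔
      (Λ.s l = Λ.r σ ∧ Λ.comp l σ = τ) ∧ p = (Λ.vtx (Λ.s σ), σ) := by
  constructor
  · rintro ⟨hp, h1, h2⟩
    obtain ⟨a1, a2, a3, a4⟩ := Λ.mem_minExt.1 hp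
    have h3 : Λ.s l = Λ.r σ := by rw [a2, ← h2, Λ.r_comp _ _ h1]
    rw [← h2, ← Λ.assoc _ _ _ h3 h1] at a3
    have h4 : Λ.s (Λ.comp l σ) = Λ.r p.1 := by rw [Λ.s_comp _ _ h3, h1]
    have h5 : Λ.d τ = Λ.d (Λ.comp l σ) := by
      have := congrArg Λ.d a3
      rw [Λ.d_comp _ _ a1, Λ.d_comp _ _ h4] at this
      exact add_right_cancel this
    obtain ⟨h6, -⟩ := Λ.comp_inj a1 h4 h5 a3
    have h7 : Λ.d p.1 = 0 := by
      have h8 : Λ.d l ≤ Λ.d τ := by rw [h5, Λ.d_comp _ _ h3]; exact le_self_add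
      rw [Λ.d_comp _ _ a1, sup_eq_left.2 h8] at a4
      exact add_eq_left.1 a4
    have h9 : p.1 = Λ.vtx (Λ.s σ) := by rw [h1]; exact Λ.eq_vtx h7
    exact ⟨⟨h3, h6.symm⟩, Prod.ext h9 (by rw [← h2, h9, Λ.comp_vtx])⟩
  · rintro ⟨⟨h1, rfl⟩, rfl⟩
    refine ⟨Λ.mem_minExt.2 ⟨?_, h1, ?_, ?_⟩, (Λ.r_vtx _).symm, Λ.comp_vtx σ⟩
    · rw [Λ.s_comp _ _ h1, Λ.r_vtx]
    · rw [← Λ.s_comp _ _ h1, Λ.comp_vtx]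
    · rw [← Λ.s_comp _ _ h1, Λ.comp_vtx, eq_comm, sup_eq_left, Λ.d_comp _ _ h1]
      exact le_self_add

/-- The KMS condition for `t_l`. -/
theorem HasWeights.map_t_mul (h : Λ.HasWeights r κ φ) (l : P) (b : Λ.ToeplitzAlgebra) :
    φ (Λ.t l * b) = (Real.exp (-degDot r (Λ.d l)) : ℂ) * φ (b * Λ.t l) := by
  classical
  -- Both sides are bounded and linear in `b`, so it is enough to compare them on monomials.
  suffices h1 : φ.comp (ContinuousLinearMap.mul ℂ _ (Λ.t l)) =
      (Real.exp (-degDot r (Λ.d l)) : ℂ) •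
        φ.comp ((ContinuousLinearMap.mul ℂ Λ.ToeplitzAlgebra).flip (Λ.t l)) from
    congrArg (fun f => f b) h1
  refine Λ.clm_ext fun σ τ => ?_
  change φ (Λ.t l * (Λ.t σ * star (Λ.t τ))) =
    (Real.exp (-degDot r (Λ.d l)) : ℂ) * φ (Λ.t σ * star (Λ.t τ) * Λ.t l)
  rw [← mul_assoc, h.map_mul_t_mul, mul_assoc, Λ.isTCK_t.T5, Finset.mul_sum, map_sum]
  simp only [← mul_assoc, h.map_mul_t_mul]
  rw [← Finset.sum_filter]
  -- At most one minimal extension survives. It does so exactly when `τ = lσ`, which is also the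
  -- condition for the left-hand side to be non-zero.
  have h2 : ∀ p, p ∈ (Λ.minExt τ l).filter (fun p => Λ.s σ = Λ.r p.1 ∧ Λ.comp σ p.1 = p.2) ↔
      (Λ.s l = Λ.r σ ∧ Λ.comp l σ = τ) ∧ p = (Λ.vtx (Λ.s σ), σ) := fun p => by
    rw [Finset.mem_filter, mem_minExt_and_comp_iff]
  split_ifs with h3
  · have h4 : (Λ.minExt τ l).filter (fun p => Λ.s σ = Λ.r p.1 ∧ Λ.comp σ p.1 = p.2) =
        {(Λ.vtx (Λ.s σ), σ)} := by
      ext p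
      rw [h2, Finset.mem_singleton, and_iff_right h3]
    rw [h4, Finset.sum_singleton, ← h3.2, Λ.weight_comp _ _ h3.1]
    push_cast
    rfl
  · have h4 : (Λ.minExt τ l).filter (fun p => Λ.s σ = Λ.r p.1 ∧ Λ.comp σ p.1 = p.2) = ∅ :=
      Finset.eq_empty_of_forall_notMem fun p hp => h3 ((h2 p).1 hp).1
    rw [h4, Finset.sum_empty, mul_zero]

/-- The weights are real. Hermitian symmetry transports the KMS identity from `t_l` to `t_l⋆`. -/
theorem HasWeights.map_star (h : Λ.HasWeights r κ φ) (a : Λ.ToeplitzAlgebra) :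
    φ (star a) = star (φ a) := by
  induction a using toeplitz_induction with
  | monomial σ τ =>
    rw [star_mul, star_star, h, h]
    by_cases hστ : σ = τ
    · subst hστ; simp
    · simp [hστ, Ne.symm hστ]
  | zero => simp
  | add a b ha hb => simp only [star_add, map_add, ha, hb]
  | smul c a ha => simp only [star_smul, map_smul, ha, smul_eq_mul, star_mul']
  | closed a ha =>
    exact (isClosed_eq (φ.continuous.comp continuous_star) (continuous_star.comp φ.continuous)
      ).closure_subset ha

theorem HasWeights.map_star_t_mul (h : Λ.HasWeights r κ φ) (l : P) (b : Λ.ToeplitzAlgebra) :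
    φ (star (Λ.t l) * b) = (Real.exp (degDot r (Λ.d l)) : ℂ) * φ (b * star (Λ.t l)) := by
  have h1 := congrArg star (h.map_t_mul l (star b))
  rw [← h.map_star, star_mul, star_star, star_mul', ← h.map_star, star_mul, star_star] at h1
  rw [h1, Complex.star_def, Complex.conj_ofReal, ← mul_assoc, ← Complex.ofReal_mul,
    ← Real.exp_add]
  simp

theorem HasWeights.map_monomial_mul (h : Λ.HasWeights r κ φ) (σ τ : P) (b : Λ.ToeplitzAlgebra) :
    φ (Λ.t σ * star (Λ.t τ) * b) =
      (Real.exp (-(degDot r (Λ.d σ) - degDot r (Λ.d τ))) : ℂ) *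
        φ (b * (Λ.t σ * star (Λ.t τ))) := by
  rw [mul_assoc, h.map_t_mul, mul_assoc, h.map_star_t_mul, ← mul_assoc, ← Complex.ofReal_mul,
    ← Real.exp_add, mul_assoc]
  congr 3
  ring_nf

/-- The dynamics multiplies a monomial by a phase, which is 1 on the diagonal, and `φ` vanishes
elsewhere. -/
theorem HasWeights.map_dynamics (h : Λ.HasWeights r κ φ) (t : ℝ) (a : Λ.ToeplitzAlgebra) :
    φ (Λ.dynamics r t a) = φ a := by
  induction a using toeplitz_induction with
  | monomial σ τ =>
    rw [dynamics_monomial, map_smul, h]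
    split_ifs with hστ
    · subst hστ; simp
    · simp
  | zero => simp
  | add a b ha hb => simp only [map_add, ha, hb]
  | smul c a ha => simp only [map_smul, ha]
  | closed a ha =>
    exact (isClosed_eq (φ.continuous.comp (Λ.continuous_dynamics r t)) φ.continuous
      ).closure_subset ha

/-- The identity theorem: the real points accumulate at 0. -/
theorem eq_of_eq_on_reals {f g : ℂ → ℂ} (hf : Differentiable ℂ f) (hg : Differentiable ℂ g)
    (h : ∀ t : ℝ, f t = g t) : f = g := by
  refine AnalyticOnNhd.eq_of_frequently_eq (z₀ := 0)
    (Complex.analyticOnNhd_univ_iff_differentiable.2 hf)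
    (Complex.analyticOnNhd_univ_iff_differentiable.2 hg) ?_
  have h1 : Filter.Tendsto (fun t : ℝ => (t : ℂ)) (nhdsWithin 0 {0}ᶜ) (nhdsWithin 0 {0}ᶜ) := by
    refine tendsto_nhdsWithin_of_tendsto_nhds_of_eventually_within _ ?_ ?_
    · exact (Complex.continuous_ofReal.tendsto' 0 0 Complex.ofReal_zero).mono_left
        nhdsWithin_le_nhds
    · filter_upwards [self_mem_nhdsWithin] with t ht
      simpa using ht
  exact h1.frequently (Filter.Frequently.of_forall h)

/-- The second factor may be taken to be a monomial `b`, an eigenvector of the dynamics with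
frequency `c`. Invariance of `φ` gives `φ(b F(t)) = e^{-itc} φ(ba)` for real `t`, hence for all
complex arguments. At `i` the factor is `e^c`, which cancels the `e^{-c}` in the KMS identity for
the monomial `b`. -/
theorem HasWeights.kms (h : Λ.HasWeights r κ φ) {a : Λ.ToeplitzAlgebra}
    {F : ℂ → Λ.ToeplitzAlgebra} (hF : IsAnalyticExtension (fun t => Λ.dynamics r t) a F)
    (b : Λ.ToeplitzAlgebra) : φ (a * b) = φ (b * F (Complex.I * (1 : ℝ))) := by
  suffices h1 : φ.comp (ContinuousLinearMap.mul ℂ _ a) =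
      φ.comp ((ContinuousLinearMap.mul ℂ Λ.ToeplitzAlgebra).flip
        (F (Complex.I * (1 : ℝ)))) from congrArg (fun f => f b) h1
  refine Λ.clm_ext fun σ τ => ?_
  set b := Λ.t σ * star (Λ.t τ) with hb
  set c := degDot r (Λ.d σ) - degDot r (Λ.d τ) with hc
  change φ (a * b) = φ (b * F (Complex.I * (1 : ℝ)))
  have h2 : (fun z => φ (b * F z)) = fun z => Complex.exp (-(Complex.I * z * c)) * φ (b * a) := by
    refine eq_of_eq_on_reals ?_ (by fun_prop) fun t => ?_
    · exact (φ.comp (ContinuousLinearMap.mul ℂ _ b)).differentiable.comp hF.1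
    · have h3 := h.map_dynamics t (b * a)
      rw [map_mul, hb, dynamics_monomial, ← hb, smul_mul_assoc, map_smul, smul_eq_mul] at h3
      rw [← h3, ← mul_assoc, ← Complex.exp_add, hF.2, hc]
      push_cast
      rw [neg_add_cancel, Complex.exp_zero, one_mul]
  have h4 : φ (b * a) = (Real.exp (-c) : ℂ) * φ (a * b) := h.map_monomial_mul σ τ a
  have h5 := congrFun h2 (Complex.I * (1 : ℝ))
  rw [h5, h4, Complex.ofReal_exp, ← mul_assoc (Complex.exp _), ← Complex.exp_add]
  have h6 : -(Complex.I * (Complex.I * ((1 : ℝ) : ℂ)) * c) + ((-c : ℝ) : ℂ) = 0 := by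
    rw [← mul_assoc Complex.I, Complex.I_mul_I]
    push_cast
    ring
  rw [h6, Complex.exp_zero, one_mul]

theorem HasWeights.isKMSState (h : Λ.HasWeights r κ φ) (hφ : IsState φ) :
    IsKMSState (fun t => Λ.dynamics r t) 1 φ :=
  ⟨hφ, fun _ b _ _ hF _ => h.kms hF b⟩

/-- The sum of orthogonal projections is a projection. It serves as the test element that bounds
`‖φ‖` from below, as the algebra carries no unit here. -/
theorem norm_sum_vtx_le [Fintype V] : ‖∑ v, Λ.t (Λ.vtx v)‖ ≤ 1 := by
  set p := ∑ v, Λ.t (Λ.vtx v) with hp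
  have h1 : star p = p := by simp only [hp, star_sum, star_t_vtx]
  have h2 : p * p = p := by
    rw [hp, Finset.sum_mul]
    refine Finset.sum_congr rfl fun v _ => ?_
    rw [Finset.mul_sum, Finset.sum_eq_single v]
    · exact (Λ.isTCK_t.T1_proj v).isIdempotentElem.eq
    · exact fun w _ hw => Λ.isTCK_t.T1_orth v w hw.symm
    · simp
  have h3 : ‖p‖ * ‖p‖ = ‖p‖ := by
    rw [← CStarRing.norm_star_mul_self, h1, h2]
  by_contra h4
  push Not at h4
  nlinarith

theorem HasWeights.one_le_norm [Fintype V] (h : Λ.HasWeights r κ φ) (hκ : ∑ v, κ v = 1) :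
    1 ≤ ‖φ‖ := by
  have h1 : φ (∑ v, Λ.t (Λ.vtx v)) = 1 := by
    rw [map_sum]
    simp only [h.map_vtx]
    rw [← Complex.ofReal_sum, hκ, Complex.ofReal_one]
  have h2 := φ.le_opNorm (∑ v, Λ.t (Λ.vtx v))
  rw [h1, norm_one] at h2
  exact h2.trans (mul_le_of_le_one_right (norm_nonneg _) norm_sum_vtx_le)

/-- The eigenvector equation evaluates the sum over edges. The factor `1 - e^{-r_i} ρ(A_i)` vanishes
for `i` in `K` and is positive outside `K`. -/
theorem HasWeights.map_gap [Fintype V] [DecidableEq V] (h : Λ.HasWeights r κ φ) (i : Fin k)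
    (hP : IsPerronVector (Λ.vertexMatrix i) κ) (v : V) :
    φ (Λ.gap v i) =
      (((1 - Real.exp (-r i) * specRad (Λ.vertexMatrix i)) * κ v : ℝ) : ℂ) := by
  have h1 : ∑ e ∈ Λ.pathsFrom v (Pi.single i 1), Λ.weight r κ e =
      Real.exp (-r i) * (specRad (Λ.vertexMatrix i) * κ v) := by
    have h2 := congrFun hP.2.2 v
    rw [vertexMatrix_mulVec, Pi.smul_apply, smul_eq_mul] at h2
    rw [← h2, Finset.mul_sum]
    refine Finset.sum_congr rfl fun e he => ?_
    rw [weight, (Λ.mem_pathsFrom.1 he).1, degDot_single]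
  rw [gap, map_sub, map_sum, h.map_vtx]
  simp only [h _ _, if_true]
  rw [← Complex.ofReal_sum, h1, ← Complex.ofReal_sub]
  congr 1
  ring

end HasWeights

/-! ### Uniqueness -/

section uniqueness
variable {Λ} {r : Fin k → ℝ} {ψ : Λ.ToeplitzAlgebra →L[ℂ] ℂ}

/-- With `kms_star_mul_t` this moves each of the two factors past the other; composing the two
identities multiplies the value by `e^{r·(d(τ) - d(σ))}`. -/
theorem kms_t_mul_star (h : IsKMSState (fun t => Λ.dynamics r t) 1 ψ) (σ τ : P) :
    ψ (Λ.t σ * star (Λ.t τ)) =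
      (Real.exp (-degDot r (Λ.d σ)) : ℂ) * ψ (star (Λ.t τ) * Λ.t σ) := by
  rw [h.2 _ _ _ _ (Λ.isAnalyticExtension_t r σ) (Λ.isAnalyticExtension_star_t r τ),
    mul_smul_comm, map_smul, smul_eq_mul, Complex.ofReal_exp]
  congr 2
  rw [← mul_assoc, Complex.I_mul_I]
  push_cast
  ring

theorem kms_star_mul_t (h : IsKMSState (fun t => Λ.dynamics r t) 1 ψ) (σ τ : P) :
    ψ (star (Λ.t τ) * Λ.t σ) =
      (Real.exp (degDot r (Λ.d τ)) : ℂ) * ψ (Λ.t σ * star (Λ.t τ)) := by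
  rw [h.2 _ _ _ _ (Λ.isAnalyticExtension_star_t r τ) (Λ.isAnalyticExtension_t r σ),
    mul_smul_comm, map_smul, smul_eq_mul, Complex.ofReal_exp]
  congr 2
  rw [← mul_assoc, Complex.I_mul_I]
  push_cast
  ring

theorem degDot_injective (hr : LinearIndependent ℚ r) {m n : Fin k → ℕ}
    (h : degDot r m = degDot r n) : m = n := by
  have h1 : ∑ i, ((m i : ℚ) - n i) • r i = 0 := by
    simp only [degDot] at h
    simp only [sub_smul, Finset.sum_sub_distrib]
    rw [sub_eq_zero]
    simpa [Rat.smul_def, mul_comm] using h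
  funext i
  have h2 := Fintype.linearIndependent_iff.1 hr _ h1 i
  exact_mod_cast sub_eq_zero.1 h2

theorem minExt_eq_empty {σ τ : P} (hd : Λ.d τ = Λ.d σ) (h : σ ≠ τ) : Λ.minExt τ σ = ∅ := by
  refine Finset.eq_empty_of_forall_notMem fun p hp => h ?_
  obtain ⟨a1, a2, a3, -⟩ := Λ.mem_minExt.1 hp
  exact (Λ.comp_inj a2 a1 hd.symm a3.symm).1

-- For distinct paths of equal degree, `t_τ⋆ t_σ = 0` because there are no common extensions. For
-- different degrees, exchanging the factors twice reproduces the value times `e^{r·(d(τ) - d(σ))}`,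
-- which is not 1 by rational independence.
open Classical in
theorem kms_monomial (hr : LinearIndependent ℚ r)
    (h : IsKMSState (fun t => Λ.dynamics r t) 1 ψ) (σ τ : P) :
    ψ (Λ.t σ * star (Λ.t τ)) =
      if σ = τ then (Real.exp (-degDot r (Λ.d σ)) : ℂ) * ψ (Λ.t (Λ.vtx (Λ.s σ))) else 0 := by
  split_ifs with hστ
  · subst hστ
    rw [kms_t_mul_star h, Λ.isTCK_t.T3]
  · by_cases hd : Λ.d τ = Λ.d σ
    · rw [kms_t_mul_star h, Λ.isTCK_t.T5, minExt_eq_empty hd hστ]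
      simp
    · have h1 := kms_t_mul_star h σ τ
      rw [kms_star_mul_t h, ← mul_assoc, ← Complex.ofReal_mul, ← Real.exp_add] at h1
      by_contra h2
      have h3 := mul_right_cancel₀ h2 ((one_mul _).trans h1)
      have h4 : Real.exp (-degDot r (Λ.d σ) + degDot r (Λ.d τ)) = 1 := by exact_mod_cast h3.symm
      rw [Real.exp_eq_one_iff] at h4
      exact hd (degDot_injective hr (by linarith))

/-- The values `w_v = ψ(t_v)` determine `ψ`. Positivity on (T4) for degree `e_i` makes `w`
subinvariant for `A_i`, precisely because `e^{-r_i} ρ(A_i) = 1`, so `w` is a multiple of `κ`. -/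
theorem kms_eq [Fintype V] [DecidableEq V] [Nonempty V] {κ : V → ℝ}
    (hirr : Λ.CoordinatewiseIrreducible) {i : Fin k}
    (hP : IsPerronVector (Λ.vertexMatrix i) κ)
    (hi : Real.exp (-r i) * specRad (Λ.vertexMatrix i) = 1) (hr : LinearIndependent ℚ r)
    {φ : Λ.ToeplitzAlgebra →L[ℂ] ℂ} (hφ : Λ.HasWeights r κ φ) (hφ1 : ‖φ‖ = 1)
    (h : IsKMSState (fun t => Λ.dynamics r t) 1 ψ) : ψ = φ := by
  classical
  set w : V → ℝ := fun v => (ψ (Λ.t (Λ.vtx v))).re with hw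
  have hw' : ∀ v, 0 ≤ w v ∧ ψ (Λ.t (Λ.vtx v)) = (w v : ℝ) := fun v => by
    have h1 := h.1.1 (Λ.t (Λ.vtx v))
    rw [star_t_vtx, (Λ.isTCK_t.T1_proj v).isIdempotentElem.eq] at h1
    exact ⟨h1.1, Complex.ext (by simp [hw]) (by simp [h1.2])⟩
  have hsub : ∀ v, ((Λ.vertexMatrix i).map (Nat.cast : ℕ → ℝ)).mulVec w v ≤
      specRad (Λ.vertexMatrix i) * w v := fun v => by
    obtain ⟨b, hb⟩ := Λ.isTCK_t.T4 v (Pi.single i 1)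
    have h1 := (h.1.1 b).1
    rw [← hb, map_sub, map_sum, (hw' v).2] at h1
    have h2 : ∀ e ∈ Λ.pathsFrom v (Pi.single i 1), ψ (Λ.t e * star (Λ.t e)) =
        ((Real.exp (-r i) * w (Λ.s e) : ℝ) : ℂ) := fun e he => by
      rw [kms_monomial hr h, if_pos rfl, (hw' _).2, (Λ.mem_pathsFrom.1 he).1, degDot_single]
      push_cast
      rfl
    rw [Finset.sum_congr rfl h2, ← Complex.ofReal_sum, ← Complex.ofReal_sub, Complex.ofReal_re,
      ← Finset.mul_sum, ← vertexMatrix_mulVec] at h1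
    have hρ : 0 ≤ specRad (Λ.vertexMatrix i) := ENNReal.toReal_nonneg
    -- From `e^{-r_i} A_i w ≤ w`: multiplying by `ρ(A_i)` removes the exponential.
    have h3 := mul_le_mul_of_nonneg_left (sub_nonneg.1 h1) hρ
    rw [← mul_assoc, mul_comm _ (Real.exp _), hi, one_mul] at h3
    exact h3
  obtain ⟨t, ht⟩ := hirr.eq_smul hP hsub
  have hψ : ψ = (t : ℂ) • φ := by
    refine Λ.clm_ext fun σ τ => ?_
    rw [smul_apply, hφ, kms_monomial hr h, (hw' _).2, ht]
    split_ifs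
    · rw [weight, Pi.smul_apply]
      simp only [smul_eq_mul]
      push_cast
      ring
    · simp
  have ht0 : 0 ≤ t := by
    obtain ⟨v⟩ := ‹Nonempty V›
    have h1 := (hw' v).1
    rw [ht, Pi.smul_apply, smul_eq_mul] at h1
    exact nonneg_of_mul_nonneg_left h1 (hP.1 v)
  have ht1 : t = 1 := by
    -- Both functionals have norm 1 and `t ≥ 0`, so `t = 1`.
    have h1 := h.1.2
    rw [hψ, norm_smul, hφ1, mul_one, Complex.norm_real, Real.norm_of_nonneg ht0] at h1
    exact h1
  rw [hψ, ht1, Complex.ofReal_one, one_smul]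

end uniqueness

end FiniteKGraph

/-! ### Assembly of the theorem -/

theorem exp_neg_mul_lt_one {ρ r : ℝ} (hρ : 0 ≤ ρ) (h : Real.log ρ < r) :
    Real.exp (-r) * ρ < 1 := by
  obtain rfl | h0 := hρ.eq_or_lt
  · simp
  · rw [Real.exp_neg, inv_mul_lt_one₀ (Real.exp_pos r)]
    exact (Real.log_lt_iff_lt_exp h0).1 h

/-- `Real.log 0 = 0`, so it is the positivity of `r` that excludes `ρ = 0`. -/
theorem exp_neg_mul_eq_one {ρ r : ℝ} (hρ : 0 ≤ ρ) (hr : 0 < r) (h : r = Real.log ρ) :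
    Real.exp (-r) * ρ = 1 := by
  obtain rfl | h0 := hρ.eq_or_lt
  · rw [Real.log_zero] at h
    exact absurd h hr.ne'
  · rw [h, Real.exp_neg, Real.exp_log h0, inv_mul_cancel₀ h0.ne']

/-- The cylinders of the vertices partition the path space according to the range, so the total mass
is read off from (b) at the vertices. -/
theorem FiniteKGraph.PathSpace.tsum_measure_univ {k : ℕ} {V P : Type u} [Fintype V]
    {Λ : FiniteKGraph k V P} {K : Finset (Fin k)}
    (ν : ∀ m : {j // j ∉ K} → ℕ, Measure (Λ.semiPaths K m)) :
    ∑' m, ν m Set.univ = ∑ v, ∑' m, ν m {x | x.1 ∈ cyl (Λ.vtx v)} := by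
  rw [← Summable.tsum_finsetSum fun _ _ => ENNReal.summable]
  refine tsum_congr fun m => ?_
  rw [← measure_biUnion_finset]
  · congr 1
    symm
    refine Set.eq_univ_of_forall fun x => ?_
    simp only [Finset.mem_univ, Set.iUnion_true, Set.mem_iUnion]
    have h := prepend_mem_cyl (Λ.vtx x.1.range) x.1 (Λ.s_vtx _)
    rw [prepend_vtx] at h
    exact ⟨_, h⟩
  · intro v _ w _ hvw
    refine Set.disjoint_left.2 fun x hx hx' => hvw ?_
    rw [← Λ.r_vtx v, ← Λ.r_vtx w, ← range_of_mem_cyl hx, ← range_of_mem_cyl hx']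
  · exact fun v _ => measurable_subtype_coe (Λ.measurableSet_cyl _)

theorem theorem5p1 {k : ℕ} {V P : Type u} [Fintype V] [DecidableEq V] [Nonempty V]
    (Λ : FiniteKGraph k V P) (hirr : Λ.CoordinatewiseIrreducible) (hns : Λ.NoSources)
    (K : Finset (Fin k)) (hK : K.Nonempty) (hJ : Kᶜ.Nonempty)
    (r : Fin k → ℝ) (hr : ∀ i, 0 < r i)
    (hrJ : ∀ j ∉ K, Real.log (specRad (Λ.vertexMatrix j)) < r j)
    (hrK : ∀ i ∈ K, r i = Real.log (specRad (Λ.vertexMatrix i))) :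
    -- the common unimodular Perron-Frobenius eigenvector
    ∃ κ : V → ℝ, (∀ i, IsPerronVector (Λ.vertexMatrix i) κ ∧
        ∀ κ', IsPerronVector (Λ.vertexMatrix i) κ' → κ' = κ) ∧
      ∃ ν : ∀ m : {j // j ∉ K} → ℕ, Measure (Λ.semiPaths K m),
        -- (a)
        (∀ m n l, Λ.d l = FiniteKGraph.joinDeg K m n →
          ν m {x | x.1 ∈ FiniteKGraph.PathSpace.cyl l} =
            ENNReal.ofReal (Real.exp (-degDot r (Λ.d l)) *
              (∏ j ∈ Kᶜ, (1 - Real.exp (-r j) * specRad (Λ.vertexMatrix j))) * κ (Λ.s l))) ∧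
        -- (b)
        (∀ m n l, Λ.d l = FiniteKGraph.joinDeg K m n →
          ∑' p, ν p {x | x.1 ∈ FiniteKGraph.PathSpace.cyl l} =
              ENNReal.ofReal (Real.exp (-degDot r (Λ.d l)) * κ (Λ.s l)) ∧
          ∑' p : {p // m ≤ p}, ν p.1 {x | x.1 ∈ FiniteKGraph.PathSpace.cyl l} =
              ENNReal.ofReal (Real.exp (-degDot r (Λ.d l)) * κ (Λ.s l))) ∧
        -- (c)
        ∃ φ : Λ.ToeplitzAlgebra →L[ℂ] ℂ,
          (∀ a,
            (∀ m, Integrable (fun x => inner ℂ (Λ.pointMass K m x)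
              (Λ.semiRep K (Λ.expectation a) (Λ.pointMass K m x))) (ν m)) ∧
            HasSum (fun m => ∫ x, inner ℂ (Λ.pointMass K m x)
              (Λ.semiRep K (Λ.expectation a) (Λ.pointMass K m x)) ∂ν m) (φ a)) ∧
          IsKMSState (fun t => Λ.dynamics r t) 1 φ ∧
          (∀ l, φ (Λ.t l * star (Λ.t l)) =
            ((Real.exp (-degDot r (Λ.d l)) * κ (Λ.s l) : ℝ) : ℂ)) ∧
          (∀ l l', l ≠ l' → φ (Λ.t l * star (Λ.t l')) = 0) ∧
          -- `φ` factors through the quotient by this ideal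
          (∀ a ∈ closedIdeal {b | ∃ v, ∃ i ∈ K, b = Λ.gap v i}, φ a = 0) ∧
          (∀ j ∉ K, ∀ v, φ (Λ.gap v j) ≠ 0) ∧
          -- (d)
          (LinearIndependent ℚ r →
            ∀ ψ : Λ.ToeplitzAlgebra →L[ℂ] ℂ,
              IsKMSState (fun t => Λ.dynamics r t) 1 ψ → ψ = φ) := by
  have hρ : ∀ i, 0 ≤ specRad (Λ.vertexMatrix i) := fun i => ENNReal.toReal_nonneg
  have hx1 : ∀ i ∈ K, Real.exp (-r i) * specRad (Λ.vertexMatrix i) = 1 := fun i hi =>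
    exp_neg_mul_eq_one (hρ i) (hr i) (hrK i hi)
  have hxJ : ∀ j ∉ K, Real.exp (-r j) * specRad (Λ.vertexMatrix j) < 1 := fun j hj =>
    exp_neg_mul_lt_one (hρ j) (hrJ j hj)
  obtain ⟨i₀, hi₀⟩ := hK
  obtain ⟨κ, hκ⟩ := hirr.exists_perron i₀
  have hP := fun i => (hκ i).1
  have hpos := (hP i₀).1
  have hsum := (hP i₀).2.1
  -- The step probabilities of the walk add up to 1: one unit in every direction of `K` preserves
  -- the weight.
  have hu : ∀ v, ∑ l ∈ Λ.pathsFrom v (FiniteKGraph.joinDeg K 0 1), Λ.weight r κ l = κ v := by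
    intro v
    rw [Λ.sum_weight r hP, FiniteKGraph.prod_pow_joinDeg K hx1]
    simp
  set C := ∏ j ∈ Kᶜ, (1 - Real.exp (-r j) * specRad (Λ.vertexMatrix j)) with hC
  have hC0 : 0 ≤ C := Finset.prod_nonneg fun j hj =>
    (sub_pos.2 (hxJ j (Finset.mem_compl.1 hj))).le
  set ν := Λ.pathMeasure (K := K) hpos hu C with hνdef
  have hb : ∀ m n l, Λ.d l = FiniteKGraph.joinDeg K m n →
      ∑' p, ν p {x | x.1 ∈ FiniteKGraph.PathSpace.cyl l} = ENNReal.ofReal (Λ.weight r κ l) ∧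
      ∑' p : {p // m ≤ p}, ν p.1 {x | x.1 ∈ FiniteKGraph.PathSpace.cyl l} =
        ENNReal.ofReal (Λ.weight r κ l) := fun m n l hl => by
    have h := Λ.tsum_pathMeasure_cyl hpos hu hP hx1 hxJ m n l hl
    exact ⟨(Λ.tsum_measure_cyl hl ν).trans h, h⟩
  have hb' : ∀ l, ∑' p, ν p {x | x.1 ∈ FiniteKGraph.PathSpace.cyl l} =
      ENNReal.ofReal (Λ.weight r κ l) := fun l => by
    obtain ⟨m, n, h⟩ := FiniteKGraph.exists_joinDeg K (Λ.d l)
    exact (hb m n l h).1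
  -- By (b) at the vertices the total mass is `∑ κ_v`.
  have hν : ∑' m, ν m Set.univ = 1 := by
    rw [FiniteKGraph.PathSpace.tsum_measure_univ]
    simp only [hb', Λ.weight_vtx]
    rw [← ENNReal.ofReal_sum_of_nonneg fun v _ => (hpos v).le, hsum, ENNReal.ofReal_one]
  have hφ : Λ.HasWeights r κ (Λ.pathState hν) := fun σ τ => by
    rw [Λ.pathState_monomial, hb', ENNReal.toReal_ofReal (Λ.weight_nonneg hpos σ)]
  have hφ1 : ‖Λ.pathState hν‖ = 1 := le_antisymm (Λ.norm_pathState_le hν) (hφ.one_le_norm hsum)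
  refine ⟨κ, hκ, ν, fun m n l hl => ?_, hb, Λ.pathState hν,
    fun a => ⟨fun m => Λ.integrable_diagFunctional hν m a, Λ.hasSum_pathState hν a⟩,
    hφ.isKMSState ⟨Λ.pathState_star_mul hν, hφ1⟩, fun l => ?_, fun l l' hll => ?_,
    fun a ha => Λ.pathState_of_mem_closedIdeal hν ha, fun j hj v => ?_,
    fun hind ψ hψ => FiniteKGraph.kms_eq hirr (hP i₀) (hx1 i₀ hi₀) hind hφ hφ1 hψ⟩
  · rw [hνdef, Λ.pathMeasure_cyl hpos hu hP hx1 hC0 m n l hl, FiniteKGraph.weight, ← mul_assoc,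
      mul_comm C]
  · rw [hφ l l, if_pos rfl, FiniteKGraph.weight]
  · rw [hφ l l', if_neg hll]
  · rw [hφ.map_gap j (hP j), Ne, Complex.ofReal_eq_zero]
    exact (mul_pos (sub_pos.2 (hxJ j hj)) (hpos v)).ne'
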